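/- Let $n\ge 1$, let $j_0=\begin{pmatrix}0&-I_n\\ I_n&0\end{pmatrix}$, $j_0'=\begin{pmatrix}0&0\\0&j_0\end{pmatrix}\in\mathfrak{so}(1,2n)$, and let $\mathcal T=SO_0(1,2n)/U(n)$, $U(n)=\{C\in SO(2n): Cj_0=j_0C\}$, be the twistor space over the hyperbolic space $H_{2n}$, viewed as the orbit of $j_0'$ under the adjoint action of $SO_0(1,2n)$, with projection $\pi_1:SO_0(1,2n)\to\mathcal T$, $g\mapsto g j_0' g^{-1}$, and base point $t_0=\pi_1(\mathrm{Id})=j_0'$. The map $\pi_{1*}$ at $\mathrm{Id}$ identifies $$\mathfrak p\oplus\mathfrak q=\left\{\begin{pmatrix}0&{}^tu\\u&B\end{pmatrix}: u\in\mathbb R^{2n},\ B\in\mathfrak{so}(2n),\ Bj_0=-j_0B\right\}$$ with $T_{t_0}\mathcal T$. Let $\omega$, $J^+$, $J^-$ be the $SO_0(1,2n)$-invariant tensors on $\mathcal T$ given at $t_0$ by $$\omega_{t_0}(\pi_{1*}A,\pi_{1*}A')=-\operatorname{Tr}\big(j_0'[A,A']\big),\qquad J^{\pm}_{t_0}\,\pi_{1*}\begin{pmatrix}0&{}^tu\\u&B\end{pmatrix}=\pi_{1*}\begin{pmatrix}0&\pm{}^t(j_0u)\\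 \pm j_0u&j_0B\end{pmatrix}\qquad (A,A'\in\mathfrak p\oplus\mathfrak q).$$ An almost complex structure $J$ (a smooth field of endomorphisms of the tangent bundle with $J^2=-\mathrm{Id}$) is called compatible with $\omega$ if $g_J(X,Y)=\omega(X,JY)$ is symmetric, positive if $g_J$ is moreover positive definite, integrable if it is induced by a complex structure (local smooth complex coordinates with holomorphic changes of coordinates, in which $J$ is multiplication by $i$), and maximally non-integrable if at every point the values of its Nijenhuis tensor $N^J(X,Y)=[JX,JY]-J[JX,Y]-J[X,JY]-[X,Y]$ span the whole tangent space. Then $\omega$ (the Kirillov–Kostant–Souriau form) is a symplectic form on $\mathcal T$, and $J^+$, $J^-$ are almost complex structures on $\mathcal T$ such that 1. $J^+$ is compatible with $\omega$ and integrable, but not positive; 2. $J^-$ is compatible with $\omega$ and positive, and, if $n\ge 2$, it is maximally non-integrable. -/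

import Mathlib

open scoped Manifold ContDiff Matrix

/-! ### Almost complex and symplectic structures on a manifold -/

namespace AlmostComplexGeometry

noncomputable section

/-- A vector field `X` on the manifold `M` is smooth. -/
def IsSmoothField {E : Type*} [NormedAddCommGroup E] [NormedSpace ℝ E] {M : Type*}
    [TopologicalSpace M] [ChartedSpace E M] [IsManifold 𝓘(ℝ, E) ∞ M]
    (X : ∀ p : M, TangentSpace 𝓘(ℝ, E) p) : Prop :=
  ContMDiff 𝓘(ℝ, E) 𝓘(ℝ, E).tangent ∞ (fun p => (⟨p, X p⟩ : TangentBundle 𝓘(ℝ, E) M))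

/-- An almost complex structure: a smooth field of endomorphisms of the tangent bundle whose
square is minus the identity. -/
structure IsAlmostComplex {E : Type*} [NormedAddCommGroup E] [NormedSpace ℝ E] {M : Type*}
    [TopologicalSpace M] [ChartedSpace E M] [IsManifold 𝓘(ℝ, E) ∞ M]
    (J : ∀ p : M, TangentSpace 𝓘(ℝ, E) p →ₗ[ℝ] TangentSpace 𝓘(ℝ, E) p) : Prop where
  sq : ∀ (p : M) (v : TangentSpace 𝓘(ℝ, E) p), J p (J p v) = -v
  smooth : ∀ X : (∀ p : M, TangentSpace 𝓘(ℝ, E) p), IsSmoothField X →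
    IsSmoothField (fun p => J p (X p))

/-- The derivative at `p` of the function `f` in the direction of the vector field `X`. -/
def dirDeriv {E : Type*} [NormedAddCommGroup E] [NormedSpace ℝ E] {M : Type*}
    [TopologicalSpace M] [ChartedSpace E M]
    (X : ∀ p : M, TangentSpace 𝓘(ℝ, E) p) (f : M → ℝ) (p : M) : ℝ :=
  mfderiv 𝓘(ℝ, E) 𝓘(ℝ, ℝ) f p (X p)

/-- The exterior derivative `dΩ(X, Y, Z)` of a `2`-form, by the invariant formula. -/
def extDerivTwo {E : Type*} [NormedAddCommGroup E] [NormedSpace ℝ E] {M : Type*}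
    [TopologicalSpace M] [ChartedSpace E M]
    (Ω : ∀ p : M, TangentSpace 𝓘(ℝ, E) p →ₗ[ℝ] TangentSpace 𝓘(ℝ, E) p →ₗ[ℝ] ℝ)
    (X Y Z : ∀ p : M, TangentSpace 𝓘(ℝ, E) p) (p : M) : ℝ :=
  dirDeriv X (fun q => Ω q (Y q) (Z q)) p + dirDeriv Y (fun q => Ω q (Z q) (X q)) p
    + dirDeriv Z (fun q => Ω q (X q) (Y q)) p
    - Ω p (VectorField.mlieBracket 𝓘(ℝ, E) X Y p) (Z p)
    - Ω p (VectorField.mlieBracket 𝓘(ℝ, E) Y Z p) (X p)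
    - Ω p (VectorField.mlieBracket 𝓘(ℝ, E) Z X p) (Y p)

/-- A symplectic form: a smooth, closed, nondegenerate, alternating `2`-form. -/
structure IsSymplectic {E : Type*} [NormedAddCommGroup E] [NormedSpace ℝ E] {M : Type*}
    [TopologicalSpace M] [ChartedSpace E M] [IsManifold 𝓘(ℝ, E) ∞ M]
    (Ω : ∀ p : M, TangentSpace 𝓘(ℝ, E) p →ₗ[ℝ] TangentSpace 𝓘(ℝ, E) p →ₗ[ℝ] ℝ) : Prop where
  alt : ∀ (p : M) (v : TangentSpace 𝓘(ℝ, E) p), Ω p v v = 0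
  nondegenerate : ∀ (p : M) (v : TangentSpace 𝓘(ℝ, E) p), (∀ w, Ω p v w = 0) → v = 0
  smooth : ∀ X Y : (∀ p : M, TangentSpace 𝓘(ℝ, E) p), IsSmoothField X → IsSmoothField Y →
    ContMDiff 𝓘(ℝ, E) 𝓘(ℝ, ℝ) ∞ (fun p => Ω p (X p) (Y p))
  closed : ∀ X Y Z : (∀ p : M, TangentSpace 𝓘(ℝ, E) p),
    IsSmoothField X → IsSmoothField Y → IsSmoothField Z → ∀ p : M, extDerivTwo Ω X Y Z p = 0

/-- `J` is compatible with `Ω`: the tensor `g_J(X, Y) = Ω(X, JY)` is symmetric. -/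
def IsCompatible {E : Type*} [NormedAddCommGroup E] [NormedSpace ℝ E] {M : Type*}
    [TopologicalSpace M] [ChartedSpace E M]
    (Ω : ∀ p : M, TangentSpace 𝓘(ℝ, E) p →ₗ[ℝ] TangentSpace 𝓘(ℝ, E) p →ₗ[ℝ] ℝ)
    (J : ∀ p : M, TangentSpace 𝓘(ℝ, E) p →ₗ[ℝ] TangentSpace 𝓘(ℝ, E) p) : Prop :=
  ∀ (p : M) (v w : TangentSpace 𝓘(ℝ, E) p), Ω p v (J p w) = Ω p w (J p v)

/-- `J` is positive: the tensor `g_J(X, Y) = Ω(X, JY)` is positive definite. -/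
def IsPositive {E : Type*} [NormedAddCommGroup E] [NormedSpace ℝ E] {M : Type*}
    [TopologicalSpace M] [ChartedSpace E M]
    (Ω : ∀ p : M, TangentSpace 𝓘(ℝ, E) p →ₗ[ℝ] TangentSpace 𝓘(ℝ, E) p →ₗ[ℝ] ℝ)
    (J : ∀ p : M, TangentSpace 𝓘(ℝ, E) p →ₗ[ℝ] TangentSpace 𝓘(ℝ, E) p) : Prop :=
  ∀ (p : M) (v : TangentSpace 𝓘(ℝ, E) p), v ≠ 0 → 0 < Ω p v (J p v)

/-- The differential at `p` of a map with values in `ℂ^m`. -/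
def complexDiff {E : Type*} [NormedAddCommGroup E] [NormedSpace ℝ E] {M : Type*}
    [TopologicalSpace M] [ChartedSpace E M] {m : ℕ} (f : M → Fin m → ℂ) (p : M)
    (v : TangentSpace 𝓘(ℝ, E) p) : Fin m → ℂ :=
  mfderiv 𝓘(ℝ, E) 𝓘(ℝ, Fin m → ℂ) f p v

/-- `J` is integrable: it is induced by a complex structure on `M`, that is, `M` is covered by
smooth complex coordinate systems with holomorphic changes of coordinates, in which `J` is the
multiplication by `i`. -/
def IsIntegrable {E : Type*} [NormedAddCommGroup E] [NormedSpace ℝ E] {M : Type*}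
    [TopologicalSpace M] [ChartedSpace E M]
    (J : ∀ p : M, TangentSpace 𝓘(ℝ, E) p →ₗ[ℝ] TangentSpace 𝓘(ℝ, E) p) : Prop :=
  ∃ (m : ℕ) (𝒜 : Set (OpenPartialHomeomorph M (Fin m → ℂ))),
    (∀ p : M, ∃ e ∈ 𝒜, p ∈ e.source) ∧
    (∀ e ∈ 𝒜, ContMDiffOn 𝓘(ℝ, E) 𝓘(ℝ, Fin m → ℂ) ∞ e e.source ∧
      ContMDiffOn 𝓘(ℝ, Fin m → ℂ) 𝓘(ℝ, E) ∞ e.symm e.target) ∧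
    (∀ e ∈ 𝒜, ∀ e' ∈ 𝒜, DifferentiableOn ℂ (e.symm.trans e') (e.symm.trans e').source) ∧
    (∀ e ∈ 𝒜, ∀ p ∈ e.source, ∀ v : TangentSpace 𝓘(ℝ, E) p,
      complexDiff e p (J p v) = Complex.I • complexDiff e p v)

/-- The Nijenhuis tensor `N^J(X, Y) = [JX, JY] - J[JX, Y] - J[X, JY] - [X, Y]`. -/
def nijenhuis {E : Type*} [NormedAddCommGroup E] [NormedSpace ℝ E] {M : Type*}
    [TopologicalSpace M] [ChartedSpace E M]
    (J : ∀ p : M, TangentSpace 𝓘(ℝ, E) p →ₗ[ℝ] TangentSpace 𝓘(ℝ, E) p)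
    (X Y : ∀ p : M, TangentSpace 𝓘(ℝ, E) p) (p : M) : TangentSpace 𝓘(ℝ, E) p :=
  VectorField.mlieBracket 𝓘(ℝ, E) (fun q => J q (X q)) (fun q => J q (Y q)) p
    - J p (VectorField.mlieBracket 𝓘(ℝ, E) (fun q => J q (X q)) Y p)
    - J p (VectorField.mlieBracket 𝓘(ℝ, E) X (fun q => J q (Y q)) p)
    - VectorField.mlieBracket 𝓘(ℝ, E) X Y p

/-- The image of the Nijenhuis tensor at `p`: the subspace of `T_p M` spanned by its values. -/
def nijenhuisImage {E : Type*} [NormedAddCommGroup E] [NormedSpace ℝ E] {M : Type*}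
    [TopologicalSpace M] [ChartedSpace E M] [IsManifold 𝓘(ℝ, E) ∞ M]
    (J : ∀ p : M, TangentSpace 𝓘(ℝ, E) p →ₗ[ℝ] TangentSpace 𝓘(ℝ, E) p) (p : M) :
    Submodule ℝ (TangentSpace 𝓘(ℝ, E) p) :=
  Submodule.span ℝ {v | ∃ X Y : (∀ q : M, TangentSpace 𝓘(ℝ, E) q),
    IsSmoothField X ∧ IsSmoothField Y ∧ nijenhuis J X Y p = v}

/-- `J` is maximally non integrable. -/
def IsMaximallyNonIntegrable {E : Type*} [NormedAddCommGroup E] [NormedSpace ℝ E] {M : Type*}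
    [TopologicalSpace M] [ChartedSpace E M] [IsManifold 𝓘(ℝ, E) ∞ M]
    (J : ∀ p : M, TangentSpace 𝓘(ℝ, E) p →ₗ[ℝ] TangentSpace 𝓘(ℝ, E) p) : Prop :=
  ∀ p : M, nijenhuisImage J p = ⊤

end

end AlmostComplexGeometry

/-! ### The twistor space over hyperbolic space -/

namespace HypTwistor

noncomputable section

/-- The indices `1, …, 2n` of the space coordinates. -/
abbrev SIdx (n : ℕ) : Type := Fin n ⊕ Fin n
/-- The indices `0, 1, …, 2n` of the coordinates of `ℝ^{1,2n}`; the index `Sum.inl ()` is `0`. -/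
abbrev LIdx (n : ℕ) : Type := Unit ⊕ SIdx n
abbrev SMat (n : ℕ) : Type := Matrix (SIdx n) (SIdx n) ℝ
abbrev LMat (n : ℕ) : Type := Matrix (LIdx n) (LIdx n) ℝ

/-- The matrix `diag(1, -1, …, -1)`: minus the Lorentzian scalar product. -/
def eta (n : ℕ) : LMat n := LieAlgebra.Orthogonal.indefiniteDiagonal Unit (SIdx n) ℝ

/-- The group `SO₀(1,2n)`: the Lorentz matrices of determinant `1` that preserve the sheet
`x⁰ > 0` of the hyperboloid. -/
def SO0 (n : ℕ) : Set (LMat n) :=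
  {g | gᵀ * eta n * g = eta n ∧ g.det = 1 ∧ 0 < g (Sum.inl ()) (Sum.inl ())}

/-- `j₀ = (0 -I; I 0)`. -/
def j0 (n : ℕ) : SMat n := Matrix.J (Fin n) ℝ

/-- `j₀' = (0 0; 0 j₀) ∈ so(1,2n)`, the base point of the twistor space. -/
def t0 (n : ℕ) : LMat n := Matrix.fromBlocks 0 0 0 (j0 n)

/-- The twistor space over `H_{2n}`, as the orbit of `j₀'` under the adjoint action of `SO₀(1,2n)`.
The matrix `X = g j₀' g⁻¹` represents the point `x = g e₀` of `H_{2n}` (its kernel is `ℝ x`) and the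
complex structure on `T_x H_{2n} = x^⊥` given by `X`, which is `j₀` in the oriented orthonormal
basis `g e₁, …, g e_{2n}`. The isotropy group of `j₀'` is `U(n)`, see `stabilizer_t0`. -/
abbrev Twistor (n : ℕ) : Type := {X : LMat n // ∃ g ∈ SO0 n, X = g * t0 n * g⁻¹}

/-- The space `𝔮` of the `B ∈ so(2n)` with `B j₀ = -j₀ B`. -/
def qSpace (n : ℕ) : Submodule ℝ (SMat n) where
  carrier := {B | Bᵀ = -B ∧ B * j0 n = -(j0 n * B)}
  add_mem' := by
    rintro A B ⟨h1, h2⟩ ⟨h3, h4⟩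
    exact ⟨by rw [Matrix.transpose_add, h1, h3]; abel, by rw [add_mul, mul_add, h2, h4]; abel⟩
  zero_mem' := by simp
  smul_mem' := by
    rintro c A ⟨h1, h2⟩
    exact ⟨by rw [Matrix.transpose_smul, h1, smul_neg],
      by rw [smul_mul_assoc, h2, mul_smul_comm, smul_neg]⟩

section
attribute [local instance] Matrix.linftyOpNormedRing Matrix.linftyOpNormedAlgebra

/-- The space `𝔭 ⊕ 𝔮 = {(u, B)}`, on which the twistor space is modelled. -/
def Model (n : ℕ) : Type := (SIdx n → ℝ) × qSpace n
instance (n : ℕ) : NormedAddCommGroup (Model n) :=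
  inferInstanceAs (NormedAddCommGroup ((SIdx n → ℝ) × qSpace n))
instance (n : ℕ) : NormedSpace ℝ (Model n) :=
  inferInstanceAs (NormedSpace ℝ ((SIdx n → ℝ) × qSpace n))
instance (n : ℕ) : FiniteDimensional ℝ (Model n) :=
  inferInstanceAs (FiniteDimensional ℝ ((SIdx n → ℝ) × qSpace n))
end

/-! Lorentz matrices. -/

theorem j0_sq (n : ℕ) : j0 n * j0 n = -1 := Matrix.J_squared _ _
theorem j0_t (n : ℕ) : (j0 n)ᵀ = -j0 n := Matrix.J_transpose _ _

theorem eta_eq (n : ℕ) : eta n = Matrix.fromBlocks 1 0 0 (-1) := by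
  unfold eta LieAlgebra.Orthogonal.indefiniteDiagonal
  ext (i | i) (j | j) <;> simp [Matrix.diagonal_apply, Matrix.one_apply]
  split_ifs <;> simp

theorem eta_t (n : ℕ) : (eta n)ᵀ = eta n := by simp [eta_eq, Matrix.fromBlocks_transpose]
theorem eta_sq (n : ℕ) : eta n * eta n = 1 := by
  simp [eta_eq, Matrix.fromBlocks_multiply, Matrix.fromBlocks_one]

/-- The `0`-th coordinate of the point of hyperbolic space over `y`. -/
def cc {n : ℕ} (y : SIdx n → ℝ) : ℝ := Real.sqrt (1 + y ⬝ᵥ y)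

/-- The sum of `e₀` and the point of hyperbolic space over `y`. -/
def mm {n : ℕ} (y : SIdx n → ℝ) : LIdx n → ℝ := Sum.elim (fun _ => 1 + cc y) y

/-- The Lorentz half-turn exchanging `e₀` and the point `(√(1+|y|²), y)` of hyperbolic space. -/
def hs {n : ℕ} (y : SIdx n → ℝ) : LMat n :=
  (1 / (1 + cc y)) • (Matrix.vecMulVec (mm y) (mm y) * eta n) - 1

theorem cc_sq {n : ℕ} (y : SIdx n → ℝ) : cc y ^ 2 = 1 + y ⬝ᵥ y := by
  have : 0 ≤ y ⬝ᵥ y := by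
    simp only [dotProduct]; exact Finset.sum_nonneg fun i _ => mul_self_nonneg _
  rw [cc, Real.sq_sqrt (by linarith)]

theorem cc_pos {n : ℕ} (y : SIdx n → ℝ) : 0 < cc y := by
  have : 0 ≤ y ⬝ᵥ y := by
    simp only [dotProduct]; exact Finset.sum_nonneg fun i _ => mul_self_nonneg _
  exact Real.sqrt_pos.2 (by linarith)

theorem mm_eta {n : ℕ} (y : SIdx n → ℝ) :
    mm y ᵥ* eta n = Sum.elim (fun _ => 1 + cc y) (-y) := by
  ext (i | i) <;> simp [eta, LieAlgebra.Orthogonal.indefiniteDiagonal, Matrix.vecMul_diagonal, mm]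

theorem mm_dot {n : ℕ} (y : SIdx n → ℝ) :
    (mm y ᵥ* eta n) ⬝ᵥ mm y = 2 * (1 + cc y) := by
  rw [mm_eta]
  simp only [dotProduct, mm, Fintype.sum_sum_type, Sum.elim_inl, Sum.elim_inr]
  have := cc_sq y
  simp only [dotProduct, Fintype.sum_sum_type] at this
  simp
  nlinarith

theorem hs_eq {n : ℕ} (y : SIdx n → ℝ) :
    hs y = (1 / (1 + cc y)) • Matrix.vecMulVec (mm y) (mm y ᵥ* eta n) - 1 := by
  rw [hs, Matrix.vecMulVec_mul]

theorem hs_sq {n : ℕ} (y : SIdx n → ℝ) : hs y * hs y = 1 := by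
  have h := mm_dot y
  have hc := cc_pos y
  rw [hs_eq, sub_mul, mul_sub, mul_sub, smul_mul_smul_comm, Matrix.vecMulVec_mul_vecMulVec, h]
  simp only [one_mul, mul_one, Matrix.vecMulVec_smul, smul_smul]
  have : 1 / (1 + cc y) * (1 / (1 + cc y)) * (2 * (1 + cc y)) = 1/(1+cc y) + 1 / (1 + cc y) := by
    field_simp; norm_num
  rw [this, add_smul]
  abel

theorem hs_t {n : ℕ} (y : SIdx n → ℝ) : (hs y)ᵀ * eta n = eta n * hs y := by
  rw [hs, Matrix.transpose_sub, Matrix.transpose_smul, Matrix.transpose_mul, eta_t,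
    Matrix.transpose_vecMulVec, sub_mul, mul_sub]
  simp [mul_assoc]

theorem hs_det {n : ℕ} (y : SIdx n → ℝ) : (hs y).det = 1 := by
  have hc := cc_pos y
  have h1 : hs y = -(1 - Matrix.replicateCol Unit ((1 / (1 + cc y)) • mm y) *
      Matrix.replicateRow Unit (mm y ᵥ* eta n)) := by
    rw [hs_eq, ← Matrix.vecMulVec_eq, Matrix.smul_vecMulVec]; abel
  rw [h1, Matrix.det_neg, Matrix.det_one_sub_mul_comm]
  have h2 : (Matrix.replicateRow Unit (mm y ᵥ* eta n) *
      Matrix.replicateCol Unit ((1 / (1 + cc y)) • mm y)) = (2 : ℝ) • (1 : Matrix Unit Unit ℝ) := by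
    ext i j
    have := mm_dot y
    simp only [Matrix.mul_apply, Matrix.replicateRow_apply, Matrix.replicateCol_apply,
      Pi.smul_apply, smul_eq_mul, Matrix.smul_apply, Matrix.one_apply_eq]
    simp only [dotProduct] at this
    calc _ = (1 / (1 + cc y)) * ∑ x, (mm y ᵥ* eta n) x * mm y x := by
          rw [Finset.mul_sum]; exact Finset.sum_congr rfl fun _ _ => by ring
      _ = _ := by rw [this]; field_simp
  rw [h2]
  have h3 : Fintype.card (LIdx n) = 2 * n + 1 := by
    simp [LIdx, SIdx]; ring
  rw [h3, pow_succ, pow_mul]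
  simp
  norm_num

theorem hs_col {n : ℕ} (y : SIdx n → ℝ) (i : LIdx n) :
    hs y i (Sum.inl ()) = Sum.elim (fun _ => cc y) y i := by
  have hc := cc_pos y
  rw [hs_eq, mm_eta]
  rcases i with i | i <;> simp [Matrix.vecMulVec_apply, mm] <;> field_simp
  ring

/-- Rotations of the spatial directions. -/
def dg {n : ℕ} (C : SMat n) : LMat n := Matrix.fromBlocks 1 0 0 C

theorem SO0_mk {n : ℕ} (y : SIdx n → ℝ) {C : SMat n} (hC : Cᵀ * C = 1) (hd : C.det = 1) :
    hs y * dg C ∈ SO0 n := by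
  have h1 : (dg C)ᵀ * eta n * dg C = eta n := by
    simp [dg, eta_eq, Matrix.fromBlocks_transpose, Matrix.fromBlocks_multiply, hC]
  refine ⟨?_, ?_, ?_⟩
  · rw [Matrix.transpose_mul]
    calc _ = (dg C)ᵀ * ((hs y)ᵀ * eta n) * hs y * dg C := by simp only [mul_assoc]
      _ = (dg C)ᵀ * eta n * (hs y * hs y) * dg C := by rw [hs_t]; simp only [mul_assoc]
      _ = _ := by rw [hs_sq, mul_one, h1]
  · rw [Matrix.det_mul, hs_det, dg, Matrix.det_fromBlocks_zero₂₁, hd]; simp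
  · have : (hs y * dg C) (Sum.inl ()) (Sum.inl ()) = cc y := by
      rw [Matrix.mul_apply, Fintype.sum_sum_type]
      simp [dg, hs_col]
    rw [this]; exact cc_pos y

theorem SO0_dec {n : ℕ} {g : LMat n} (hg : g ∈ SO0 n) :
    ∃ (y : SIdx n → ℝ) (C : SMat n), Cᵀ * C = 1 ∧ C.det = 1 ∧ g = hs y * dg C := by
  obtain ⟨h1, h2, h3⟩ := hg
  set y : SIdx n → ℝ := fun i => g (Sum.inr i) (Sum.inl ()) with hy
  have hc : g (Sum.inl ()) (Sum.inl ()) = cc y := by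
    have := congrFun (congrFun h1 (Sum.inl ())) (Sum.inl ())
    rw [eta, LieAlgebra.Orthogonal.indefiniteDiagonal, Matrix.mul_apply] at this
    simp only [Matrix.mul_diagonal, Matrix.transpose_apply, Fintype.sum_sum_type] at this
    simp at this
    rw [cc, eq_comm, Real.sqrt_eq_iff_mul_self_eq_of_pos h3]
    simp only [dotProduct, hy, Fintype.sum_sum_type]
    linarith
  have hcol : ∀ i, g i (Sum.inl ()) = hs y i (Sum.inl ()) := by
    intro i; rw [hs_col]; rcases i with i | i
    · simpa using hc
    · simp [hy]
  set h := hs y * g with hh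
  have hO : hᵀ * eta n * h = eta n := by
    rw [hh, Matrix.transpose_mul]
    calc _ = gᵀ * ((hs y)ᵀ * eta n) * hs y * g := by simp only [mul_assoc]
      _ = gᵀ * eta n * (hs y * hs y) * g := by rw [hs_t]; simp only [mul_assoc]
      _ = _ := by rw [hs_sq, mul_one, h1]
  have hcol' : ∀ i, h i (Sum.inl ()) = (1 : LMat n) i (Sum.inl ()) := by
    intro i
    rw [hh, Matrix.mul_apply, ← hs_sq y, Matrix.mul_apply]
    exact Finset.sum_congr rfl fun k _ => by rw [hcol]
  have hrow : ∀ k, h (Sum.inl ()) (Sum.inr k) = 0 := by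
    intro k
    have := congrFun (congrFun hO (Sum.inl ())) (Sum.inr k)
    rw [eta, LieAlgebra.Orthogonal.indefiniteDiagonal, Matrix.mul_apply] at this
    simp only [Matrix.mul_diagonal, Matrix.transpose_apply, Fintype.sum_sum_type, hcol'] at this
    simpa [Matrix.one_apply] using this
  have hblk : h = dg h.toBlocks₂₂ := by
    ext (i | i) (j | j)
    · have := hcol' (Sum.inl ()); simpa [dg] using this
    · simpa [dg] using hrow j
    · have := hcol' (Sum.inr i); simpa [dg] using this
    · simp [dg, Matrix.toBlocks₂₂]
  refine ⟨y, h.toBlocks₂₂, ?_, ?_, ?_⟩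
  · rw [hblk, eta_eq] at hO
    simp only [dg, Matrix.fromBlocks_transpose, Matrix.fromBlocks_multiply] at hO
    have := congrArg Matrix.toBlocks₂₂ hO
    simpa using this
  · have hd : h.det = 1 := by rw [hh, Matrix.det_mul, hs_det, h2, one_mul]
    rw [hblk, dg, Matrix.det_fromBlocks_zero₂₁] at hd
    simpa using hd
  · rw [← hblk, hh, ← mul_assoc, hs_sq, one_mul]

theorem SO0_inv {n : ℕ} (y : SIdx n → ℝ) {C : SMat n} (hC : Cᵀ * C = 1) :
    (hs y * dg C)⁻¹ = dg Cᵀ * hs y := by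
  apply Matrix.inv_eq_left_inv
  have : dg Cᵀ * dg C = 1 := by
    simp [dg, Matrix.fromBlocks_multiply, hC, Matrix.fromBlocks_one]
  calc _ = dg Cᵀ * (hs y * hs y) * dg C := by simp only [mul_assoc]
    _ = 1 := by rw [hs_sq, mul_one, this]

/-- `(0 0; 0 j)`. -/
def ext0 {n : ℕ} (j : SMat n) : LMat n := Matrix.fromBlocks 0 0 0 j

theorem mem_iff {n : ℕ} (X : LMat n) : (∃ g ∈ SO0 n, X = g * t0 n * g⁻¹) ↔
    ∃ (y : SIdx n → ℝ) (C : SMat n), Cᵀ * C = 1 ∧ C.det = 1 ∧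
      X = hs y * ext0 (C * j0 n * Cᵀ) * hs y := by
  have key : ∀ (y : SIdx n → ℝ) (C : SMat n), Cᵀ * C = 1 →
      (hs y * dg C) * t0 n * (hs y * dg C)⁻¹ = hs y * ext0 (C * j0 n * Cᵀ) * hs y := by
    intro y C hC
    rw [SO0_inv y hC]
    have : dg C * t0 n * dg Cᵀ = ext0 (C * j0 n * Cᵀ) := by
      simp [dg, t0, ext0, Matrix.fromBlocks_multiply]
    rw [← this]; simp only [mul_assoc]
  constructor
  · rintro ⟨g, hg, rfl⟩
    obtain ⟨y, C, hC, hd, rfl⟩ := SO0_dec hg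
    exact ⟨y, C, hC, hd, key y C hC⟩
  · rintro ⟨y, C, hC, hd, rfl⟩
    exact ⟨_, SO0_mk y hC hd, (key y C hC).symm⟩


/-- The Cayley transform. -/
def cay {n : ℕ} (S : SMat n) : SMat n := (1 + S) * (1 - S)⁻¹

theorem one_sub_skew_det {n : ℕ} {S : SMat n} (hS : Sᵀ = -S) : IsUnit (1 - S).det := by
  have h : (1 + Sᵀ * S).PosDef :=
    Matrix.PosDef.add_posSemidef Matrix.PosDef.one (Matrix.posSemidef_conjTranspose_mul_self S)
  have h2 : 1 + Sᵀ * S = (1 + S) * (1 - S) := by rw [hS]; noncomm_ring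
  have h3 := h.det_pos
  rw [h2, Matrix.det_mul] at h3
  exact isUnit_iff_ne_zero.2 fun h4 => by simp [h4] at h3

theorem one_add_skew_det {n : ℕ} {S : SMat n} (hS : Sᵀ = -S) : 0 < (1 + S).det := by
  have hne : ∀ t : ℝ, (1 + t • S).det ≠ 0 := by
    intro t
    have := one_sub_skew_det (S := -(t • S)) (by simp [hS])
    rw [sub_neg_eq_add] at this
    exact this.ne_zero
  have hcont : Continuous fun t : ℝ => (1 + t • S).det := by fun_prop
  by_contra hneg
  push Not at hneg
  have h0 : (0 : ℝ) ∈ (fun t : ℝ => (1 + t • S).det) '' Set.Icc 0 1 := by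
    apply intermediate_value_Icc' zero_le_one hcont.continuousOn
    simp [hneg]
  obtain ⟨t, _, ht⟩ := h0
  exact hne t ht

/-- For `S ∈ 𝔮`, the matrix `cay S * j0` lies in the rotation orbit of `j0`. -/
theorem cay_orbit {n : ℕ} {S : SMat n} (hS : S ∈ qSpace n) :
    ∃ C : SMat n, Cᵀ * C = 1 ∧ C.det = 1 ∧ cay S * j0 n = C * j0 n * Cᵀ := by
  obtain ⟨h1, h2⟩ := hS
  set A : SMat n := 1 + Sᵀ * S with hA
  have hA' : A = 1 - S * S := by rw [hA, h1]; noncomm_ring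
  have hpd : A.PosDef :=
    Matrix.PosDef.add_posSemidef Matrix.PosDef.one (Matrix.posSemidef_conjTranspose_mul_self S)
  have hsa : IsSelfAdjoint A := hpd.1
  set f : ℝ → ℝ := fun x => x ^ (-(1 / 4) : ℝ) with hf
  set K : SMat n := cfc f A with hK
  have hspec : ∀ x ∈ spectrum ℝ A, 0 < x := by
    intro x hx
    rw [hpd.1.spectrum_real_eq_range_eigenvalues] at hx
    obtain ⟨i, rfl⟩ := hx
    exact hpd.eigenvalues_pos i
  have hfc : ContinuousOn f (spectrum ℝ A) := fun x hx =>
    (Real.continuousAt_rpow_const _ _ (Or.inl (hspec x hx).ne')).continuousWithinAt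
  have hKA : K * K * A * (K * K) = 1 := by
    have hid : A = cfc (id : ℝ → ℝ) A := (cfc_id ℝ A).symm
    have hff : ContinuousOn (fun x => f x * f x) (spectrum ℝ A) := hfc.mul hfc
    have e1 : K * K = cfc (fun x => f x * f x) A := (cfc_mul f f A hfc hfc).symm
    rw [e1]
    have e2 : cfc (fun x => f x * f x) A * A = cfc (fun x => f x * f x * x) A := by
      conv_lhs => rw [show cfc (fun x => f x * f x) A * A
        = cfc (fun x => f x * f x) A * cfc (id : ℝ → ℝ) A by rw [← hid]]
      exact (cfc_mul (fun x => f x * f x) id A hff continuousOn_id).symm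
    rw [e2, ← cfc_mul (fun x => f x * f x * x) (fun x => f x * f x) A
      (hff.mul continuousOn_id) hff]
    rw [← cfc_one ℝ A]
    apply cfc_congr
    intro x hx
    have hx := hspec x hx
    simp only [hf, Pi.one_apply]
    rw [← Real.rpow_add hx, ← Real.rpow_add_one hx.ne', ← Real.rpow_add hx]
    norm_num
  have hcomm : ∀ B : SMat n, Commute A B → Commute K B := fun B hB =>
    Commute.cfc hB (by rw [hsa.star_eq]; exact hB) f
  have hKt : Kᵀ = K := by
    have : IsSelfAdjoint K := cfc_predicate f A
    exact this
  have hAS : Commute A S := by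
    rw [hA']; exact ((Commute.one_left S).sub_left ((Commute.refl S).mul_left (Commute.refl S)))
  have hAj : Commute A (j0 n) := by
    rw [hA']
    apply (Commute.one_left _).sub_left
    show S * S * j0 n = j0 n * (S * S)
    rw [mul_assoc, h2, mul_neg, ← mul_assoc, h2]; noncomm_ring
  have hKS := hcomm S hAS
  have hKj := hcomm _ hAj
  have hKA' := hcomm _ (Commute.refl A)
  refine ⟨(1 + S) * (K * K), ?_, ?_, ?_⟩
  · rw [Matrix.transpose_mul, Matrix.transpose_mul, hKt, Matrix.transpose_add, h1,
      Matrix.transpose_one]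
    calc _ = K * K * ((1 + -S) * (1 + S)) * (K * K) := by simp only [mul_assoc]
      _ = K * K * A * (K * K) := by
          congr 2; rw [hA']; noncomm_ring
      _ = 1 := hKA
  · have hsq : ((1 + S) * (K * K)).det ^ 2 = 1 := by
      have e : (1 + S).det ^ 2 = A.det := by
        have : (1 - S).det = (1 + S).det := by
          rw [← Matrix.det_transpose, Matrix.transpose_sub, h1, Matrix.transpose_one,
            sub_neg_eq_add]
        rw [sq]; nth_rewrite 2 [← this]; rw [← Matrix.det_mul]; congr 1; rw [hA']; noncomm_ring
      have e2 := congrArg Matrix.det hKA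
      simp only [Matrix.det_mul, Matrix.det_one] at e2 ⊢
      rw [mul_pow, e]; linarith
    have hpos : 0 ≤ ((1 + S) * (K * K)).det := by
      rw [Matrix.det_mul, Matrix.det_mul]
      exact mul_nonneg (one_add_skew_det h1).le (mul_self_nonneg _)
    nlinarith [sq_nonneg (((1 + S) * (K * K)).det - 1)]
  · have hu := one_sub_skew_det h1
    have e1 : (1 - S) * (K * K * (K * K)) * (1 + S) = 1 := by
      have c1 : Commute (K * K) (1 - S) :=
        ((Commute.one_right _).sub_right (hKS.mul_left hKS))
      have c2 : Commute (K * K) (1 + S) :=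
        ((Commute.one_right _).add_right (hKS.mul_left hKS))
      calc _ = ((1 - S) * (K * K)) * ((K * K) * (1 + S)) := by simp only [mul_assoc]
        _ = (K * K) * ((1 - S) * (1 + S)) * (K * K) := by
            rw [← c1.eq, c2.eq]; simp only [mul_assoc]
        _ = K * K * A * (K * K) := by congr 2; rw [hA']; noncomm_ring
        _ = 1 := hKA
    have e2 : (1 - S)⁻¹ = (K * K * (K * K)) * (1 + S) := by
      apply Matrix.inv_eq_right_inv
      rw [← mul_assoc, e1]
    have hj : (1 + S) * j0 n = j0 n * (1 - S) := by
      rw [add_mul, h2, mul_sub]; noncomm_ring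
    have hKK : Commute (K * K) (j0 n) := hKj.mul_left hKj
    rw [cay, e2, Matrix.transpose_mul, Matrix.transpose_mul, hKt, Matrix.transpose_add, h1,
      Matrix.transpose_one]
    have hK4 : Commute (K * K * (K * K)) (j0 n) := hKK.mul_left hKK
    have c2 : Commute (K * K) (1 - S) := ((Commute.one_right _).sub_right (hKS.mul_left hKS))
    calc _ = (1 + S) * (K * K * (K * K)) * ((1 + S) * j0 n) := by simp only [mul_assoc]
      _ = (1 + S) * ((K * K * (K * K)) * j0 n) * (1 - S) := by rw [hj]; simp only [mul_assoc]
      _ = (1 + S) * (K * K * (K * K) * j0 n) * (1 - S) := by rfl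
      _ = (1 + S) * (K * K) * (K * K * j0 n) * (1 - S) := by simp only [mul_assoc]
      _ = (1 + S) * (K * K) * j0 n * (K * K * (1 - S)) := by rw [hKK.eq]; simp only [mul_assoc]
      _ = _ := by simp only [sub_eq_add_neg, mul_assoc]

/-- Conversely, an orthogonal complex structure near `j0` is `cay S * j0` with `S ∈ 𝔮`. -/
theorem icay_mem {n : ℕ} {j : SMat n} (h1 : jᵀ = -j) (h2 : j * j = -1)
    (hu : IsUnit (-(j * j0 n) + 1).det) :
    (-(j * j0 n) + 1)⁻¹ * (-(j * j0 n) - 1) ∈ qSpace n ∧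
    cay ((-(j * j0 n) + 1)⁻¹ * (-(j * j0 n) - 1)) * j0 n = j := by
  have hj := j0_sq n
  have hjt := j0_t n
  set R : SMat n := -(j * j0 n) with hR
  have hRt : Rᵀ = -(j0 n * j) := by rw [hR]; simp [Matrix.transpose_mul, h1, hjt]
  have hRR : R * Rᵀ = 1 := by
    rw [hRt, hR]
    calc _ = j * (j0 n * j0 n) * j := by noncomm_ring
      _ = 1 := by rw [hj, mul_neg, neg_mul, mul_one, h2, neg_neg]
  have hRR' : Rᵀ * R = 1 := by
    rw [hRt, hR]
    calc _ = j0 n * (j * j) * j0 n := by noncomm_ring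
      _ = 1 := by rw [h2, mul_neg, neg_mul, mul_one, hj, neg_neg]
  have hRj : R * j0 n = j0 n * Rᵀ := by
    rw [hRt, hR]
    calc _ = - (j * (j0 n * j0 n)) := by noncomm_ring
      _ = -((j0 n * j0 n) * j) := by rw [hj]; noncomm_ring
      _ = _ := by noncomm_ring
  have hRj' : Rᵀ * j0 n = j0 n * R := by
    rw [hRt, hR]; noncomm_ring
  have hut : IsUnit (Rᵀ + 1).det := by
    rw [← Matrix.det_transpose]; simpa using hu
  set S := (R + 1)⁻¹ * (R - 1) with hS
  have hRS : (R + 1) * S = R - 1 := by rw [hS, Matrix.mul_nonsing_inv_cancel_left _ _ hu]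
  have hcom : S = (R - 1) * (R + 1)⁻¹ := by
    rw [hS]
    have : (R + 1) * (R - 1) = (R - 1) * (R + 1) := by noncomm_ring
    calc _ = (R + 1)⁻¹ * ((R - 1) * (R + 1)) * (R + 1)⁻¹ := by
          rw [mul_assoc, Matrix.mul_nonsing_inv_cancel_right _ _ hu]
      _ = _ := by rw [← this, Matrix.nonsing_inv_mul_cancel_left _ _ hu]
  have hSR : S * (R + 1) = R - 1 := by rw [hcom, Matrix.nonsing_inv_mul_cancel_right _ _ hu]
  have hcanc : ∀ Z W : SMat n, (R + 1) * Z = (R + 1) * W → Z = W := by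
    intro Z W h
    have := congrArg ((R + 1)⁻¹ * ·) h
    simpa [Matrix.nonsing_inv_mul_cancel_left _ _ hu] using this
  clear_value S
  have hSt : Sᵀ = -S := by
    have e1 : Sᵀ * (Rᵀ + 1) = Rᵀ - 1 := by
      have := congrArg Matrix.transpose hRS
      simpa [Matrix.transpose_mul] using this
    have e2 : (-S) * (Rᵀ + 1) = Rᵀ - 1 := by
      calc (-S) * (Rᵀ + 1) = -(S * (R * Rᵀ + Rᵀ)) := by
            rw [hRR, neg_mul, add_comm]
        _ = -(S * (R + 1) * Rᵀ) := by noncomm_ring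
        _ = _ := by rw [hSR, sub_mul, hRR]; noncomm_ring
    have := congrArg (· * (Rᵀ + 1)⁻¹) (e1.trans e2.symm)
    simpa [Matrix.mul_nonsing_inv_cancel_right _ _ hut] using this
  have hSj : S * j0 n = -(j0 n * S) := by
    apply hcanc
    have e1 : (R + 1) * (S * j0 n) = j0 n * (Rᵀ - 1) := by
      rw [← mul_assoc, hRS, sub_mul, hRj]; noncomm_ring
    have e2 : (R + 1) * -(j0 n * S) = - (j0 n * ((Rᵀ + 1) * S)) := by
      rw [mul_neg, ← mul_assoc, add_mul, hRj]; noncomm_ring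
    have e3 : (Rᵀ + 1) * S = -(Rᵀ - 1) := by
      calc (Rᵀ + 1) * S = Rᵀ * ((R + 1) * S) := by
            rw [← mul_assoc Rᵀ, mul_add, hRR', mul_one, add_comm]
        _ = _ := by rw [hRS, mul_sub, hRR']; noncomm_ring
    rw [e1, e2, e3]; noncomm_ring
  refine ⟨⟨hSt, hSj⟩, ?_⟩
  have hus := one_sub_skew_det hSt
  have hfin : 1 + S = R * (1 - S) := by
    have : R * S = R - 1 - S := by rw [← hRS]; noncomm_ring
    rw [mul_sub, this]; noncomm_ring
  rw [cay, hfin, Matrix.mul_nonsing_inv_cancel_right _ _ hus, hR]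
  calc _ = -(j * (j0 n * j0 n)) := by noncomm_ring
    _ = j := by rw [hj]; noncomm_ring

theorem cay_props {n : ℕ} {S : SMat n} (hS : S ∈ qSpace n) :
    IsUnit (-(cay S * j0 n * j0 n) + 1).det ∧
    (-(cay S * j0 n * j0 n) + 1)⁻¹ * (-(cay S * j0 n * j0 n) - 1) = S := by
  have hu := one_sub_skew_det hS.1
  have e : -(cay S * j0 n * j0 n) = cay S := by rw [mul_assoc, j0_sq]; simp
  rw [e]
  have e1 : cay S + 1 = (2 : ℝ) • (1 - S)⁻¹ := by
    calc cay S + 1 = (1 + S) * (1 - S)⁻¹ + (1 - S) * (1 - S)⁻¹ := by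
          rw [cay, Matrix.mul_nonsing_inv _ hu]
      _ = ((1 + S) + (1 - S)) * (1 - S)⁻¹ := by rw [add_mul (1 + S)]
      _ = _ := by
          rw [show (1 + S) + (1 - S) = (1 : SMat n) + 1 by abel, add_mul, one_mul, two_smul]
  have e2 : cay S - 1 = (1 - S)⁻¹ * ((2 : ℝ) • S) := by
    have hc : Commute ((2 : ℝ) • S) (1 - S) := by
      apply Commute.smul_left
      exact (Commute.one_right _).sub_right (Commute.refl _)
    calc cay S - 1 = (1 + S) * (1 - S)⁻¹ - (1 - S) * (1 - S)⁻¹ := by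
          rw [cay, Matrix.mul_nonsing_inv _ hu]
      _ = ((1 + S) - (1 - S)) * (1 - S)⁻¹ := by rw [sub_mul (1 + S)]
      _ = ((2 : ℝ) • S) * (1 - S)⁻¹ := by rw [two_smul]; congr 1; abel
      _ = (1 - S)⁻¹ * ((1 - S) * ((2 : ℝ) • S)) * (1 - S)⁻¹ := by
          rw [Matrix.nonsing_inv_mul_cancel_left _ _ hu]
      _ = _ := by
          rw [← hc.eq, mul_assoc, Matrix.mul_nonsing_inv_cancel_right _ _ hu]
  have hu2 : IsUnit ((2 : ℝ) • (1 - S)⁻¹).det := by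
    rw [Matrix.det_smul]
    exact (isUnit_iff_ne_zero.2 (pow_ne_zero _ two_ne_zero)).mul (Matrix.isUnit_nonsing_inv_det _ hu)
  rw [e1, e2]
  refine ⟨hu2, ?_⟩
  have : (1 - S)⁻¹ * ((2 : ℝ) • S) = ((2 : ℝ) • (1 - S)⁻¹) * S := by simp
  rw [this, Matrix.nonsing_inv_mul_cancel_left _ _ hu2]


/-! Coordinates on the twistor space: a point is given by the space coordinates `y` of its
projection on hyperbolic space and by a complex structure `j` in the frame `hs y`; the latter is
described near `C j₀ Cᵀ` by the Cayley transform of an element of `𝔮`. -/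

/-- The space coordinates of the projection on hyperbolic space. -/
def yOf {n : ℕ} (X : LMat n) : SIdx n → ℝ := fun i =>
  (1 + X * X) (Sum.inr i) (Sum.inl ()) / Real.sqrt ((1 + X * X) (Sum.inl ()) (Sum.inl ()))

/-- The complex structure in the frame `hs y`. -/
def jOf {n : ℕ} (X : LMat n) : SMat n := (hs (yOf X) * X * hs (yOf X)).toBlocks₂₂

/-- The orthogonal matrix with `Cᵀ j C = R j₀`. -/
def rOf {n : ℕ} (C : SMat n) (X : LMat n) : SMat n := -(Cᵀ * jOf X * C * j0 n)

/-- The projection on `𝔮`. -/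
def projQ (n : ℕ) : SMat n →ₗ[ℝ] qSpace n where
  toFun B := ⟨(1 / 4 : ℝ) • (B - Bᵀ + j0 n * (B - Bᵀ) * j0 n), by
    have h1 := j0_sq n
    have h2 := j0_t n
    constructor
    · simp only [Matrix.transpose_smul, Matrix.transpose_add, Matrix.transpose_sub,
        Matrix.transpose_mul, Matrix.transpose_transpose, h2]
      rw [← smul_neg]; congr 1; noncomm_ring
    · rw [smul_mul_assoc, mul_smul_comm, ← smul_neg]
      congr 1
      have e1 : ∀ Z : SMat n, j0 n * Z * j0 n * j0 n = -(j0 n * Z) := fun Z => by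
        rw [mul_assoc, h1]; simp
      have e2 : ∀ Z : SMat n, j0 n * (j0 n * Z * j0 n) = -(Z * j0 n) := fun Z => by
        rw [← mul_assoc, ← mul_assoc, h1]; simp
      rw [add_mul, mul_add, e1, e2]; abel⟩
  map_add' A B := by
    ext1
    simp only [Submodule.coe_add, ← smul_add, Matrix.transpose_add]
    congr 1; noncomm_ring
  map_smul' c A := by
    ext1
    simp only [Submodule.coe_smul, RingHom.id_apply, Matrix.transpose_smul, ← smul_sub]
    rw [mul_smul_comm, smul_mul_assoc, ← smul_add, smul_comm]

theorem projQ_coe {n : ℕ} (B : qSpace n) : projQ n (B : SMat n) = B := by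
  ext1
  obtain ⟨B, h1, h2⟩ := B
  have h3 := j0_sq n
  show (1 / 4 : ℝ) • (B - Bᵀ + j0 n * (B - Bᵀ) * j0 n) = B
  have e : j0 n * (B - Bᵀ) * j0 n = B - Bᵀ := by
    rw [h1, sub_neg_eq_add, mul_assoc, add_mul, h2, mul_add, mul_neg, ← mul_assoc, h3]; simp
  rw [e, h1]
  module

/-- The coordinates. -/
def chartF {n : ℕ} (C : SMat n) (X : LMat n) : Model n :=
  (yOf X, projQ n ((rOf C X + 1)⁻¹ * (rOf C X - 1)))

/-- The parametrization. -/
def chartG {n : ℕ} (C : SMat n) (a : Model n) : LMat n :=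
  hs a.1 * ext0 (C * (cay (a.2 : SMat n) * j0 n) * Cᵀ) * hs a.1

theorem one_add_sq_std {n : ℕ} (y : SIdx n → ℝ) {j : SMat n} (hj : j * j = -1) (i : LIdx n) :
    (1 + (hs y * ext0 j * hs y) * (hs y * ext0 j * hs y)) i (Sum.inl ()) = hs y i (Sum.inl ()) * cc y := by
  have e : 1 + (hs y * ext0 j * hs y) * (hs y * ext0 j * hs y)
      = hs y * Matrix.fromBlocks 1 0 0 0 * hs y := by
    calc _ = hs y * hs y + hs y * (ext0 j * (hs y * hs y) * ext0 j) * hs y := by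
          rw [hs_sq]; congr 1
          rw [mul_one]
          calc _ = hs y * ext0 j * (hs y * hs y) * ext0 j * hs y := by simp only [mul_assoc]
            _ = _ := by rw [hs_sq, mul_one]; simp only [mul_assoc]
      _ = hs y * (1 + ext0 j * ext0 j) * hs y := by rw [hs_sq, mul_one, mul_add, add_mul, mul_one, hs_sq]
      _ = _ := by
          congr 2
          rw [← Matrix.fromBlocks_one, ext0, Matrix.fromBlocks_multiply, Matrix.fromBlocks_add]
          simp [hj]
  rw [e, Matrix.mul_apply, Fintype.sum_sum_type]
  simp [Matrix.mul_apply, hs_col]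

theorem one_add_sq_std00 {n : ℕ} (y : SIdx n → ℝ) {j : SMat n} (hj : j * j = -1) :
    (1 + (hs y * ext0 j * hs y) * (hs y * ext0 j * hs y)) (Sum.inl ()) (Sum.inl ()) = cc y * cc y := by
  rw [one_add_sq_std y hj, hs_col]; rfl

theorem yOf_std {n : ℕ} (y : SIdx n → ℝ) {j : SMat n} (hj : j * j = -1) :
    yOf (hs y * ext0 j * hs y) = y := by
  have hc := cc_pos y
  ext i
  rw [yOf, one_add_sq_std00 y hj, one_add_sq_std y hj, hs_col, Real.sqrt_mul_self hc.le]
  simp [hc.ne']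

theorem jOf_std {n : ℕ} (y : SIdx n → ℝ) {j : SMat n} (hj : j * j = -1) :
    jOf (hs y * ext0 j * hs y) = j := by
  rw [jOf, yOf_std y hj]
  have : hs y * (hs y * ext0 j * hs y) * hs y = ext0 j := by
    calc _ = (hs y * hs y) * ext0 j * (hs y * hs y) := by simp only [mul_assoc]
      _ = _ := by rw [hs_sq, mul_one, one_mul]
  rw [this, ext0, Matrix.toBlocks_fromBlocks₂₂]

theorem conj_j0_sq {n : ℕ} {C : SMat n} (hC : Cᵀ * C = 1) :
    (C * j0 n * Cᵀ) * (C * j0 n * Cᵀ) = -1 := by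
  have hC' : C * Cᵀ = 1 := mul_eq_one_comm.1 hC
  calc _ = C * (j0 n * (Cᵀ * C) * j0 n) * Cᵀ := by simp only [mul_assoc]
    _ = -1 := by rw [hC, mul_one, j0_sq]; simp [hC']

theorem cay_j0_sq {n : ℕ} {S : SMat n} (hS : S ∈ qSpace n) :
    (cay S * j0 n) * (cay S * j0 n) = -1 := by
  obtain ⟨D, hD, -, h⟩ := cay_orbit hS
  rw [h, conj_j0_sq hD]

theorem conj_sq {n : ℕ} {C j : SMat n} (hC : Cᵀ * C = 1) (hj : j * j = -1) :
    (C * j * Cᵀ) * (C * j * Cᵀ) = -1 := by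
  have hC' : C * Cᵀ = 1 := mul_eq_one_comm.1 hC
  calc _ = C * (j * (Cᵀ * C) * j) * Cᵀ := by simp only [mul_assoc]
    _ = -1 := by rw [hC, mul_one, hj]; simp [hC']

theorem rOf_std {n : ℕ} (y : SIdx n → ℝ) {C j : SMat n} (hj : j * j = -1) :
    rOf C (hs y * ext0 j * hs y) = -(Cᵀ * j * C * j0 n) := by
  rw [rOf, jOf_std y hj]

theorem chartG_mem {n : ℕ} {C : SMat n} (hC : Cᵀ * C = 1) (hd : C.det = 1) (a : Model n) :
    ∃ g ∈ SO0 n, chartG C a = g * t0 n * g⁻¹ := by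
  rw [mem_iff]
  obtain ⟨D, hD, hDd, h⟩ := cay_orbit a.2.2
  refine ⟨a.1, C * D, ?_, by rw [Matrix.det_mul, hd, hDd, one_mul], ?_⟩
  · rw [Matrix.transpose_mul]
    calc _ = Dᵀ * (Cᵀ * C) * D := by simp only [mul_assoc]
      _ = 1 := by rw [hC, mul_one, hD]
  · rw [chartG, h, Matrix.transpose_mul]; simp only [mul_assoc]

theorem rOf_chartG {n : ℕ} {C : SMat n} (hC : Cᵀ * C = 1) (a : Model n) :
    rOf C (chartG C a) = -(cay (a.2 : SMat n) * j0 n * j0 n) := by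
  have h := cay_j0_sq a.2.2
  rw [chartG, rOf_std _ (conj_sq hC h)]
  congr 1
  calc _ = (Cᵀ * C) * (cay (a.2 : SMat n) * j0 n) * (Cᵀ * C) * j0 n := by simp only [mul_assoc]
    _ = _ := by rw [hC, one_mul, mul_one]

theorem chartF_chartG {n : ℕ} {C : SMat n} (hC : Cᵀ * C = 1) (a : Model n) :
    chartF C (chartG C a) = a := by
  have h := cay_j0_sq a.2.2
  rw [chartF, rOf_chartG hC, (cay_props a.2.2).2, projQ_coe, chartG, yOf_std _ (conj_sq hC h)]
  rfl

theorem chartG_chartF {n : ℕ} {C : SMat n} (hC : Cᵀ * C = 1) {X : LMat n}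
    (hX : ∃ g ∈ SO0 n, X = g * t0 n * g⁻¹) (hu : IsUnit (rOf C X + 1).det) :
    chartG C (chartF C X) = X := by
  obtain ⟨y, D, hD, -, rfl⟩ := (mem_iff X).1 hX
  have hC' : C * Cᵀ = 1 := mul_eq_one_comm.1 hC
  have hj := conj_j0_sq hD
  have hjt : (D * j0 n * Dᵀ)ᵀ = -(D * j0 n * Dᵀ) := by
    rw [Matrix.transpose_mul, Matrix.transpose_mul, j0_t, Matrix.transpose_transpose]
    noncomm_ring
  set j := D * j0 n * Dᵀ with hjdef
  clear_value j
  rw [rOf_std y hj] at hu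
  have hk : (Cᵀ * j * C) * (Cᵀ * j * C) = -1 := by
    have := conj_sq (C := Cᵀ) (by simpa using hC') hj
    simpa using this
  have hkt : (Cᵀ * j * C)ᵀ = -(Cᵀ * j * C) := by
    rw [Matrix.transpose_mul, Matrix.transpose_mul, hjt, Matrix.transpose_transpose]
    noncomm_ring
  obtain ⟨h1, h2⟩ := icay_mem hkt hk hu
  have e : projQ n ((-(Cᵀ * j * C * j0 n) + 1)⁻¹ * (-(Cᵀ * j * C * j0 n) - 1))
      = ⟨_, h1⟩ := projQ_coe ⟨_, h1⟩
  rw [chartF, rOf_std y hj, yOf_std y hj, e]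
  show hs y * ext0 (C * (cay _ * j0 n) * Cᵀ) * hs y = _
  rw [h2]
  congr 3
  calc _ = (C * Cᵀ) * j * (C * Cᵀ) := by simp only [mul_assoc]
    _ = j := by rw [hC', one_mul, mul_one]

section
attribute [local instance] Matrix.linftyOpNormedRing Matrix.linftyOpNormedAlgebra

theorem contDiff_linear {V W : Type*} [NormedAddCommGroup V] [NormedSpace ℝ V]
    [FiniteDimensional ℝ V] [NormedAddCommGroup W] [NormedSpace ℝ W] (f : V →ₗ[ℝ] W) :
    ContDiff ℝ ∞ f := (LinearMap.toContinuousLinearMap f).contDiff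

theorem contDiff_matrix {V : Type*} [NormedAddCommGroup V] [NormedSpace ℝ V]
    {I : Type*} [Fintype I] [DecidableEq I]
    {f : V → Matrix I I ℝ} (h : ∀ i j, ContDiff ℝ ∞ fun x => f x i j) : ContDiff ℝ ∞ f := by
  have h1 : ContDiff ℝ ∞ (fun x => (fun i j => f x i j : I → I → ℝ)) :=
    contDiff_pi.2 fun i => contDiff_pi.2 fun j => h i j
  exact (contDiff_linear (Matrix.ofLinearEquiv ℝ : (I → I → ℝ) ≃ₗ[ℝ] Matrix I I ℝ).toLinearMap).comp h1

theorem contDiffAt_inv {I : Type*} [Fintype I] [DecidableEq I] {A : Matrix I I ℝ}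
    (hA : IsUnit A.det) : ContDiffAt ℝ ∞ (fun B : Matrix I I ℝ => B⁻¹) A := by
  have e : (fun B : Matrix I I ℝ => B⁻¹) = Ring.inverse :=
    funext fun B => Matrix.nonsing_inv_eq_ringInverse B
  rw [e]
  obtain ⟨u, rfl⟩ := (Matrix.isUnit_iff_isUnit_det A).2 hA
  exact contDiffAt_ringInverse ℝ u

theorem contDiff_hs (n : ℕ) : ContDiff ℝ ∞ (fun y : SIdx n → ℝ => hs y) := by
  have hcc : ContDiff ℝ ∞ (fun y : SIdx n → ℝ => cc y) := by
    unfold cc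
    apply ContDiff.sqrt
    · simp only [dotProduct]; fun_prop
    · intro y
      have := cc_sq y
      have h2 := cc_pos y
      rw [← this]; positivity
  have hmm : ∀ i, ContDiff ℝ ∞ (fun y : SIdx n → ℝ => mm y i) := by
    rintro (i | i)
    · simp only [mm, Sum.elim_inl]; fun_prop
    · simp only [mm, Sum.elim_inr]; fun_prop
  have hv : ContDiff ℝ ∞ (fun y : SIdx n → ℝ => Matrix.vecMulVec (mm y) (mm y)) :=
    contDiff_matrix fun i j => by
      simp only [Matrix.vecMulVec_apply]; exact (hmm i).mul (hmm j)
  have hinv : ContDiff ℝ ∞ (fun y : SIdx n → ℝ => 1 / (1 + cc y)) :=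
    contDiff_const.div (contDiff_const.add hcc) fun y => by have := cc_pos y; positivity
  unfold hs
  exact (hinv.smul (hv.mul contDiff_const)).sub contDiff_const

/-- `ext0` as a linear map. -/
def ext0L (n : ℕ) : SMat n →ₗ[ℝ] LMat n where
  toFun := ext0
  map_add' A B := by simp [ext0, Matrix.fromBlocks_add]
  map_smul' c A := by simp [ext0, Matrix.fromBlocks_smul]

/-- The lower right block. -/
def blkL (n : ℕ) : LMat n →ₗ[ℝ] SMat n where
  toFun A := A.toBlocks₂₂
  map_add' _ _ := rfl
  map_smul' _ _ := rfl

/-- An entry. -/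
def entL {n : ℕ} (i j : LIdx n) : LMat n →ₗ[ℝ] ℝ where
  toFun A := A i j
  map_add' _ _ := rfl
  map_smul' _ _ := rfl

theorem contDiff_chartG {n : ℕ} (C : SMat n) : ContDiff ℝ ∞ (chartG C) := by
  have h1 : ContDiff ℝ ∞ (fun a : Model n => hs a.1) := (contDiff_hs n).comp contDiff_fst
  have h2 : ContDiff ℝ ∞ (fun a : Model n => (a.2 : SMat n)) :=
    (contDiff_linear (qSpace n).subtype).comp contDiff_snd
  have h3 : ContDiff ℝ ∞ (fun a : Model n => (1 - (a.2 : SMat n))⁻¹) := by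
    rw [contDiff_iff_contDiffAt]
    intro a
    exact (contDiffAt_inv (one_sub_skew_det a.2.2.1)).comp a
      (contDiff_const.sub h2).contDiffAt
  have h4 : ContDiff ℝ ∞ (fun a : Model n => C * (cay (a.2 : SMat n) * j0 n) * Cᵀ) := by
    unfold cay
    exact (contDiff_const.mul (((contDiff_const.add h2).mul h3).mul contDiff_const)).mul
      contDiff_const
  exact (h1.mul ((contDiff_linear (ext0L n)).comp h4)).mul h1

/-- The open set of matrices on which the chart with base rotation `C` is defined. -/
def dom {n : ℕ} (C : SMat n) : Set (LMat n) :=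
  {X | 0 < (1 + X * X) (Sum.inl ()) (Sum.inl ()) ∧ (rOf C X + 1).det ≠ 0}

theorem contDiffAt_ent {n : ℕ} (i j : LIdx n) (X : LMat n) :
    ContDiffAt ℝ ∞ (fun X : LMat n => (1 + X * X) i j) X := by
  have h : ContDiff ℝ ∞ (fun X : LMat n => 1 + X * X) := by fun_prop
  exact ((contDiff_linear (entL i j)).comp h).contDiffAt

theorem contDiffAt_yOf {n : ℕ} {X : LMat n} (h : 0 < (1 + X * X) (Sum.inl ()) (Sum.inl ())) :
    ContDiffAt ℝ ∞ (yOf : LMat n → _) X := by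
  rw [contDiffAt_pi]
  intro i
  exact (contDiffAt_ent _ _ X).div ((contDiffAt_ent _ _ X).sqrt h.ne') (Real.sqrt_pos.2 h).ne'

theorem contDiffAt_rOf {n : ℕ} (C : SMat n) {X : LMat n}
    (h : 0 < (1 + X * X) (Sum.inl ()) (Sum.inl ())) : ContDiffAt ℝ ∞ (rOf C) X := by
  have h1 : ContDiffAt ℝ ∞ (fun X : LMat n => hs (yOf X)) X :=
    (contDiff_hs n).contDiffAt.comp X (contDiffAt_yOf h)
  have h2 : ContDiffAt ℝ ∞ (fun X : LMat n => hs (yOf X) * X * hs (yOf X)) X :=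
    (h1.mul contDiffAt_id).mul h1
  have h3 : ContDiffAt ℝ ∞ (jOf : LMat n → _) X :=
    (contDiff_linear (blkL n)).contDiffAt.comp X h2
  exact (((contDiffAt_const.mul h3).mul contDiffAt_const).mul contDiffAt_const).neg

theorem contDiffAt_chartF {n : ℕ} {C : SMat n} {X : LMat n} (h : X ∈ dom C) :
    ContDiffAt ℝ ∞ (chartF C) X := by
  have h1 := contDiffAt_rOf C h.1
  have h2 : ContDiffAt ℝ ∞ (fun X : LMat n => (rOf C X + 1)⁻¹) X :=
    (contDiffAt_inv (isUnit_iff_ne_zero.2 h.2)).comp X (h1.add contDiffAt_const)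
  exact (contDiffAt_yOf h.1).prodMk
    ((contDiff_linear (projQ n)).contDiffAt.comp X (h2.mul (h1.sub contDiffAt_const)))

theorem isOpen_dom {n : ℕ} (C : SMat n) : IsOpen (dom C) := by
  rw [isOpen_iff_mem_nhds]
  intro X hX
  have h1 : ContinuousAt (fun X : LMat n => (1 + X * X) (Sum.inl ()) (Sum.inl ())) X :=
    (contDiffAt_ent _ _ X).continuousAt
  have h2 : ContinuousAt (fun X : LMat n => (rOf C X + 1).det) X :=
    (Continuous.matrix_det continuous_id).continuousAt.comp
      (((contDiffAt_rOf C hX.1).continuousAt).add continuousAt_const)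
  filter_upwards [h1.eventually (lt_mem_nhds hX.1), h2.eventually_ne hX.2] with Y a b using ⟨a, b⟩

theorem pos_of_mem {n : ℕ} {X : LMat n} (hX : ∃ g ∈ SO0 n, X = g * t0 n * g⁻¹) :
    0 < (1 + X * X) (Sum.inl ()) (Sum.inl ()) := by
  obtain ⟨y, D, hD, -, rfl⟩ := (mem_iff X).1 hX
  rw [one_add_sq_std00 y (conj_j0_sq hD)]
  exact mul_self_pos.2 (cc_pos y).ne'

/-- The coordinate chart of the twistor space with base rotation `C`. -/
def chart {n : ℕ} (C : SMat n) (hC : Cᵀ * C = 1) (hd : C.det = 1) :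
    OpenPartialHomeomorph (Twistor n) (Model n) where
  toFun X := chartF C X.1
  invFun a := ⟨chartG C a, chartG_mem hC hd a⟩
  source := {X | X.1 ∈ dom C}
  target := Set.univ
  map_source' := fun _ _ => trivial
  map_target' a _ := by
    refine ⟨pos_of_mem (chartG_mem hC hd a), ?_⟩
    rw [rOf_chartG hC]
    exact (cay_props a.2.2).1.ne_zero
  left_inv' X hX := Subtype.ext (chartG_chartF hC X.2 (isUnit_iff_ne_zero.2 hX.2))
  right_inv' a _ := chartF_chartG hC a
  open_source := (isOpen_dom C).preimage continuous_subtype_val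
  open_target := isOpen_univ
  continuousOn_toFun := fun X hX =>
    ((contDiffAt_chartF hX).continuousAt.comp continuous_subtype_val.continuousAt).continuousWithinAt
  continuousOn_invFun := (Continuous.subtype_mk (contDiff_chartG C).continuous _).continuousOn

theorem exists_rot {n : ℕ} (X : Twistor n) :
    ∃ C : SMat n, Cᵀ * C = 1 ∧ C.det = 1 ∧ X.1 ∈ dom C := by
  obtain ⟨y, C, hC, hd, h⟩ := (mem_iff X.1).1 X.2
  refine ⟨C, hC, hd, pos_of_mem X.2, ?_⟩
  rw [h, rOf_std y (conj_j0_sq hC)]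
  have : -(Cᵀ * (C * j0 n * Cᵀ) * C * j0 n) = 1 := by
    calc _ = -((Cᵀ * C) * j0 n * (Cᵀ * C) * j0 n) := by simp only [mul_assoc]
      _ = 1 := by rw [hC, one_mul, mul_one, j0_sq, neg_neg]
  rw [this, one_add_one_eq_two]
  have : (2 : SMat n) = (2 : ℝ) • 1 := by rw [two_smul, one_add_one_eq_two]
  rw [this, Matrix.det_smul]
  simp

/-- The smooth atlas of the twistor space. -/
instance (n : ℕ) : ChartedSpace (Model n) (Twistor n) where
  atlas := {e | ∃ (C : SMat n) (hC : Cᵀ * C = 1) (hd : C.det = 1), e = chart C hC hd}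
  chartAt X := chart (exists_rot X).choose (exists_rot X).choose_spec.1
    (exists_rot X).choose_spec.2.1
  mem_chart_source := fun X => (exists_rot X).choose_spec.2.2
  chart_mem_atlas _ := ⟨_, _, _, rfl⟩

instance (n : ℕ) : IsManifold 𝓘(ℝ, Model n) ∞ (Twistor n) := by
  apply isManifold_of_contDiffOn
  rintro _ _ ⟨C, hC, hd, rfl⟩ ⟨C', hC', hd', rfl⟩
  intro a ha
  have ha' : chartG C a ∈ dom C' := ha.1.2
  exact ((contDiffAt_chartF ha').comp a (contDiff_chartG C).contDiffAt).contDiffWithinAt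

end

/-- The inclusion of the twistor space in the space of matrices. -/
def coords {n : ℕ} (X : Twistor n) : LIdx n → LIdx n → ℝ := fun i j => X.1 i j

section
attribute [local instance] Matrix.linftyOpNormedRing Matrix.linftyOpNormedAlgebra

/-- A matrix as a family of numbers. -/
def ofL (n : ℕ) : LMat n →L[ℝ] (LIdx n → LIdx n → ℝ) :=
  LinearMap.toContinuousLinearMap
    (Matrix.ofLinearEquiv ℝ : (LIdx n → LIdx n → ℝ) ≃ₗ[ℝ] LMat n).symm.toLinearMap

theorem contMDiff_coords (n : ℕ) :
    ContMDiff 𝓘(ℝ, Model n) 𝓘(ℝ, LIdx n → LIdx n → ℝ) ∞ (coords (n := n)) := by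
  rw [contMDiff_iff]
  constructor
  · exact continuous_pi fun i => continuous_pi fun j =>
      (continuous_subtype_val (p := fun X : LMat n => ∃ g ∈ SO0 n, X = g * t0 n * g⁻¹)).matrix_elem i j
  · intro X _
    exact ((ofL n).contDiff.comp (contDiff_chartG (exists_rot X).choose)).contDiffOn

theorem mfderiv_coords {n : ℕ} (X : Twistor n) : ∃ (C : SMat n) (a : Model n),
    Cᵀ * C = 1 ∧ C.det = 1 ∧ chartG C a = X.1 ∧
    mfderiv 𝓘(ℝ, Model n) 𝓘(ℝ, LIdx n → LIdx n → ℝ) coords X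
      = (ofL n).comp (fderiv ℝ (chartG C) a) := by
  have h := (exists_rot X).choose_spec
  set C := (exists_rot X).choose with hC
  refine ⟨C, chartF C X.1, h.1, h.2.1,
    chartG_chartF h.1 X.2 (isUnit_iff_ne_zero.2 h.2.2.2), ?_⟩
  have hm := ((contMDiff_coords n).mdifferentiable (by simp) X).mfderiv
  refine hm.trans ?_
  have e : writtenInExtChartAt 𝓘(ℝ, Model n) 𝓘(ℝ, LIdx n → LIdx n → ℝ) X coords
      = (ofL n) ∘ (chartG C) := rfl
  rw [e]
  have e2 : (extChartAt 𝓘(ℝ, Model n) X) X = chartF C X.1 := rfl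
  rw [e2]
  simp only [ModelWithCorners.range_eq_univ, fderivWithin_univ]
  exact ((ofL n).hasFDerivAt.comp (chartF C X.1)
    ((contDiff_chartG C).differentiable (by simp) _).hasFDerivAt).fderiv
end

/-- The matrix of a tangent vector, seen as a tangent vector to the space of matrices. -/
def tangentMat {n : ℕ} (X : Twistor n) : TangentSpace 𝓘(ℝ, Model n) X →ₗ[ℝ] LMat n where
  toFun v := Matrix.of (mfderiv 𝓘(ℝ, Model n) 𝓘(ℝ, LIdx n → LIdx n → ℝ) coords X v)
  map_add' v w := by rw [map_add]; rfl
  map_smul' c v := by rw [map_smul]; rfl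

/-- The element `(0 ᵗu; u B)` of `𝔭 ⊕ 𝔮 ⊆ so(1,2n)`. -/
def mMat (n : ℕ) : Model n →ₗ[ℝ] LMat n where
  toFun a := Matrix.fromBlocks 0 (Matrix.replicateRow Unit a.1) (Matrix.replicateCol Unit a.1)
    (a.2 : SMat n)
  map_add' a b := by
    rw [Matrix.fromBlocks_add, Matrix.fromBlocks_inj]; exact ⟨by simp, rfl, rfl, rfl⟩
  map_smul' c a := by
    rw [RingHom.id_apply, Matrix.fromBlocks_smul, Matrix.fromBlocks_inj]
    exact ⟨by simp, rfl, rfl, rfl⟩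

/-- `A ↦ g [A, j₀'] g⁻¹ = d/ds (g exp(sA) j₀' exp(-sA) g⁻¹)` at `s = 0`. -/
def frameMat {n : ℕ} (g : LMat n) : Model n →ₗ[ℝ] LMat n where
  toFun a := g * (mMat n a * t0 n - t0 n * mMat n a) * g⁻¹
  map_add' a b := by rw [map_add]; noncomm_ring
  map_smul' c a := by
    rw [map_smul, RingHom.id_apply, smul_mul_assoc, mul_smul_comm, ← smul_sub, mul_smul_comm,
      smul_mul_assoc]

theorem SO0_unit {n : ℕ} {g : LMat n} (hg : g ∈ SO0 n) : IsUnit g.det := by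
  rw [hg.2.1]; exact isUnit_one

/-- `[A, j₀']` for `A = (0 ᵗu; u B)`. -/
theorem mMat_comm {n : ℕ} (a : Model n) : mMat n a * t0 n - t0 n * mMat n a =
    Matrix.fromBlocks 0 (Matrix.replicateRow Unit (-(j0 n *ᵥ a.1)))
      (Matrix.replicateCol Unit (-(j0 n *ᵥ a.1))) (-((2 : ℝ) • (j0 n * (a.2 : SMat n)))) := by
  have h1 : (a.1 ᵥ* j0 n) = -(j0 n *ᵥ a.1) := by
    rw [← Matrix.mulVec_transpose, j0_t, Matrix.neg_mulVec]
  have h2 := a.2.2.2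
  simp only [mMat, LinearMap.coe_mk, AddHom.coe_mk, t0, Matrix.fromBlocks_multiply,
    sub_eq_add_neg, Matrix.fromBlocks_neg, Matrix.fromBlocks_add]
  congr 1
  · simp
  · simp [← Matrix.replicateRow_vecMul, h1]
  · rw [← Matrix.replicateCol_mulVec]
    ext i j; simp
  · rw [h2]; simp [two_smul]

theorem frameMat_injective {n : ℕ} {g : LMat n} (hg : g ∈ SO0 n) :
    Function.Injective (frameMat g) := by
  rw [← LinearMap.ker_eq_bot, LinearMap.ker_eq_bot']
  intro a ha
  have hu := SO0_unit hg
  have h : mMat n a * t0 n - t0 n * mMat n a = 0 := by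
    have := congrArg (fun Z => g⁻¹ * Z * g) ha
    simp only [frameMat, LinearMap.coe_mk, AddHom.coe_mk] at this
    simpa [mul_assoc, Matrix.nonsing_inv_mul_cancel_left _ _ hu, Matrix.nonsing_inv_mul _ hu]
      using this
  rw [mMat_comm, ← Matrix.fromBlocks_zero, Matrix.fromBlocks_inj] at h
  obtain ⟨-, -, h3, h4⟩ := h
  have h5 : j0 n *ᵥ a.1 = 0 := by
    ext i
    have := congrFun (congrFun h3 i) ()
    simpa using this
  have h6 : a.1 = 0 := by
    have := congrArg (j0 n *ᵥ ·) h5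
    simpa [j0_sq, Matrix.neg_mulVec] using this
  have h7 : (a.2 : SMat n) = 0 := by
    have : j0 n * (a.2 : SMat n) = 0 := by simpa using h4
    have := congrArg (j0 n * ·) this
    simpa [← mul_assoc, j0_sq] using this
  exact Prod.ext h6 (Subtype.ext h7)

theorem mem_frameMat_base {n : ℕ} {N : LMat n} (h1 : Nᵀ * eta n = -(eta n * N))
    (h2 : N * t0 n * t0 n + t0 n * N * t0 n + t0 n * t0 n * N = -N) :
    ∃ a : Model n, mMat n a * t0 n - t0 n * mMat n a = N := by
  rw [← Matrix.fromBlocks_toBlocks N] at h1 h2 ⊢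
  generalize N.toBlocks₁₁ = a11 at *
  generalize N.toBlocks₁₂ = a12 at *
  generalize N.toBlocks₂₁ = a21 at *
  generalize N.toBlocks₂₂ = B at *
  have hj := j0_sq n
  rw [eta_eq] at h1
  simp only [Matrix.fromBlocks_transpose, Matrix.fromBlocks_multiply, Matrix.fromBlocks_neg,
    Matrix.fromBlocks_inj] at h1
  simp only [t0, Matrix.fromBlocks_multiply, Matrix.fromBlocks_add, Matrix.fromBlocks_neg,
    Matrix.fromBlocks_inj] at h2
  obtain ⟨-, p2, -, p4⟩ := h1
  obtain ⟨q1, -, -, q4⟩ := h2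
  have r1 : a11 = 0 := by simpa using q1.symm
  have r2 : a12 = a21ᵀ := by simpa using p2.symm
  have r3 : Bᵀ = -B := by
    have : -Bᵀ = B := by simpa using p4
    rw [← neg_eq_iff_eq_neg, this]
  have r4 : B * j0 n = -(j0 n * B) := by
    have e : j0 n * B * j0 n = B := by
      have : B * j0 n * j0 n + j0 n * B * j0 n + j0 n * j0 n * B = -B := by simpa using q4
      rw [mul_assoc B, hj] at this
      have h := congrArg (· + B + B) this
      simp only [mul_neg, mul_one, neg_mul, one_mul] at h
      calc j0 n * B * j0 n = -B + j0 n * B * j0 n + -B + B + B := by abel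
        _ = -B + B + B := h
        _ = B := by abel
    calc B * j0 n = j0 n * B * (j0 n * j0 n) := by rw [← mul_assoc, e]
      _ = _ := by rw [hj]; simp
  set u : SIdx n → ℝ := fun i => a21 i () with hu
  have hq : (1 / 2 : ℝ) • (j0 n * B) ∈ qSpace n := by
    apply Submodule.smul_mem
    constructor
    · rw [Matrix.transpose_mul, r3, j0_t, neg_mul_neg, r4]
    · rw [mul_assoc, r4]; simp
  refine ⟨(j0 n *ᵥ u, ⟨_, hq⟩), (mMat_comm _).trans ?_⟩
  rw [Matrix.fromBlocks_inj]
  have e1 : -(j0 n *ᵥ (j0 n *ᵥ u)) = u := by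
    rw [Matrix.mulVec_mulVec, hj]; simp [Matrix.neg_mulVec]
  refine ⟨r1.symm, ?_, ?_, ?_⟩
  · show Matrix.replicateRow Unit (-(j0 n *ᵥ (j0 n *ᵥ u))) = _
    rw [e1, r2]; ext i j; rfl
  · show Matrix.replicateCol Unit (-(j0 n *ᵥ (j0 n *ᵥ u))) = _
    rw [e1]; ext i j; rfl
  · show -((2 : ℝ) • (j0 n * ((1 / 2 : ℝ) • (j0 n * B)))) = B
    rw [mul_smul_comm, smul_smul, ← mul_assoc, hj]; norm_num

theorem t0_cube (n : ℕ) : t0 n * t0 n * t0 n = -t0 n := by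
  simp [t0, Matrix.fromBlocks_multiply, j0_sq, Matrix.fromBlocks_neg]

theorem t0_eta (n : ℕ) : (t0 n)ᵀ * eta n = -(eta n * t0 n) := by
  simp [t0, eta_eq, Matrix.fromBlocks_transpose, Matrix.fromBlocks_multiply, j0_t,
    Matrix.fromBlocks_neg]

theorem SO0_inv_eq {n : ℕ} {g : LMat n} (hg : g ∈ SO0 n) : g⁻¹ = eta n * gᵀ * eta n := by
  apply Matrix.inv_eq_left_inv
  calc _ = eta n * (gᵀ * eta n * g) := by simp only [mul_assoc]
    _ = 1 := by rw [hg.1, eta_sq]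

theorem orbit_cube {n : ℕ} {X : LMat n} (hX : ∃ g ∈ SO0 n, X = g * t0 n * g⁻¹) :
    X * X * X = -X := by
  obtain ⟨g, hg, rfl⟩ := hX
  have hu := SO0_unit hg
  calc _ = g * (t0 n * (g⁻¹ * g) * t0 n * (g⁻¹ * g) * t0 n) * g⁻¹ := by simp only [mul_assoc]
    _ = _ := by rw [Matrix.nonsing_inv_mul _ hu, mul_one, mul_one, t0_cube]; noncomm_ring

theorem conj_eta {n : ℕ} {g N : LMat n} (hg : g ∈ SO0 n) (hN : Nᵀ * eta n = -(eta n * N)) :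
    (g * N * g⁻¹)ᵀ * eta n = -(eta n * (g * N * g⁻¹)) := by
  have h2 := eta_sq n
  have h3 := eta_t n
  rw [SO0_inv_eq hg]
  simp only [Matrix.transpose_mul, Matrix.transpose_transpose, h3]
  have hN' : eta n * Nᵀ = -(N * eta n) := by
    have := congrArg (fun Z => eta n * Z * eta n) hN
    simp only [mul_neg, neg_mul] at this
    rw [← mul_assoc (eta n) (eta n) N, h2, one_mul, mul_assoc, mul_assoc, h2, mul_one] at this
    exact this
  calc _ = eta n * g * (eta n * Nᵀ) * gᵀ * eta n := by simp only [mul_assoc]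
    _ = _ := by rw [hN']; noncomm_ring

theorem orbit_eta {n : ℕ} {X : LMat n} (hX : ∃ g ∈ SO0 n, X = g * t0 n * g⁻¹) :
    Xᵀ * eta n = -(eta n * X) := by
  obtain ⟨g, hg, rfl⟩ := hX
  exact conj_eta hg (t0_eta n)

theorem SO0_inv_conj {n : ℕ} {g N : LMat n} (hg : g ∈ SO0 n) (hN : Nᵀ * eta n = -(eta n * N)) :
    (g⁻¹ * N * g)ᵀ * eta n = -(eta n * (g⁻¹ * N * g)) := by
  have h2 := eta_sq n
  have h3 := eta_t n
  rw [SO0_inv_eq hg]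
  simp only [Matrix.transpose_mul, Matrix.transpose_transpose, h3]
  calc _ = gᵀ * (Nᵀ * eta n) * g * (eta n * eta n) := by
        rw [h2, mul_one]
        calc _ = gᵀ * Nᵀ * (eta n * g * (eta n * eta n)) := by simp only [mul_assoc]
          _ = _ := by rw [h2, mul_one]; simp only [mul_assoc]
    _ = -((eta n * eta n) * gᵀ * eta n * N * g) := by rw [hN, h2]; noncomm_ring
    _ = _ := by simp only [mul_assoc]

section
attribute [local instance] Matrix.linftyOpNormedRing Matrix.linftyOpNormedAlgebra

theorem fderiv_chartG_mem {n : ℕ} {C : SMat n} (hC : Cᵀ * C = 1) (hd : C.det = 1) (a v : Model n)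
    {g : LMat n} (hg : g ∈ SO0 n) (hX : chartG C a = g * t0 n * g⁻¹) :
    fderiv ℝ (chartG C) a v ∈ LinearMap.range (frameMat g) := by
  have hu := SO0_unit hg
  have hD : HasFDerivAt (chartG C) (fderiv ℝ (chartG C) a) a :=
    ((contDiff_chartG C).differentiable (by simp) a).hasFDerivAt
  set V := fderiv ℝ (chartG C) a v with hV
  set X := chartG C a with hXdef
  have k1 : V * X * X + X * V * X + X * X * V = -V := by
    have e : (fun b => chartG C b * chartG C b * chartG C b) = fun b => -chartG C b :=
      funext fun b => orbit_cube (chartG_mem hC hd b)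
    have h1 := ((hD.mul' hD).mul' hD)
    have h2 := hD.neg
    have h3 := (h1.congr_of_eventuallyEq (Filter.EventuallyEq.of_eq e.symm)).unique h2
    have h4 := congrArg (fun L => L v) h3
    have h5 : X * X * V + (X * V + V * X) * X = -V := h4
    rw [← h5]; noncomm_ring
  have k2 : Vᵀ * eta n = -(eta n * V) := by
    let L : LMat n →ₗ[ℝ] LMat n :=
      { toFun := fun Z => Zᵀ * eta n + eta n * Z
        map_add' := fun A B => by simp only [Matrix.transpose_add]; noncomm_ring
        map_smul' := fun c A => by simp [Matrix.transpose_smul] }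
    have e : (fun b => LinearMap.toContinuousLinearMap L (chartG C b)) = fun _ => 0 :=
      funext fun b => by
        show (chartG C b)ᵀ * eta n + eta n * chartG C b = 0
        rw [orbit_eta (chartG_mem hC hd b)]; simp
    have h1 := (LinearMap.toContinuousLinearMap L).hasFDerivAt.comp a hD
    have h3 := (h1.congr_of_eventuallyEq (Filter.EventuallyEq.of_eq e.symm)).unique
      (hasFDerivAt_const (0 : LMat n) a)
    have h4 : Vᵀ * eta n + eta n * V = 0 := congrArg (fun L => L v) h3
    exact eq_neg_of_add_eq_zero_left h4
  obtain ⟨b, hb⟩ := mem_frameMat_base (N := g⁻¹ * V * g) (SO0_inv_conj hg k2) (by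
    have hgg := Matrix.nonsing_inv_mul _ hu
    have hgg' := Matrix.mul_nonsing_inv _ hu
    have ht : t0 n = g⁻¹ * X * g := by
      rw [hX]
      calc t0 n = (g⁻¹ * g) * t0 n * (g⁻¹ * g) := by rw [hgg]; simp
        _ = _ := by simp only [mul_assoc]
    have c : ∀ A B : LMat n, (g⁻¹ * A * g) * (g⁻¹ * B * g) = g⁻¹ * (A * B) * g := fun A B => by
      calc _ = g⁻¹ * A * (g * g⁻¹) * B * g := by simp only [mul_assoc]
        _ = _ := by rw [hgg', mul_one]; simp only [mul_assoc]
    rw [ht]; simp only [c]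
    rw [← neg_mul, ← mul_neg, ← k1]; noncomm_ring)
  refine ⟨b, ?_⟩
  show g * (mMat n b * t0 n - t0 n * mMat n b) * g⁻¹ = V
  rw [hb]
  calc _ = (g * g⁻¹) * V * (g * g⁻¹) := by simp only [mul_assoc]
    _ = V := by rw [Matrix.mul_nonsing_inv _ hu, one_mul, mul_one]

theorem fderiv_chartG_injective {n : ℕ} {C : SMat n} (hC : Cᵀ * C = 1) (hd : C.det = 1)
    (a : Model n) : Function.Injective (fderiv ℝ (chartG C) a) := by
  have hmem : chartG C a ∈ dom C := ((chart C hC hd).map_target' (x := a) trivial)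
  have h1 := ((contDiffAt_chartF hmem).differentiableAt (by simp)).hasFDerivAt
  have hD : HasFDerivAt (chartG C) (fderiv ℝ (chartG C) a) a :=
    ((contDiff_chartG C).differentiable (by simp) a).hasFDerivAt
  have h2 := h1.comp a hD
  have e : chartF C ∘ chartG C = id := funext fun b => chartF_chartG hC b
  rw [e] at h2
  have h3 := h2.unique (hasFDerivAt_id a)
  intro v w hvw
  have h4 : ∀ v, (fderiv ℝ (chartF C) (chartG C a)) (fderiv ℝ (chartG C) a v) = v := fun v =>
    congrArg (fun L => L v) h3
  rw [← h4 v, ← h4 w, hvw]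

theorem tangentMat_eq {n : ℕ} (X : Twistor n) : ∃ (C : SMat n) (a : Model n),
    Cᵀ * C = 1 ∧ C.det = 1 ∧ chartG C a = X.1 ∧
    ∀ v, tangentMat X v = fderiv ℝ (chartG C) a v := by
  obtain ⟨C, a, h1, h2, h3, h4⟩ := mfderiv_coords X
  refine ⟨C, a, h1, h2, h3, fun v => ?_⟩
  show Matrix.of (mfderiv 𝓘(ℝ, Model n) 𝓘(ℝ, LIdx n → LIdx n → ℝ) coords X v) = _
  rw [h4]
  rfl
end

/-- The inclusion of the twistor space in the space of matrices is an immersion. -/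
theorem tangentMat_injective {n : ℕ} (X : Twistor n) : Function.Injective (tangentMat X) := by
  obtain ⟨C, a, h1, h2, -, h4⟩ := tangentMat_eq X
  intro v w hvw
  rw [h4, h4] at hvw
  exact fderiv_chartG_injective h1 h2 a hvw

/-- The tangent space at `g j₀' g⁻¹` consists of the matrices `g [A, j₀'] g⁻¹`, `A ∈ 𝔭 ⊕ 𝔮`. -/
theorem range_tangentMat {n : ℕ} (X : Twistor n) {g : LMat n} (hg : g ∈ SO0 n)
    (hX : X.1 = g * t0 n * g⁻¹) :
    LinearMap.range (frameMat g) = LinearMap.range (tangentMat X) := by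
  symm
  apply Submodule.eq_of_le_of_finrank_eq
  · rintro _ ⟨v, rfl⟩
    obtain ⟨C, a, h1, h2, h3, h4⟩ := tangentMat_eq X
    rw [h4]
    exact fderiv_chartG_mem h1 h2 a v hg (h3.trans hX)
  · rw [LinearMap.finrank_range_of_inj (tangentMat_injective X),
      LinearMap.finrank_range_of_inj (frameMat_injective hg)]
    rfl

/-- The identification `𝔭 ⊕ 𝔮 ≃ T_X` given by `A ↦ d/ds (g exp(sA) j₀' exp(-sA) g⁻¹)` at `s = 0`,
where `X = g j₀' g⁻¹`. -/
def frame {n : ℕ} (X : Twistor n) {g : LMat n} (hg : g ∈ SO0 n) (hX : X.1 = g * t0 n * g⁻¹) :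
    Model n ≃ₗ[ℝ] TangentSpace 𝓘(ℝ, Model n) X :=
  (LinearEquiv.ofInjective (frameMat g) (frameMat_injective hg)).trans
    ((LinearEquiv.ofEq _ _ (range_tangentMat X hg hX)).trans
      (LinearEquiv.ofInjective (tangentMat X) (tangentMat_injective X)).symm)

theorem tangentMat_frame {n : ℕ} (X : Twistor n) {g : LMat n} (hg : g ∈ SO0 n)
    (hX : X.1 = g * t0 n * g⁻¹) (a : Model n) :
    tangentMat X (frame X hg hX a) = g * (mMat n a * t0 n - t0 n * mMat n a) * g⁻¹ := by
  have h := LinearEquiv.apply_symm_apply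
    (LinearEquiv.ofInjective (tangentMat X) (tangentMat_injective X))
    (LinearEquiv.ofEq _ _ (range_tangentMat X hg hX)
      (LinearEquiv.ofInjective (frameMat g) (frameMat_injective hg) a))
  exact congrArg Subtype.val h


/-- The endomorphism `(0 ᵗu; u B) ↦ (0 ε ᵗ(j₀u); ε j₀u j₀B)` of `𝔭 ⊕ 𝔮`. -/
def baseJ (n : ℕ) (ε : ℝ) : Model n →ₗ[ℝ] Model n where
  toFun a := (ε • (j0 n *ᵥ a.1), ⟨j0 n * (a.2 : SMat n), by
    have h1 := a.2.2.1
    have h2 := a.2.2.2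
    constructor
    · rw [Matrix.transpose_mul, h1, j0_t, neg_mul_neg, h2]
    · rw [mul_assoc, h2, mul_neg]⟩)
  map_add' a b := Prod.ext (by
      show ε • (j0 n *ᵥ (a.1 + b.1)) = ε • (j0 n *ᵥ a.1) + ε • (j0 n *ᵥ b.1)
      rw [Matrix.mulVec_add, smul_add])
    (Subtype.ext (mul_add _ _ _))
  map_smul' c a := Prod.ext (by
      show ε • (j0 n *ᵥ (c • a.1)) = c • (ε • (j0 n *ᵥ a.1))
      rw [Matrix.mulVec_smul, smul_comm])
    (Subtype.ext (mul_smul_comm _ _ _))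

/-- The form `(A, A') ↦ -Tr (j₀' [A, A'])` on `𝔭 ⊕ 𝔮`. -/
def baseForm (n : ℕ) : Model n →ₗ[ℝ] Model n →ₗ[ℝ] ℝ :=
  LinearMap.mk₂ ℝ (fun a b => -(t0 n * (mMat n a * mMat n b - mMat n b * mMat n a)).trace)
    (fun a a' b => by
      rw [map_add, ← neg_add, ← Matrix.trace_add]; congr 2; noncomm_ring)
    (fun c a b => by
      rw [map_smul, smul_mul_assoc, mul_smul_comm, ← smul_sub, mul_smul_comm, Matrix.trace_smul,
        smul_neg])
    (fun a b b' => by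
      rw [map_add, ← neg_add, ← Matrix.trace_add]; congr 2; noncomm_ring)
    (fun c a b => by
      rw [map_smul, smul_mul_assoc, mul_smul_comm, ← smul_sub, mul_smul_comm, Matrix.trace_smul,
        smul_neg])

/-- The left invariant structure equal to `baseJ n ε` at the base point: `J⁺` for `ε = 1` and `J⁻`
for `ε = -1`. By `twistorJ_frame` it does not depend on the choice of `g` with `X = g j₀' g⁻¹`. -/
def twistorJ (n : ℕ) (ε : ℝ) (X : Twistor n) :
    TangentSpace 𝓘(ℝ, Model n) X →ₗ[ℝ] TangentSpace 𝓘(ℝ, Model n) X :=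
  let F := frame X X.2.choose_spec.1 X.2.choose_spec.2
  F.toLinearMap ∘ₗ baseJ n ε ∘ₗ F.symm.toLinearMap

/-- The left invariant Kirillov–Kostant–Souriau form, equal to `baseForm n` at the base point; see
`kks_apply` for its value in terms of any representatives. -/
def kks (n : ℕ) (X : Twistor n) :
    TangentSpace 𝓘(ℝ, Model n) X →ₗ[ℝ] TangentSpace 𝓘(ℝ, Model n) X →ₗ[ℝ] ℝ :=
  let F := frame X X.2.choose_spec.1 X.2.choose_spec.2
  (baseForm n).compl₁₂ F.symm.toLinearMap F.symm.toLinearMap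

theorem conj_mul {n : ℕ} {g : LMat n} (hg : g ∈ SO0 n) (A B : LMat n) :
    (g * A * g⁻¹) * (g * B * g⁻¹) = g * (A * B) * g⁻¹ := by
  calc _ = g * A * (g⁻¹ * g) * B * g⁻¹ := by simp only [mul_assoc]
    _ = _ := by rw [Matrix.nonsing_inv_mul _ (SO0_unit hg), mul_one]; simp only [mul_assoc]

theorem fromBlocks_std {n : ℕ} (u : SIdx n → ℝ) (B : SMat n) (ε : ℝ) :
    let N : LMat n :=
      Matrix.fromBlocks 0 (Matrix.replicateRow Unit u) (Matrix.replicateCol Unit u) B;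
    -(t0 n * N * (t0 n * t0 n)) + ε • (t0 n * N * (1 + t0 n * t0 n) - (1 + t0 n * t0 n) * N * t0 n)
     = Matrix.fromBlocks 0 (Matrix.replicateRow Unit (ε • (j0 n *ᵥ u)))
      (Matrix.replicateCol Unit (ε • (j0 n *ᵥ u))) (j0 n * B) := by
  dsimp only
  have h1 : (u ᵥ* j0 n) = -(j0 n *ᵥ u) := by
    rw [← Matrix.mulVec_transpose, j0_t, Matrix.neg_mulVec]
  have hj := j0_sq n
  have hone : (1 : LMat n) = Matrix.fromBlocks 1 0 0 1 := Matrix.fromBlocks_one.symm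
  simp only [t0, hone, Matrix.fromBlocks_multiply, sub_eq_add_neg,
    Matrix.fromBlocks_neg, Matrix.fromBlocks_add, Matrix.fromBlocks_smul, hj, Matrix.fromBlocks_inj]
  refine ⟨by simp, ?_, ?_, ?_⟩
  · ext i j
    simp [← Matrix.replicateRow_vecMul, h1]
  · ext i j
    simp [← Matrix.replicateCol_mulVec]
  · simp

/-- The structure `J^ε` does not depend on the choice of `g` with `X = g j₀' g⁻¹`. -/
theorem twistorJ_frame {n : ℕ} (ε : ℝ) (X : Twistor n) {g : LMat n} (hg : g ∈ SO0 n)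
    (hX : X.1 = g * t0 n * g⁻¹) (a : Model n) :
    twistorJ n ε X (frame X hg hX a) = frame X hg hX (baseJ n ε a) := by
  have key : ∀ {g : LMat n} (hg : g ∈ SO0 n) (hX : X.1 = g * t0 n * g⁻¹) (a : Model n),
      tangentMat X (frame X hg hX (baseJ n ε a)) =
      -(X.1 * tangentMat X (frame X hg hX a) * (X.1 * X.1)) +
        ε • (X.1 * tangentMat X (frame X hg hX a) * (1 + X.1 * X.1) -
          (1 + X.1 * X.1) * tangentMat X (frame X hg hX a) * X.1) := by
    intro g hg hX a
    have h1 : (1 : LMat n) = g * 1 * g⁻¹ := by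
      rw [mul_one, Matrix.mul_nonsing_inv _ (SO0_unit hg)]
    rw [tangentMat_frame, tangentMat_frame, hX]
    have e := fromBlocks_std (-(j0 n *ᵥ a.1)) (-((2 : ℝ) • (j0 n * (a.2 : SMat n)))) ε
    dsimp only at e
    rw [← mMat_comm] at e
    have e2 : mMat n (baseJ n ε a) * t0 n - t0 n * mMat n (baseJ n ε a) =
        -(t0 n * (mMat n a * t0 n - t0 n * mMat n a) * (t0 n * t0 n)) +
        ε • (t0 n * (mMat n a * t0 n - t0 n * mMat n a) * (1 + t0 n * t0 n) -
          (1 + t0 n * t0 n) * (mMat n a * t0 n - t0 n * mMat n a) * t0 n) := by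
      rw [e, mMat_comm, Matrix.fromBlocks_inj]
      have h3 : -(j0 n *ᵥ (ε • (j0 n *ᵥ a.1))) = ε • (j0 n *ᵥ -(j0 n *ᵥ a.1)) := by
        rw [Matrix.mulVec_smul, Matrix.mulVec_neg, smul_neg]
      refine ⟨rfl, congrArg _ h3, congrArg _ h3, ?_⟩
      show -((2 : ℝ) • (j0 n * (j0 n * (a.2 : SMat n)))) = _
      simp
    rw [e2]
    generalize mMat n a * t0 n - t0 n * mMat n a = N
    have h4 : 1 + g * t0 n * g⁻¹ * (g * t0 n * g⁻¹) = g * (1 + t0 n * t0 n) * g⁻¹ := by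
      rw [conj_mul hg, mul_add, add_mul, ← h1]
    rw [h4]
    simp only [conj_mul hg]
    simp only [mul_add, add_mul, mul_sub, sub_mul, smul_mul_assoc, mul_smul_comm, mul_neg, neg_mul]
  apply tangentMat_injective X
  set F := frame X X.2.choose_spec.1 X.2.choose_spec.2 with hF
  have e1 : twistorJ n ε X (frame X hg hX a) = F (baseJ n ε (F.symm (frame X hg hX a))) := rfl
  rw [e1, key hg hX, hF, key X.2.choose_spec.1 X.2.choose_spec.2]
  rw [← hF, LinearEquiv.apply_symm_apply]

/-- The Kirillov–Kostant–Souriau form: `ω_X(ξ·X, ζ·X) = -Tr (X [ξ, ζ])`, for any choice of the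
matrices `ξ`, `ζ` in `so(1,2n)` that represent the given tangent vectors. -/
theorem kks_apply {n : ℕ} (X : Twistor n) (ξ ζ : LMat n) (v w : TangentSpace 𝓘(ℝ, Model n) X)
    (hξ : tangentMat X v = ξ * X.1 - X.1 * ξ) (hζ : tangentMat X w = ζ * X.1 - X.1 * ζ) :
    kks n X v w = -(X.1 * (ξ * ζ - ζ * ξ)).trace := by
  have hind : ∀ ξ ξ' ζ : LMat n, ξ * X.1 - X.1 * ξ = ξ' * X.1 - X.1 * ξ' →
      (X.1 * (ξ * ζ - ζ * ξ)).trace = (X.1 * (ξ' * ζ - ζ * ξ')).trace := by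
    intro ξ ξ' ζ h
    have e : ∀ ξ : LMat n, (X.1 * (ξ * ζ - ζ * ξ)).trace = -((ξ * X.1 - X.1 * ξ) * ζ).trace := by
      intro ξ
      rw [mul_sub, sub_mul, Matrix.trace_sub, Matrix.trace_sub, ← mul_assoc, ← mul_assoc,
        Matrix.trace_mul_comm (X.1 * ζ) ξ, ← mul_assoc]
      ring
    rw [e, e, h]
  have hg := X.2.choose_spec.1
  have hX := X.2.choose_spec.2
  set g := X.2.choose
  set F := frame X hg hX with hF
  obtain ⟨a, rfl⟩ := F.surjective v
  obtain ⟨b, rfl⟩ := F.surjective w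
  have hgg := Matrix.nonsing_inv_mul _ (SO0_unit hg)
  have hc : ∀ A : LMat n, g * (A * t0 n - t0 n * A) * g⁻¹ =
      (g * A * g⁻¹) * X.1 - X.1 * (g * A * g⁻¹) := by
    intro A
    rw [hX, conj_mul hg, conj_mul hg, mul_sub, sub_mul]
  rw [hF, tangentMat_frame, hc] at hξ hζ
  have e1 : kks n X (F a) (F b) = baseForm n (F.symm (F a)) (F.symm (F b)) := rfl
  rw [e1, LinearEquiv.symm_apply_apply, LinearEquiv.symm_apply_apply]
  rw [← hind _ _ ζ hξ]
  have e2 : ∀ ξ ζ : LMat n, (X.1 * (ξ * ζ - ζ * ξ)).trace = -(X.1 * (ζ * ξ - ξ * ζ)).trace := by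
    intro ξ ζ
    rw [← Matrix.trace_neg]; congr 1; noncomm_ring
  rw [e2, ← hind _ _ _ hζ, ← e2]
  show -(t0 n * (mMat n a * mMat n b - mMat n b * mMat n a)).trace = _
  rw [hX, conj_mul hg, conj_mul hg, ← sub_mul, ← mul_sub, conj_mul hg,
    Matrix.trace_mul_comm _ g⁻¹, ← mul_assoc, ← mul_assoc, hgg, one_mul]

/-- The isotropy group of the base point is `U(n) = {C ∈ SO(2n) | C j₀ = j₀ C}`. -/
theorem stabilizer_t0 {n : ℕ} {g : LMat n} (hg : g ∈ SO0 n) :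
    g * t0 n * g⁻¹ = t0 n ↔ ∃ C ∈ Matrix.specialOrthogonalGroup (SIdx n) ℝ,
      C * j0 n = j0 n * C ∧ g = Matrix.fromBlocks 1 0 0 C := by
  have hu := SO0_unit hg
  have h0 : g * t0 n * g⁻¹ = t0 n ↔ g * t0 n = t0 n * g := by
    constructor
    · intro h
      calc g * t0 n = g * t0 n * g⁻¹ * g := by rw [Matrix.nonsing_inv_mul_cancel_right _ _ hu]
        _ = _ := by rw [h]
    · intro h
      rw [h, Matrix.mul_nonsing_inv_cancel_right _ _ hu]
  rw [h0]
  constructor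
  · intro h
    obtain ⟨g1, g2, g3⟩ := hg
    rw [← Matrix.fromBlocks_toBlocks g] at h g1 g2 ⊢
    have g3' : 0 < g.toBlocks₁₁ () () := g3
    generalize g.toBlocks₁₁ = a at *
    generalize g.toBlocks₁₂ = b at *
    generalize g.toBlocks₂₁ = c at *
    generalize g.toBlocks₂₂ = C at *
    rw [t0, Matrix.fromBlocks_multiply, Matrix.fromBlocks_multiply, Matrix.fromBlocks_inj] at h
    obtain ⟨-, h2, h3, h4⟩ := h
    have hb : b = 0 := by
      have : b * j0 n = 0 := by simpa using h2
      have := congrArg (fun Z : Matrix Unit (SIdx n) ℝ => Z * j0 n) this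
      simpa [Matrix.mul_assoc, j0_sq] using this
    have hc : c = 0 := by
      have : j0 n * c = 0 := by simpa using h3.symm
      have := congrArg (fun Z : Matrix (SIdx n) Unit ℝ => j0 n * Z) this
      simpa [← Matrix.mul_assoc, j0_sq] using this
    subst hb hc
    rw [eta_eq, Matrix.fromBlocks_transpose, Matrix.fromBlocks_multiply,
      Matrix.fromBlocks_multiply, Matrix.fromBlocks_inj] at g1
    obtain ⟨k1, -, -, k4⟩ := g1
    have ha : a = 1 := by
      have e : a () () * a () () = 1 := by
        have := congrFun (congrFun k1 ()) ()
        simpa [Matrix.mul_apply] using this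
      ext i j
      have : a () () = 1 := by nlinarith
      simpa using this
    subst ha
    have hC : Cᵀ * C = 1 := by simpa using k4
    refine ⟨C, ?_, by simpa using h4, rfl⟩
    rw [Matrix.mem_specialOrthogonalGroup_iff, Matrix.mem_orthogonalGroup_iff']
    refine ⟨hC, ?_⟩
    rw [Matrix.det_fromBlocks_zero₂₁] at g2
    simpa using g2
  · rintro ⟨C, -, hC, rfl⟩
    simp [t0, Matrix.fromBlocks_multiply, hC]

end

/-- The almost complex structure `J⁺` on the twistor space. -/
noncomputable def twistorJPlus (n : ℕ) (X : Twistor n) :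
    TangentSpace 𝓘(ℝ, Model n) X →ₗ[ℝ] TangentSpace 𝓘(ℝ, Model n) X :=
  twistorJ n 1 X

/-- The almost complex structure `J⁻` on the twistor space. -/
noncomputable def twistorJMinus (n : ℕ) (X : Twistor n) :
    TangentSpace 𝓘(ℝ, Model n) X →ₗ[ℝ] TangentSpace 𝓘(ℝ, Model n) X :=
  twistorJ n (-1) X

end HypTwistor

/-! The twistor space is treated as a submanifold of the algebra of real matrices. Its points
satisfy `X³ = -X` and `Xᵀη = -ηX`, and its tangent space at `X` is exactly the solution space of the
linearised equations (`tangentMat_rel`, `tangentMat_eta`, `mem_range_tangentMat`). In these terms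
`J^ε` and `ω` are restrictions of polynomial expressions in `X` and the tangent matrices (`matJ`,
`matForm`), so smoothness is immediate. Brackets of fields are commutators of derivatives of
matrix-valued functions (`fieldMat_mlieBracket`), and every differential identity becomes matrix
algebra.

Closedness: the terms of `dω` that differentiate the fields cancel against the bracket terms. What
remains is a cyclic sum of traces of three tangent matrices with powers of `X` inserted. It vanishes
because a tangent matrix has no block from `ker X` to itself, and because a product of three
matrices anticommuting with `X` on the image of `X` has trace zero.

Signs: on `𝔭 ⊕ 𝔮` one finds `ω(a, J^ε a) = -2ε|u|² + 2 ∑ B_ik²`. This is positive definite for `ε =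
-1`, which also gives nondegeneracy, and negative on `𝔭` for `ε = 1`.

Non-integrability of `J⁻`: the Nijenhuis tensor has a polynomial expression `matNij`, equivariant
under conjugation, so it is enough to compute at `j₀'`. There `𝔭 × 𝔭` fills `𝔮`, and `𝔭 × 𝔮` fills
`𝔭` as soon as `n ≥ 2`.

Integrability of `J⁺`: send `X` to its `-i` eigenspace in `ℂ^{1+2n}`, a point of a complex
Grassmannian. This map is an immersion whose differential turns `J⁺` into multiplication by `i`
(`eigenProj_relation`, `mul_eigenProj_eq_zero`). Composing the graph chart of the Grassmannian with
a complex-linear projection and applying the inverse function theorem gives explicit holomorphic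
coordinates. -/

namespace AlmostComplexGeometry

/-! ### Vector fields and their brackets seen through vector-valued maps. -/

section
variable {E : Type*} [NormedAddCommGroup E] [NormedSpace ℝ E] {M : Type*}
  [TopologicalSpace M] [ChartedSpace E M] [IsManifold 𝓘(ℝ, E) ∞ M]
  {F : Type*} [NormedAddCommGroup F] [NormedSpace ℝ F]

/-- The function `q ↦ df_q (X_q)` for a map `f` with values in a vector space. -/
noncomputable def mdir (f : M → F) (X : ∀ p : M, TangentSpace 𝓘(ℝ, E) p) (q : M) : F :=
  mfderiv 𝓘(ℝ, E) 𝓘(ℝ, F) f q (X q)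

theorem IsSmoothField.mdir {f : M → F} (hf : ContMDiff 𝓘(ℝ, E) 𝓘(ℝ, F) ∞ f)
    {X : ∀ p : M, TangentSpace 𝓘(ℝ, E) p} (hX : IsSmoothField X) :
    ContMDiff 𝓘(ℝ, E) 𝓘(ℝ, F) ∞ (mdir f X) := by
  have h1 := hf.contMDiff_tangentMap (m := ∞) (by simp)
  have h2 := contMDiff_snd_tangentBundle_modelSpace F 𝓘(ℝ, F) (n := ∞)
  exact h2.comp (h1.comp hX)

omit [IsManifold 𝓘(ℝ, E) ∞ M] in
/-- In the chart at `p`, the derivative of `f` in the direction `v` is the ordinary one. -/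
theorem mfderiv_eq_fderiv_chart {f : M → F} {p : M}
    (hf : MDifferentiableAt 𝓘(ℝ, E) 𝓘(ℝ, F) f p) (v : TangentSpace 𝓘(ℝ, E) p) :
    mfderiv 𝓘(ℝ, E) 𝓘(ℝ, F) f p v =
      fderiv ℝ (f ∘ (extChartAt 𝓘(ℝ, E) p).symm) (extChartAt 𝓘(ℝ, E) p p) (v : E) := by
  have h : mfderiv 𝓘(ℝ, E) 𝓘(ℝ, F) f p =
      fderivWithin ℝ (writtenInExtChartAt 𝓘(ℝ, E) 𝓘(ℝ, F) p f) (Set.range 𝓘(ℝ, E))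
        (extChartAt 𝓘(ℝ, E) p p) := hf.mfderiv
  rw [h]
  simp only [ModelWithCorners.range_eq_univ, fderivWithin_univ]
  rfl

omit [IsManifold 𝓘(ℝ, E) ∞ M] in
theorem differentiableAt_chart {f : M → F} {p : M}
    (hf : MDifferentiableAt 𝓘(ℝ, E) 𝓘(ℝ, F) f p) :
    DifferentiableAt ℝ (f ∘ (extChartAt 𝓘(ℝ, E) p).symm) (extChartAt 𝓘(ℝ, E) p p) := by
  have h := (mdifferentiableAt_iff _ _).1 hf |>.2
  simpa only [ModelWithCorners.range_eq_univ, differentiableWithinAt_univ] using! h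

omit [IsManifold 𝓘(ℝ, E) ∞ M] in
/-- Every tangent vector is the velocity of a curve. -/
theorem exists_curve (p : M) (v : TangentSpace 𝓘(ℝ, E) p) :
    ∃ γ : ℝ → M, γ 0 = p ∧ ∀ (F : Type) [NormedAddCommGroup F] [NormedSpace ℝ F] (f : M → F),
      MDifferentiableAt 𝓘(ℝ, E) 𝓘(ℝ, F) f p →
      HasDerivAt (fun t => f (γ t)) (mfderiv 𝓘(ℝ, E) 𝓘(ℝ, F) f p v : F) 0 := by
  obtain ⟨w, hw⟩ : ∃ w : E, w = v := ⟨v, rfl⟩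
  -- The straight line in the chart at `p`; only its germ at `t = 0` matters, so it may leave the
  -- chart later.
  refine ⟨fun t => (extChartAt 𝓘(ℝ, E) p).symm (extChartAt 𝓘(ℝ, E) p p + t • w), by simp, ?_⟩
  intro F _ _ f hf
  rw [mfderiv_eq_fderiv_chart hf, ← hw]
  have h1 := (differentiableAt_chart hf).hasFDerivAt
  have h2 : HasDerivAt (fun t : ℝ => extChartAt 𝓘(ℝ, E) p p + t • w) w 0 := by
    simpa using! ((hasDerivAt_id (0 : ℝ)).smul_const w).const_add (extChartAt 𝓘(ℝ, E) p p)
  have h3 : extChartAt 𝓘(ℝ, E) p p = extChartAt 𝓘(ℝ, E) p p + (0 : ℝ) • w := by simp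
  exact HasFDerivAt.comp_hasDerivAt_of_eq (0 : ℝ) h1 h2 h3

/-- The bracket of vector fields, seen through a map with values in a vector space. -/
theorem mfderiv_mlieBracket [CompleteSpace E] {f : M → F} (hf : ContMDiff 𝓘(ℝ, E) 𝓘(ℝ, F) ∞ f)
    {X Y : ∀ p : M, TangentSpace 𝓘(ℝ, E) p} (hX : IsSmoothField X) (hY : IsSmoothField Y) (p : M) :
    mdir f (VectorField.mlieBracket 𝓘(ℝ, E) X Y) p = mdir (mdir f Y) X p - mdir (mdir f X) Y p := by
  set φ := extChartAt 𝓘(ℝ, E) p with hφ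
  set a := φ p with ha
  -- `T X` is the expression of the field `X` in the chart at `p`.
  let T : (∀ p : M, TangentSpace 𝓘(ℝ, E) p) → E → E := fun X =>
    VectorField.mpullbackWithin 𝓘(ℝ, E) 𝓘(ℝ, E) φ.symm X (Set.range 𝓘(ℝ, E))
  have ht : φ.target ∈ nhds a := extChartAt_target_mem_nhds p
  have hG : ContDiffAt ℝ ∞ (f ∘ φ.symm) a := by
    have h := (contMDiffAt_iff.1 (hf p)).2
    simpa only [ModelWithCorners.range_eq_univ, contDiffWithinAt_univ] using! h
  have hT : ∀ {X : ∀ p : M, TangentSpace 𝓘(ℝ, E) p}, IsSmoothField X →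
      DifferentiableAt ℝ (T X) a := by
    intro X hX
    have h := ((hX p).mdifferentiableAt (by simp)).mdifferentiableWithinAt (s := Set.univ)
    have h2 := MDifferentiableWithinAt.differentiableWithinAt_mpullbackWithin_vectorField h
    rw [← differentiableWithinAt_univ]
    convert h2 using 1
    simp
  -- The chart at `p` serves to identify `T_p M` with `E`, so its differential at `p` is the
  -- identity and no Jacobian appears in the formulas at `a`.
  have hI : ∀ v : TangentSpace 𝓘(ℝ, E) p,
      (mfderiv 𝓘(ℝ, E) 𝓘(ℝ, E) φ p).inverse v = v := fun v =>
    (isInvertible_mfderiv_extChartAt (mem_extChartAt_source p)).inverse_apply_eq.2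
      (congrArg (fun A : TangentSpace 𝓘(ℝ, E) p →L[ℝ] TangentSpace 𝓘(ℝ, E) p => A v)
        (mfderiv_extChartAt_self (I := 𝓘(ℝ, E)) (x := p))).symm
  have hTa : ∀ X : ∀ p : M, TangentSpace 𝓘(ℝ, E) p, T X a = X p := by
    intro X
    have h := VectorField.mfderiv_extChartAt_inverse_comp_mfderivWithin_extChartAT_symm
      (I := 𝓘(ℝ, E)) (x := p) (X p)
    have h2 : ∀ q, q = p → ∀ A : E →L[ℝ] E, A (X q) = A (X p) := by rintro q rfl A; rfl
    exact (h2 _ (extChartAt_to_inv p) _).trans ((hI _).symm.trans h)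
  have hfT : ∀ {X : ∀ p : M, TangentSpace 𝓘(ℝ, E) p},
      (mdir f X) ∘ φ.symm =ᶠ[nhds a] fun b => fderiv ℝ (f ∘ φ.symm) b (T X b) := by
    intro X
    filter_upwards [ht] with b hb
    have h1 := isInvertible_mfderivWithin_extChartAt_symm (I := 𝓘(ℝ, E)) hb
    have h2 : mfderiv 𝓘(ℝ, E) 𝓘(ℝ, E) φ.symm b (T X b) = X (φ.symm b) := by
      rw [← mfderivWithin_univ, ← ModelWithCorners.range_eq_univ 𝓘(ℝ, E)]
      exact h1.self_apply_inverse _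
    have h3 := mfderiv_comp_apply (I := 𝓘(ℝ, E)) (I' := 𝓘(ℝ, E)) (I'' := 𝓘(ℝ, F)) b
      (hf.mdifferentiable (by simp) (φ.symm b)) ((contMDiffOn_extChartAt_symm (n := 1) p b hb).contMDiffAt ((isOpen_extChartAt_target p).mem_nhds hb) |>.mdifferentiableAt (by simp)) (T X b)
    rw [h2, mfderiv_eq_fderiv] at h3
    exact h3.symm
  -- Product rule for `b ↦ G'(b)(T Y b)` with `G = f ∘ φ⁻¹`. The Hessian term is symmetric in `X`
  -- and `Y`, so it disappears from the commutator.
  have hder : ∀ {X Y : ∀ p : M, TangentSpace 𝓘(ℝ, E) p}, IsSmoothField X → IsSmoothField Y →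
      mdir (mdir f Y) X p = fderiv ℝ (fderiv ℝ (f ∘ φ.symm)) a (X p) (Y p)
        + fderiv ℝ (f ∘ φ.symm) a (fderiv ℝ (T Y) a (X p)) := by
    intro X Y hX hY
    have h1 : mdir (mdir f Y) X p = fderiv ℝ (mdir f Y ∘ φ.symm) a (X p) :=
      mfderiv_eq_fderiv_chart ((hY.mdir hf).mdifferentiableAt (by simp)) _
    rw [h1, hfT.fderiv_eq]
    have h2 : DifferentiableAt ℝ (fderiv ℝ (f ∘ φ.symm)) a :=
      (hG.fderiv_right (m := 1) (by norm_cast)).differentiableAt (by simp)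
    rw [fderiv_clm_apply h2 (hT hY)]
    rw [hTa, add_comm]
    rfl
  have hb : VectorField.mlieBracket 𝓘(ℝ, E) X Y p =
      fderiv ℝ (T Y) a (X p) - fderiv ℝ (T X) a (Y p) := by
    rw [← VectorField.mlieBracketWithin_univ, VectorField.mlieBracketWithin_apply]
    have h : ∀ V W : E → E, VectorField.lieBracketWithin ℝ V W
        (φ.symm ⁻¹' Set.univ ∩ Set.range 𝓘(ℝ, E)) a = fderiv ℝ W a (V a) - fderiv ℝ V a (W a) := by
      intro V W
      simp [VectorField.lieBracketWithin]
    refine (hI _).trans ((h (T X) (T Y)).trans ?_)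
    rw [hTa, hTa]
  rw [hder hX hY, hder hY hX]
  have h1 : mdir f (VectorField.mlieBracket 𝓘(ℝ, E) X Y) p =
     fderiv ℝ (f ∘ φ.symm) a (VectorField.mlieBracket 𝓘(ℝ, E) X Y p) :=
    mfderiv_eq_fderiv_chart (hf.mdifferentiableAt (by simp)) _
  have h2 := hG.isSymmSndFDerivAt (by simp; norm_cast)
  rw [h1, hb, map_sub, h2 (X p) (Y p)]
  abel

end

end AlmostComplexGeometry

/-! ### The twistor space as a submanifold of the matrix algebra. -/

namespace HypTwistor

open AlmostComplexGeometry

section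
attribute [local instance] Matrix.linftyOpNormedRing Matrix.linftyOpNormedAlgebra

/-- The algebra of matrices with its normed structure. -/
def AMat (n : ℕ) : Type := LMat n
noncomputable instance (n : ℕ) : NormedRing (AMat n) := inferInstanceAs (NormedRing (LMat n))
noncomputable instance (n : ℕ) : NormedAlgebra ℝ (AMat n) :=
  inferInstanceAs (NormedAlgebra ℝ (LMat n))

/-- The inclusion of the twistor space in the algebra of matrices. -/
def matOf {n : ℕ} (X : Twistor n) : AMat n := X.1

theorem contMDiff_val (n : ℕ) :
    ContMDiff 𝓘(ℝ, Model n) 𝓘(ℝ, AMat n) ∞ (matOf (n := n)) := by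
  let L : (LIdx n → LIdx n → ℝ) →L[ℝ] AMat n := LinearMap.toContinuousLinearMap
    (Matrix.ofLinearEquiv ℝ : (LIdx n → LIdx n → ℝ) ≃ₗ[ℝ] LMat n).toLinearMap
  exact L.contMDiff.comp (contMDiff_coords n)

theorem tangentMat_eq_mfderiv {n : ℕ} (X : Twistor n) (v : TangentSpace 𝓘(ℝ, Model n) X) :
    tangentMat X v = mfderiv 𝓘(ℝ, Model n) 𝓘(ℝ, AMat n) (matOf (n := n)) X v := by
  let L : (LIdx n → LIdx n → ℝ) →L[ℝ] AMat n := LinearMap.toContinuousLinearMap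
    (Matrix.ofLinearEquiv ℝ : (LIdx n → LIdx n → ℝ) ≃ₗ[ℝ] LMat n).toLinearMap
  have h := mfderiv_comp_apply (I := 𝓘(ℝ, Model n)) (I' := 𝓘(ℝ, LIdx n → LIdx n → ℝ))
    (I'' := 𝓘(ℝ, AMat n)) X (g := L) (f := coords) (L.contMDiff.mdifferentiableAt one_ne_zero)
    ((contMDiff_coords n).mdifferentiable (by simp) X) v
  rw [mfderiv_eq_fderiv, L.fderiv] at h
  exact h.symm

/-- A vector field on the twistor space as a matrix valued function. -/
noncomputable def fieldMat {n : ℕ} (X : ∀ p : Twistor n, TangentSpace 𝓘(ℝ, Model n) p) :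
    Twistor n → AMat n := fun p => tangentMat p (X p)

theorem fieldMat_eq_mdir {n : ℕ} (X : ∀ p : Twistor n, TangentSpace 𝓘(ℝ, Model n) p) :
    fieldMat X = mdir matOf X := funext fun p => tangentMat_eq_mfderiv p (X p)

/-- The preferred chart at `p`, as a function of the matrix. -/
noncomputable def chartOf {n : ℕ} (p : Twistor n) : AMat n → Model n :=
  chartF (exists_rot p).choose

theorem contDiffAt_chartOf {n : ℕ} {p q : Twistor n} (hq : q ∈ (chartAt (Model n) p).source) :
    ContDiffAt ℝ ∞ (chartOf p) (matOf q) := contDiffAt_chartF hq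

theorem mfderiv_extChartAt_eq {n : ℕ} {p q : Twistor n} (hq : q ∈ (chartAt (Model n) p).source)
    (v : TangentSpace 𝓘(ℝ, Model n) q) :
    mfderiv 𝓘(ℝ, Model n) 𝓘(ℝ, Model n) (extChartAt 𝓘(ℝ, Model n) p) q v =
      fderiv ℝ (chartOf p) (matOf q) (tangentMat q v) := by
  rw [tangentMat_eq_mfderiv, ← mfderiv_eq_fderiv]
  exact mfderiv_comp_apply (I := 𝓘(ℝ, Model n)) (I' := 𝓘(ℝ, AMat n)) (I'' := 𝓘(ℝ, Model n)) q
    (g := (chartOf p)) (f := matOf)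
    ((contDiffAt_chartOf hq).differentiableAt (by simp)).mdifferentiableAt
    ((contMDiff_val n).mdifferentiable (by simp) q) v

/-- Smoothness can be tested in the ambient matrices because each chart is the restriction of a map
`chartOf p` that is smooth near the relevant matrices. The coordinates of a field are then obtained
by applying `fderiv ℝ (chartOf p)` to its matrix. -/
theorem isSmoothField_iff {n : ℕ} (X : ∀ p : Twistor n, TangentSpace 𝓘(ℝ, Model n) p) :
    IsSmoothField X ↔ ContMDiff 𝓘(ℝ, Model n) 𝓘(ℝ, AMat n) ∞ (fieldMat X) := by
  constructor
  · intro h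
    rw [fieldMat_eq_mdir]
    exact h.mdir (contMDiff_val n)
  · intro h p
    refine (Bundle.contMDiffAt_section p).2 ?_
    have hp := mem_chart_source (Model n) p
    have h1 : ContMDiffAt 𝓘(ℝ, Model n) 𝓘(ℝ, Model n) ∞
        (fun q => fderiv ℝ (chartOf p) (matOf q)
          (fieldMat X q)) p := by
      have h2 : ContDiffAt ℝ ∞ (fderiv ℝ (chartOf p)) (matOf p) :=
        (contDiffAt_chartOf hp).fderiv_right (by simp)
      have h3 := h2.contMDiffAt.comp p ((contMDiff_val n) p)
      exact h3.clm_apply (h p)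
    refine h1.congr_of_eventuallyEq ?_
    filter_upwards [(chartAt (Model n) p).open_source.mem_nhds hp] with q hq
    rw [fieldMat, ← mfderiv_extChartAt_eq hq, ← TangentBundle.continuousLinearMapAt_trivializationAt hq]
    exact (Bundle.Trivialization.continuousLinearMapAt_apply_of_mem _ _ (by simpa using! hq) _).symm

/-- The bracket formula for functions, applied to the inclusion. The two derivatives on the right
need not be tangent separately; only their difference is. -/
theorem fieldMat_mlieBracket {n : ℕ} {X Y : ∀ p : Twistor n, TangentSpace 𝓘(ℝ, Model n) p}
    (hX : IsSmoothField X) (hY : IsSmoothField Y) :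
    fieldMat (VectorField.mlieBracket 𝓘(ℝ, Model n) X Y) =
      fun p => mdir (fieldMat Y) X p - mdir (fieldMat X) Y p := by
  have : CompleteSpace (Model n) := FiniteDimensional.complete ℝ _
  simp only [fieldMat_eq_mdir]
  exact funext fun p => mfderiv_mlieBracket (contMDiff_val n) hX hY p

/-- A curve through `p` with velocity `v`, along which functions are differentiated. -/
theorem exists_curve_val {n : ℕ} (p : Twistor n) (v : TangentSpace 𝓘(ℝ, Model n) p) :
    ∃ γ : ℝ → Twistor n, γ 0 = p ∧ HasDerivAt (fun t => matOf (γ t)) (tangentMat p v : AMat n) 0 ∧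
      ∀ (F : Type) [NormedAddCommGroup F] [NormedSpace ℝ F] (f : Twistor n → F),
      ContMDiff 𝓘(ℝ, Model n) 𝓘(ℝ, F) ∞ f →
      HasDerivAt (fun t => f (γ t)) (mfderiv 𝓘(ℝ, Model n) 𝓘(ℝ, F) f p v : F) 0 := by
  obtain ⟨γ, h0, h⟩ := exists_curve p v
  refine ⟨γ, h0, ?_, fun F _ _ f hf => h F f (hf.mdifferentiable (by simp) p)⟩
  rw [tangentMat_eq_mfderiv]
  exact h (AMat n) _ ((contMDiff_val n).mdifferentiable (by simp) p)

end

/-! Tangent matrices. -/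

/-- The orbit is homogeneous: at `X = g j₀' g⁻¹` one takes `ξ = g A g⁻¹` with `A ∈ 𝔭 ⊕ 𝔮`. -/
theorem tangentMat_mem {n : ℕ} (X : Twistor n) (v : TangentSpace 𝓘(ℝ, Model n) X) :
    ∃ ξ : LMat n, ξᵀ * eta n = -(eta n * ξ) ∧ tangentMat X v = ξ * X.1 - X.1 * ξ := by
  obtain ⟨g, hg, hX⟩ := X.2
  obtain ⟨a, rfl⟩ := (frame X hg hX).surjective v
  refine ⟨g * mMat n a * g⁻¹, conj_eta hg ?_, ?_⟩
  · simp only [mMat, LinearMap.coe_mk, AddHom.coe_mk, eta_eq, Matrix.fromBlocks_transpose,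
      Matrix.fromBlocks_multiply, Matrix.fromBlocks_neg, a.2.2.1]
    rw [Matrix.fromBlocks_inj]
    simp
  · rw [tangentMat_frame, hX, conj_mul hg, conj_mul hg, mul_sub, sub_mul]

/-- The linearisation of `X³ = -X`; this is the only property of tangent vectors used in the
closedness computation. -/
theorem tangentMat_rel {n : ℕ} (X : Twistor n) (v : TangentSpace 𝓘(ℝ, Model n) X) :
    tangentMat X v * X.1 * X.1 + X.1 * tangentMat X v * X.1 + X.1 * X.1 * tangentMat X v
      = -tangentMat X v := by
  obtain ⟨ξ, -, h⟩ := tangentMat_mem X v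
  have h3 := orbit_cube X.2
  rw [h]
  generalize X.1 = x at *
  calc _ = ξ * (x * x * x) - (x * x * x) * ξ := by noncomm_ring
    _ = _ := by rw [h3]; noncomm_ring

theorem tangentMat_eta {n : ℕ} (X : Twistor n) (v : TangentSpace 𝓘(ℝ, Model n) X) :
    (tangentMat X v)ᵀ * eta n = -(eta n * tangentMat X v) := by
  obtain ⟨ξ, hξ, h⟩ := tangentMat_mem X v
  have h3 := orbit_eta X.2
  rw [h]
  generalize X.1 = x at *
  rw [Matrix.transpose_sub, Matrix.transpose_mul, Matrix.transpose_mul]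
  calc _ = xᵀ * (ξᵀ * eta n) - ξᵀ * (xᵀ * eta n) := by noncomm_ring
    _ = xᵀ * -(eta n * ξ) - ξᵀ * -(eta n * x) := by rw [hξ, h3]
    _ = -(xᵀ * eta n) * ξ + (ξᵀ * eta n) * x := by noncomm_ring
    _ = _ := by rw [hξ, h3]; noncomm_ring

/-- The linearised equations suffice: conjugating by `g⁻¹` reduces to the base point, where
`mem_frameMat_base` solves for the element of `𝔭 ⊕ 𝔮`. -/
theorem mem_range_tangentMat {n : ℕ} (X : Twistor n) {V : LMat n}
    (h1 : V * X.1 * X.1 + X.1 * V * X.1 + X.1 * X.1 * V = -V)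
    (h2 : Vᵀ * eta n = -(eta n * V)) : ∃ v, tangentMat X v = V := by
  obtain ⟨g, hg, hX⟩ := X.2
  have hu := SO0_unit hg
  have hgg := Matrix.nonsing_inv_mul _ hu
  have hgg' := Matrix.mul_nonsing_inv _ hu
  obtain ⟨b, hb⟩ := mem_frameMat_base (N := g⁻¹ * V * g) (SO0_inv_conj hg h2) (by
    have ht : t0 n = g⁻¹ * X.1 * g := by
      rw [hX]
      calc t0 n = (g⁻¹ * g) * t0 n * (g⁻¹ * g) := by rw [hgg]; simp
        _ = _ := by simp only [mul_assoc]
    have c : ∀ A B : LMat n, (g⁻¹ * A * g) * (g⁻¹ * B * g) = g⁻¹ * (A * B) * g := fun A B => by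
      calc _ = g⁻¹ * A * (g * g⁻¹) * B * g := by simp only [mul_assoc]
        _ = _ := by rw [hgg', mul_one]; simp only [mul_assoc]
    rw [ht]; simp only [c]
    rw [← neg_mul, ← mul_neg, ← h1]; noncomm_ring)
  refine ⟨frame X hg hX b, ?_⟩
  rw [tangentMat_frame, hb]
  calc _ = (g * g⁻¹) * V * (g * g⁻¹) := by simp only [mul_assoc]
    _ = V := by rw [hgg', one_mul, mul_one]

/-- The endomorphism `J^ε` of the tangent space at `X`, as a map on matrices. -/
def matJ {n : ℕ} (ε : ℝ) (X V : LMat n) : LMat n :=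
  -(X * V * (X * X)) + ε • (X * V * (1 + X * X) - (1 + X * X) * V * X)

/-- At `j₀'`, the matrix `1 + X²` projects on `ℝe₀` and `-X²` on its orthogonal. The first term of
`matJ` therefore multiplies the `𝔮` block by `j₀`, and the two terms with `ε` multiply the column
and the row of the `𝔭` part. Conjugation by `g` carries the formula to every point. -/
theorem tangentMat_twistorJ {n : ℕ} (ε : ℝ) (X : Twistor n) (v : TangentSpace 𝓘(ℝ, Model n) X) :
    tangentMat X (twistorJ n ε X v) = matJ ε X.1 (tangentMat X v) := by
  obtain ⟨g, hg, hX⟩ := X.2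
  obtain ⟨a, rfl⟩ := (frame X hg hX).surjective v
  have h1 : (1 : LMat n) = g * 1 * g⁻¹ := by
    rw [mul_one, Matrix.mul_nonsing_inv _ (SO0_unit hg)]
  rw [twistorJ_frame, tangentMat_frame, tangentMat_frame, matJ, hX]
  have e := fromBlocks_std (-(j0 n *ᵥ a.1)) (-((2 : ℝ) • (j0 n * (a.2 : SMat n)))) ε
  dsimp only at e
  rw [← mMat_comm] at e
  have e2 : mMat n (baseJ n ε a) * t0 n - t0 n * mMat n (baseJ n ε a) =
      -(t0 n * (mMat n a * t0 n - t0 n * mMat n a) * (t0 n * t0 n)) +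
      ε • (t0 n * (mMat n a * t0 n - t0 n * mMat n a) * (1 + t0 n * t0 n) -
        (1 + t0 n * t0 n) * (mMat n a * t0 n - t0 n * mMat n a) * t0 n) := by
    rw [e, mMat_comm, Matrix.fromBlocks_inj]
    have h3 : -(j0 n *ᵥ (ε • (j0 n *ᵥ a.1))) = ε • (j0 n *ᵥ -(j0 n *ᵥ a.1)) := by
      rw [Matrix.mulVec_smul, Matrix.mulVec_neg, smul_neg]
    refine ⟨rfl, congrArg _ h3, congrArg _ h3, ?_⟩
    show -((2 : ℝ) • (j0 n * (j0 n * (a.2 : SMat n)))) = _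
    simp
  rw [e2]
  generalize mMat n a * t0 n - t0 n * mMat n a = N
  have h4 : 1 + g * t0 n * g⁻¹ * (g * t0 n * g⁻¹) = g * (1 + t0 n * t0 n) * g⁻¹ := by
    rw [conj_mul hg, mul_add, add_mul, ← h1]
  rw [h4]
  simp only [conj_mul hg]
  simp only [mul_add, add_mul, mul_sub, sub_mul, smul_mul_assoc, mul_smul_comm, mul_neg, neg_mul]

/-- The Kirillov–Kostant–Souriau form at `X`, as a form on matrices. -/
noncomputable def matForm {n : ℕ} (X V W : LMat n) : ℝ :=
  (V * X * W - V * W * X).trace + 3 / 4 * (V * X * W * X * X - V * X * X * W * X).trace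

/-- By invariance of the trace, `-Tr(X[ξ, ζ]) = Tr([ξ, X]ζ) = Tr(Vζ)`, so it suffices to write `ζ`
as a polynomial expression in `X` and `W`. -/
theorem kks_eq {n : ℕ} (X : Twistor n) (v w : TangentSpace 𝓘(ℝ, Model n) X) :
    kks n X v w = matForm X.1 (tangentMat X v) (tangentMat X w) := by
  have h3 := orbit_cube X.2
  -- `Z` solves `[Z, X] = V`. The square of `ad X` is `-1` on the `𝔭` part and `-4` on the `𝔮` part,
  -- so `Z` must be `[X, V]` on the first and `¼[X, V]` on the second. The expression `X²VX - XVX²`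
  -- is `0` on the first and `[X, V]` on the second, whence the coefficient `3/4`.
  have key : ∀ v : TangentSpace 𝓘(ℝ, Model n) X, ∀ Z, Z = X.1 * tangentMat X v - tangentMat X v * X.1 -
      (3 / 4 : ℝ) • (X.1 * X.1 * tangentMat X v * X.1 - X.1 * tangentMat X v * X.1 * X.1) →
      tangentMat X v = Z * X.1 - X.1 * Z := by
    rintro v Z rfl
    have hr := tangentMat_rel X v
    generalize tangentMat X v = V at *
    generalize X.1 = x at *
    have h4 : x * x * V * x * x = x * V * x := by
      have e : x * (V * x * x + x * V * x + x * x * V) * x = -(x * V * x) := by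
        rw [hr]; noncomm_ring
      have e2 : x * (V * x * x + x * V * x + x * x * V) * x =
        x * V * (x * x * x) + x * x * V * x * x + (x * x * x) * V * x := by noncomm_ring
      rw [e2, h3] at e
      have e3 : x * x * V * x * x = (x * V * -x + x * x * V * x * x + -x * V * x)
        + x * V * x + x * V * x := by noncomm_ring
      rw [e3, e]; abel
    have e5 : V = -(V * x * x) - x * V * x - x * x * V := by
      calc V = -(-V) := (neg_neg V).symm
        _ = -(V * x * x + x * V * x + x * x * V) := by rw [hr]
        _ = _ := by abel
    have e6 : (x * V - V * x - (3 / 4 : ℝ) • (x * x * V * x - x * V * x * x)) * x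
      - x * (x * V - V * x - (3 / 4 : ℝ) • (x * x * V * x - x * V * x * x)) =
      (2 : ℝ) • (x * V * x) - V * x * x - x * x * V - (3 / 4 : ℝ) • ((2 : ℝ) • (x * x * V * x * x)
       - x * V * (x * x * x) - (x * x * x) * V * x) := by
      simp only [sub_mul, mul_sub, smul_mul_assoc, mul_smul_comm, mul_assoc]
      module
    rw [e6, h3, h4]
    simp only [mul_neg, neg_mul]
    nth_rewrite 1 [e5]
    module
  rw [kks_apply X _ _ v w (key v _ rfl) (key w _ rfl)]
  have e : ∀ ξ ζ : LMat n,
      (X.1 * (ξ * ζ - ζ * ξ)).trace = -((ξ * X.1 - X.1 * ξ) * ζ).trace := by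
    intro ξ ζ
    rw [mul_sub, sub_mul, Matrix.trace_sub, Matrix.trace_sub, ← mul_assoc, ← mul_assoc,
      Matrix.trace_mul_comm (X.1 * ζ) ξ, ← mul_assoc]
    ring
  rw [e, ← key v _ rfl, neg_neg, matForm]
  generalize tangentMat X v = V at *
  generalize tangentMat X w = W at *
  generalize X.1 = x at *
  simp only [mul_sub, Matrix.trace_sub, mul_smul_comm, Matrix.trace_smul, smul_eq_mul, ← mul_assoc]
  ring

end HypTwistor

namespace HypTwistor

open AlmostComplexGeometry

/-! Closedness of the Kirillov–Kostant–Souriau form. -/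

/-- The derivative of `X ↦ matForm X V W` in the direction `U`. -/
noncomputable def matFormDeriv {n : ℕ} (x U V W : LMat n) : ℝ :=
  (V * U * W - V * W * U).trace + 3 / 4 *
    (V * U * W * x * x + V * x * W * U * x + V * x * W * x * U
      - V * U * x * W * x - V * x * U * W * x - V * x * x * W * U).trace

theorem matForm_swap {n : ℕ} (x V W : LMat n) : matForm x V W = -matForm x W V := by
  simp only [matForm, Matrix.trace_sub]
  have r1 := Matrix.trace_mul_comm (V * x) W
  have r2 := Matrix.trace_mul_comm V (W * x)
  have r3 := Matrix.trace_mul_comm (V * x) (W * x * x)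
  have r4 := Matrix.trace_mul_comm (V * x * x) (W * x)
  simp only [mul_assoc] at *
  linear_combination r1 - r2 + 3 / 4 * r3 - 3 / 4 * r4

theorem matForm_sub {n : ℕ} (x V V' W : LMat n) :
    matForm x (V - V') W = matForm x V W - matForm x V' W := by
  simp only [matForm, Matrix.trace_sub, sub_mul]
  ring

section
variable {I : Type*} [Fintype I] [DecidableEq I] {x U V W : Matrix I I ℝ}

/-- Multiply the tangency relation by `x` on both sides and reduce with `x³ = -x`. -/
theorem sq_mul_sq (h3 : x * x * x = -x) (hV : V * x * x + x * V * x + x * x * V = -V) :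
    x * x * V * (x * x) = x * V * x := by
  have e : x * (V * x * x + x * V * x + x * x * V) * x = -(x * V * x) := by
    rw [hV]; noncomm_ring
  have e2 : x * (V * x * x + x * V * x + x * x * V) * x =
    x * V * (x * x * x) + x * x * V * (x * x) + (x * x * x) * V * x := by noncomm_ring
  rw [e2, h3] at e
  have e3 : x * x * V * (x * x) = (x * V * -x + x * x * V * (x * x) + -x * V * x)
    + x * V * x + x * V * x := by noncomm_ring
  rw [e3, e]; abel

/-- Each `xUx` anticommutes with `x` and satisfies `x²(xUx) = -xUx`. A product `M` of three such
factors also anticommutes with `x`, hence `Tr(x²M) = -Tr(xMx) = -Tr(x²M)`, while `Tr(x²M) = -Tr M`.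
-/
theorem trace_triple_eq_zero (h3 : x * x * x = -x)
    (hU : U * x * x + x * U * x + x * x * U = -U) (hV : V * x * x + x * V * x + x * x * V = -V)
    (hW : W * x * x + x * W * x + x * x * W = -W) :
    ((x * U * x) * (x * V * x) * (x * W * x)).trace = 0 := by
  have anti : ∀ {U : Matrix I I ℝ}, U * x * x + x * U * x + x * x * U = -U →
      x * (x * U * x) = -(x * U * x * x) := by
    intro U hU
    have e : x * (U * x * x + x * U * x + x * x * U) = -(x * U) := by rw [hU, mul_neg]
    have e2 : x * (U * x * x + x * U * x + x * x * U) =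
      x * U * x * x + x * (x * U * x) + x * x * x * U := by noncomm_ring
    rw [e2, h3, neg_mul, add_eq_right] at e
    rw [eq_neg_iff_add_eq_zero, add_comm, e]
  have hA := anti hU
  have hB := anti hV
  have hC := anti hW
  have hx : x * (x * (x * U * x)) = -(x * U * x) := by
    calc _ = (x * x * x) * U * x := by noncomm_ring
      _ = _ := by rw [h3]; noncomm_ring
  generalize x * U * x = A at *
  generalize x * V * x = B at *
  generalize x * W * x = C at *
  have e1 : x * (A * B * C) = -(A * B * C * x) := by
    calc x * (A * B * C) = (x * A) * B * C := by noncomm_ring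
      _ = -(A * (x * B) * C) := by rw [hA]; noncomm_ring
      _ = A * B * (x * C) := by rw [hB]; noncomm_ring
      _ = _ := by rw [hC]; noncomm_ring
  have e2 : (x * (x * (A * B * C))).trace = -(A * B * C).trace := by
    rw [← Matrix.trace_neg]
    congr 1
    calc _ = (x * (x * A)) * B * C := by noncomm_ring
      _ = _ := by rw [hx]; noncomm_ring
  have e3 : (x * (x * (A * B * C))).trace = -(x * (x * (A * B * C))).trace := by
    nth_rewrite 1 [e1]
    rw [mul_neg, Matrix.trace_neg, ← mul_assoc, Matrix.trace_mul_comm]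
  linarith

/-- Products of three tangent matrices, with `X²` inserted in one place. -/
theorem trace_triple_sq (h3 : x * x * x = -x)
    (hU : U * x * x + x * U * x + x * x * U = -U) (hV : V * x * x + x * V * x + x * x * V = -V)
    (hW : W * x * x + x * W * x + x * x * W = -W) :
    (x * x * U * V * W).trace + (U * x * x * V * W).trace + (U * V * x * x * W).trace
      + 2 * (U * V * W).trace = 0 := by
  -- This says `EUE = 0` for the projector `E = 1 + x²` on `ker x`. Insert `1 = E + (-x²)` at the
  -- three cyclic places of `Tr(UVW)`: any two places are adjacent, so terms with two or more
  -- factors `E` vanish. The term without `E` vanishes by `trace_triple_eq_zero`, and the three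
  -- terms with one `E` give the formula.
  have hE : ∀ {U : Matrix I I ℝ}, U * x * x + x * U * x + x * x * U = -U →
      U + x * x * U + U * (x * x) + x * x * U * (x * x) = 0 := by
    intro U hU
    rw [sq_mul_sq h3 hU]
    have : U + (U * x * x + x * U * x + x * x * U) = 0 := by rw [hU, add_neg_cancel]
    rw [← this]; noncomm_ring
  have t := trace_triple_eq_zero h3 hU hV hW
  have d1 : ((U + x * x * U + U * (x * x) + x * x * U * (x * x)) * (V * W)).trace = 0 := by
    rw [hE hU]; simp
  have d2 : (U * (V + x * x * V + V * (x * x) + x * x * V * (x * x)) * W).trace = 0 := by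
    rw [hE hV]; simp
  have d3 : (U * V * (W + x * x * W + W * (x * x) + x * x * W * (x * x))).trace = 0 := by
    rw [hE hW]; simp
  have d4 : ((U + x * x * U + U * (x * x) + x * x * U * (x * x)) * (V * W + V * (x * x) * W)).trace
      = 0 := by
    rw [hE hU]; simp
  have r0 := Matrix.trace_mul_comm (x * U * x * (x * V * x) * (x * W)) x
  have r1 := Matrix.trace_mul_comm (U * V * W) (x * x)
  have r2 := Matrix.trace_mul_comm (U * V * (x * x) * W) (x * x)
  simp only [mul_add, add_mul, Matrix.trace_add, mul_assoc] at *
  linear_combination t - r0 + d1 + d2 + d3 - d4 - r1 - r2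

/-- Products of three tangent matrices, with `X` inserted in two places. -/
theorem trace_triple_pair (h3 : x * x * x = -x)
    (hU : U * x * x + x * U * x + x * x * U = -U) (hV : V * x * x + x * V * x + x * x * V = -V)
    (hW : W * x * x + x * W * x + x * x * W = -W) :
    (x * U * x * V * W).trace + (U * x * V * x * W).trace + (x * U * V * x * W).trace
      - (U * V * W).trace = 0 := by
  have s := trace_triple_sq h3 hU hV hW
  -- Summing the tangency relation over the three factors counts each position of `x²` twice and
  -- each pair of separated `x` once; the previous identity then eliminates the `x²` terms.
  have e1 : ((U * x * x + x * U * x + x * x * U) * V * W).trace = -(U * V * W).trace := by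
    rw [hU]; simp
  have e2 : (U * (V * x * x + x * V * x + x * x * V) * W).trace = -(U * V * W).trace := by
    rw [hV]; simp
  have e3 : (U * V * (W * x * x + x * W * x + x * x * W)).trace = -(U * V * W).trace := by
    rw [hW]; simp
  have r1 := Matrix.trace_mul_comm (x * x) (U * V * W)
  have r2 := Matrix.trace_mul_comm x (U * V * x * W)
  simp only [mul_add, add_mul, Matrix.trace_add, mul_assoc] at *
  linear_combination e1 + e2 + e3 - 2 * s + r1 + r2
end

/-- Up to cyclic rotation the words involve the two orders `VUW` and `VWU`. In each order the sum is
a combination of `trace_triple_sq` and `trace_triple_pair`. -/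
theorem matFormDeriv_cyclic {n : ℕ} {x U V W : LMat n} (h3 : x * x * x = -x)
    (hU : U * x * x + x * U * x + x * x * U = -U) (hV : V * x * x + x * V * x + x * x * V = -V)
    (hW : W * x * x + x * W * x + x * x * W = -W) :
    matFormDeriv x U V W + matFormDeriv x V W U + matFormDeriv x W U V = 0 := by
  have s1 := trace_triple_sq h3 hV hU hW
  have d1 := trace_triple_pair h3 hV hU hW
  have s2 := trace_triple_sq h3 hV hW hU
  have d2 := trace_triple_pair h3 hV hW hU
  simp only [matFormDeriv, Matrix.trace_add, Matrix.trace_sub]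
  -- The rotations `r0` to `r21` bring `V` to the front of every word, so that equal traces become
  -- syntactically equal.
  have r0 := Matrix.trace_mul_comm (W) (V * U)
  have r1 := Matrix.trace_mul_comm (W * U) (V)
  have r2 := Matrix.trace_mul_comm (W) (V * U * x * x)
  have r3 := Matrix.trace_mul_comm (W * x * U) (V * x)
  have r4 := Matrix.trace_mul_comm (W * x * U * x) (V)
  have r5 := Matrix.trace_mul_comm (W) (V * x * U * x)
  have r6 := Matrix.trace_mul_comm (W * x) (V * U * x)
  have r7 := Matrix.trace_mul_comm (W * x * x * U) (V)
  have r8 := Matrix.trace_mul_comm (U * W) (V)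
  have r9 := Matrix.trace_mul_comm (U) (V * W)
  have r10 := Matrix.trace_mul_comm (U * W) (V * x * x)
  have r11 := Matrix.trace_mul_comm (U * x) (V * W * x)
  have r12 := Matrix.trace_mul_comm (U * x) (V * x * W)
  have r13 := Matrix.trace_mul_comm (U * W * x) (V * x)
  have r14 := Matrix.trace_mul_comm (U * x * W) (V * x)
  have r15 := Matrix.trace_mul_comm (U * x * x) (V * W)
  have r16 := Matrix.trace_mul_comm (x * x) (V * U * W)
  have r17 := Matrix.trace_mul_comm (x) (V * x * U * W)
  have r18 := Matrix.trace_mul_comm (x) (V * U * x * W)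
  have r19 := Matrix.trace_mul_comm (x * x) (V * W * U)
  have r20 := Matrix.trace_mul_comm (x) (V * x * W * U)
  have r21 := Matrix.trace_mul_comm (x) (V * W * x * U)
  simp only [mul_assoc] at *
  linear_combination 3 / 4 * s1 - 3 / 2 * d1 - 3 / 4 * s2 + 3 / 2 * d2 + r0 - r1 + 3 / 4 * r2 +
    3 / 4 * r3 + 3 / 4 * r4 - 3 / 4 * r5 - 3 / 4 * r6 - 3 / 4 * r7 + r8 - r9 + 3 / 4 * r10 +
    3 / 4 * r11 + 3 / 4 * r12 - 3 / 4 * r13 - 3 / 4 * r14 - 3 / 4 * r15 - 3 / 4 * r16 +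
    3 / 2 * r17 + 3 / 2 * r18 + 3 / 4 * r19 - 3 / 2 * r20 - 3 / 2 * r21

/-- The trace as a continuous linear form. -/
noncomputable def traceL (n : ℕ) : AMat n →L[ℝ] ℝ :=
  haveI : FiniteDimensional ℝ (AMat n) := inferInstanceAs (FiniteDimensional ℝ (LMat n))
  LinearMap.toContinuousLinearMap (Matrix.traceLinearMap (LIdx n) ℝ ℝ : AMat n →ₗ[ℝ] ℝ)

theorem matForm_eq_traceL {n : ℕ} (x V W : AMat n) : matForm x V W =
    traceL n (V * x * W - V * W * x) + 3 / 4 * traceL n (V * x * W * x * x - V * x * x * W * x) :=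
  rfl

theorem hasDerivAt_matForm {n : ℕ} {γ A B : ℝ → AMat n} {U A' B' : AMat n}
    (hγ : HasDerivAt γ U 0) (hA : HasDerivAt A A' 0) (hB : HasDerivAt B B' 0) :
    HasDerivAt (fun t => matForm (γ t) (A t) (B t)) (matFormDeriv (γ 0) U (A 0) (B 0) +
      matForm (γ 0) A' (B 0) + matForm (γ 0) (A 0) B') 0 := by
  have h1 := ((hA.mul hγ).mul hB).sub ((hA.mul hB).mul hγ)
  have h2 := ((((hA.mul hγ).mul hB).mul hγ).mul hγ).sub ((((hA.mul hγ).mul hγ).mul hB).mul hγ)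
  have h3 := ((traceL n).hasFDerivAt.comp_hasDerivAt (0 : ℝ) h1).add
    (((traceL n).hasFDerivAt.comp_hasDerivAt (0 : ℝ) h2).const_mul (3 / 4 : ℝ))
  refine h3.congr_deriv ?_
  have e : ∀ x U V W : AMat n, matFormDeriv x U V W =
    traceL n (V * U * W - V * W * U) + 3 / 4 *
    traceL n (V * U * W * x * x + V * x * W * U * x + V * x * W * x * U
      - V * U * x * W * x - V * x * U * W * x - V * x * x * W * U) := fun _ _ _ _ => rfl
  rw [e, matForm_eq_traceL, matForm_eq_traceL]
  simp only [Pi.mul_apply, add_mul, map_add, map_sub]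
  ring

theorem contMDiff_mul_mat {n : ℕ} {A B : Twistor n → AMat n}
    (hA : ContMDiff 𝓘(ℝ, Model n) 𝓘(ℝ, AMat n) ∞ A)
    (hB : ContMDiff 𝓘(ℝ, Model n) 𝓘(ℝ, AMat n) ∞ B) :
    ContMDiff 𝓘(ℝ, Model n) 𝓘(ℝ, AMat n) ∞ (fun p => A p * B p) := by
  have h : ContDiff ℝ ∞ (fun z : AMat n × AMat n => z.1 * z.2) := contDiff_fst.mul contDiff_snd
  exact h.contMDiff.comp (hA.prodMk_space hB)

theorem kks_smooth {n : ℕ} {X Y : ∀ p : Twistor n, TangentSpace 𝓘(ℝ, Model n) p}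
    (hX : IsSmoothField X) (hY : IsSmoothField Y) :
    ContMDiff 𝓘(ℝ, Model n) 𝓘(ℝ, ℝ) ∞ (fun p => kks n p (X p) (Y p)) := by
  rw [isSmoothField_iff] at hX hY
  have e : (fun p => kks n p (X p) (Y p)) = fun p =>
      traceL n (fieldMat X p * matOf p * fieldMat Y p - fieldMat X p * fieldMat Y p * matOf p) +
      3 / 4 * traceL n (fieldMat X p * matOf p * fieldMat Y p * matOf p * matOf p -
        fieldMat X p * matOf p * matOf p * fieldMat Y p * matOf p) :=
    funext fun p => kks_eq p _ _
  rw [e]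
  have hv := contMDiff_val n
  have hXv := contMDiff_mul_mat hX hv
  have h1 := (contMDiff_mul_mat hXv hY).sub (contMDiff_mul_mat (contMDiff_mul_mat hX hY) hv)
  have h2 := (contMDiff_mul_mat (contMDiff_mul_mat (contMDiff_mul_mat hXv hY) hv) hv).sub
    (contMDiff_mul_mat (contMDiff_mul_mat (contMDiff_mul_mat hXv hv) hY) hv)
  exact ((traceL n).contMDiff.comp h1).add (contMDiff_const.mul ((traceL n).contMDiff.comp h2))

theorem dirDeriv_kks {n : ℕ} {X Y Z : ∀ p : Twistor n, TangentSpace 𝓘(ℝ, Model n) p}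
    (hY : IsSmoothField Y) (hZ : IsSmoothField Z) (p : Twistor n) :
    dirDeriv X (fun q => kks n q (Y q) (Z q)) p =
      matFormDeriv p.1 (fieldMat X p) (fieldMat Y p) (fieldMat Z p) +
        matForm p.1 (mdir (F := AMat n) (fieldMat Y) X p) (fieldMat Z p) +
        matForm p.1 (fieldMat Y p) (mdir (F := AMat n) (fieldMat Z) X p) := by
  obtain ⟨γ, h0, h1, h2⟩ := exists_curve_val p (X p)
  have hY' := h2 (AMat n) _ ((isSmoothField_iff Y).1 hY)
  have hZ' := h2 (AMat n) _ ((isSmoothField_iff Z).1 hZ)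
  have h3 := h2 ℝ _ (kks_smooth hY hZ)
  have h4 := hasDerivAt_matForm h1 hY' hZ'
  rw [h0] at h4
  have e : (fun t => kks n (γ t) (Y (γ t)) (Z (γ t))) =
    fun t => matForm (matOf (γ t)) (fieldMat Y (γ t)) (fieldMat Z (γ t)) :=
    funext fun t => kks_eq _ _ _
  rw [e] at h3
  exact h3.unique h4

/-- Every term `matForm (derivative of a field) (field)` occurs once in the derivatives of the
functions `ω(Y, Z)` and once, with the opposite sign, in the bracket terms. Only the derivatives of
the coefficients of `ω` survive, and their cyclic sum is zero. -/
theorem kks_closed {n : ℕ} {X Y Z : ∀ p : Twistor n, TangentSpace 𝓘(ℝ, Model n) p}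
    (hX : IsSmoothField X) (hY : IsSmoothField Y) (hZ : IsSmoothField Z) (p : Twistor n) :
    extDerivTwo (kks n) X Y Z p = 0 := by
  have hb : ∀ {X Y Z : ∀ p : Twistor n, TangentSpace 𝓘(ℝ, Model n) p}, IsSmoothField X →
      IsSmoothField Y → kks n p (VectorField.mlieBracket 𝓘(ℝ, Model n) X Y p) (Z p) =
      matForm p.1 (mdir (F := AMat n) (fieldMat Y) X p) (fieldMat Z p) +
        matForm p.1 (fieldMat Z p) (mdir (F := AMat n) (fieldMat X) Y p) := by
    intro X Y Z hX hY
    have h : tangentMat p (VectorField.mlieBracket 𝓘(ℝ, Model n) X Y p) =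
      mdir (F := AMat n) (fieldMat Y) X p - mdir (F := AMat n) (fieldMat X) Y p :=
      congrFun (fieldMat_mlieBracket hX hY) p
    have e : ∀ A B C : LMat n, matForm p.1 (A - B) C = matForm p.1 A C + matForm p.1 C B := by
      intro A B C
      rw [matForm_sub, matForm_swap _ C B, sub_eq_add_neg]
    rw [kks_eq, h]
    exact e _ _ _
  have hc : matFormDeriv p.1 (fieldMat X p) (fieldMat Y p) (fieldMat Z p) +
      matFormDeriv p.1 (fieldMat Y p) (fieldMat Z p) (fieldMat X p) +
      matFormDeriv p.1 (fieldMat Z p) (fieldMat X p) (fieldMat Y p) = 0 :=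
    matFormDeriv_cyclic (orbit_cube p.2) (tangentMat_rel p (X p)) (tangentMat_rel p (Y p))
      (tangentMat_rel p (Z p))
  rw [extDerivTwo, dirDeriv_kks hY hZ, dirDeriv_kks hZ hX, dirDeriv_kks hX hY, hb hX hY, hb hY hZ,
    hb hZ hX]
  linarith

/-! Positivity and compatibility. -/

/-- The trace splits into the `𝔭` and the `𝔮` contributions. Since `j₀² = -1`, `j₀` is skew and `B`
anticommutes with `j₀`, both lose every trace of `j₀`, and `ε` only affects the first. -/
theorem baseForm_baseJ {n : ℕ} (ε : ℝ) (a b : Model n) : baseForm n a (baseJ n ε b) =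
    -2 * ε * (a.1 ⬝ᵥ b.1) - 2 * ((a.2 : SMat n) * (b.2 : SMat n)).trace := by
  have hj := j0_sq n
  have ha := a.2.2.2
  have hr : ∀ (M : Matrix (SIdx n) Unit ℝ) (N : Matrix Unit (SIdx n) ℝ),
      (j0 n * (M * N)).trace = ∑ i, (j0 n *ᵥ (fun k => M k ())) i * N () i := by
    intro M N
    rw [← Matrix.mul_assoc, Matrix.trace]
    simp [Matrix.mul_apply, Matrix.mulVec, dotProduct]
  have hu : ∀ u v : SIdx n → ℝ, (j0 n *ᵥ u) ⬝ᵥ v = -(u ⬝ᵥ (j0 n *ᵥ v)) := by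
    intro u v
    rw [Matrix.dotProduct_mulVec, ← Matrix.mulVec_transpose, j0_t, Matrix.neg_mulVec,
      neg_dotProduct, neg_neg]
  have e1 : baseForm n a (baseJ n ε b) =
      -(((j0 n *ᵥ a.1) ⬝ᵥ (ε • (j0 n *ᵥ b.1)) + (j0 n * ((a.2 : SMat n) * (j0 n * b.2))).trace) -
      ((j0 n *ᵥ (ε • (j0 n *ᵥ b.1))) ⬝ᵥ a.1 + (j0 n * ((j0 n * b.2) * a.2)).trace)) := by
    have e0 : ∀ c d : Model n, (t0 n * (mMat n c * mMat n d)).trace =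
        (j0 n *ᵥ c.1) ⬝ᵥ d.1 + (j0 n * ((c.2 : SMat n) * d.2)).trace := by
      intro c d
      simp only [mMat, LinearMap.coe_mk, AddHom.coe_mk, t0, Matrix.fromBlocks_multiply]
      have ht : ∀ (A : Matrix Unit Unit ℝ) (B : Matrix Unit (SIdx n) ℝ)
          (C : Matrix (SIdx n) Unit ℝ) (D : SMat n),
          (Matrix.fromBlocks A B C D).trace = A.trace + D.trace := fun A B C D =>
        Fintype.sum_sum_type _
      rw [ht]
      simp only [Matrix.zero_mul, Matrix.trace_zero, add_zero, zero_add, Matrix.mul_add,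
        Matrix.trace_add, hr]
      rfl
    show -(t0 n * (mMat n a * mMat n (baseJ n ε b) - mMat n (baseJ n ε b) * mMat n a)).trace = _
    rw [mul_sub, Matrix.trace_sub, e0, e0]
    rfl
  have e2 : (j0 n * ((a.2 : SMat n) * (j0 n * b.2))) = (a.2 : SMat n) * b.2 := by
    calc _ = j0 n * ((a.2 : SMat n) * j0 n) * b.2 := by noncomm_ring
      _ = -(j0 n * j0 n) * a.2 * b.2 := by rw [ha]; noncomm_ring
      _ = _ := by rw [hj]; noncomm_ring
  have e3 : (j0 n * ((j0 n * b.2) * a.2)) = -((b.2 : SMat n) * a.2) := by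
    calc _ = (j0 n * j0 n) * b.2 * a.2 := by noncomm_ring
      _ = _ := by rw [hj]; noncomm_ring
  rw [e1, e2, e3, Matrix.trace_neg, Matrix.trace_mul_comm (b.2 : SMat n), hu]
  simp only [Matrix.mulVec_smul, Matrix.mulVec_mulVec, hj, Matrix.neg_mulVec, Matrix.one_mulVec,
    dotProduct_smul, smul_dotProduct, dotProduct_neg, neg_dotProduct, smul_eq_mul, smul_neg]
  rw [dotProduct_comm b.1 a.1]
  ring

/-- One and the same frame carries both invariant tensors to their models, so pointwise properties
are checked on `𝔭 ⊕ 𝔮`. -/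
theorem kks_frame {n : ℕ} (X : Twistor n) :
    ∃ F : Model n ≃ₗ[ℝ] TangentSpace 𝓘(ℝ, Model n) X,
      (∀ a b, kks n X (F a) (F b) = baseForm n a b) ∧
      ∀ ε a, twistorJ n ε X (F a) = F (baseJ n ε a) := by
  refine ⟨frame X X.2.choose_spec.1 X.2.choose_spec.2, fun a b => ?_, fun ε a => ?_⟩
  · simp [kks]
  · simp [twistorJ]


theorem baseForm_baseJ_comm {n : ℕ} (ε : ℝ) (a b : Model n) :
    baseForm n a (baseJ n ε b) = baseForm n b (baseJ n ε a) := by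
  rw [baseForm_baseJ, baseForm_baseJ, dotProduct_comm, Matrix.trace_mul_comm]

/-- For skew `B`, `-Tr(B²)` is the sum of the squares of the entries; the sign of the metric on `𝔭`
is that of `-ε`. -/
theorem baseForm_baseJ_self {n : ℕ} (ε : ℝ) (a : Model n) : baseForm n a (baseJ n ε a) =
    -2 * ε * (a.1 ⬝ᵥ a.1) + 2 * ∑ i, ∑ k, (a.2 : SMat n) i k ^ 2 := by
  rw [baseForm_baseJ, sub_eq_add_neg, ← mul_neg]
  congr 2
  have h : ∀ i k, (a.2 : SMat n) k i = -(a.2 : SMat n) i k := fun i k =>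
    congrFun (congrFun a.2.2.1 i) k
  simp only [Matrix.trace, Matrix.diag_apply, Matrix.mul_apply]
  rw [← Finset.sum_neg_distrib]
  refine Finset.sum_congr rfl fun i _ => ?_
  rw [← Finset.sum_neg_distrib]
  refine Finset.sum_congr rfl fun k _ => ?_
  rw [h i k]; ring

theorem baseJ_baseJ {n : ℕ} {ε : ℝ} (hε : ε * ε = 1) (a : Model n) :
    baseJ n ε (baseJ n ε a) = -a := by
  have hj := j0_sq n
  refine Prod.ext ?_ (Subtype.ext ?_)
  · show ε • (j0 n *ᵥ (ε • (j0 n *ᵥ a.1))) = -a.1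
    rw [Matrix.mulVec_smul, smul_smul, hε, Matrix.mulVec_mulVec, hj]
    simp [Matrix.neg_mulVec]
  · show j0 n * (j0 n * (a.2 : SMat n)) = -(a.2 : SMat n)
    rw [← mul_assoc, hj]; simp

theorem isCompatible_twistorJ (n : ℕ) (ε : ℝ) : IsCompatible (kks n) (twistorJ n ε) := by
  intro p v w
  obtain ⟨F, h1, h2⟩ := kks_frame p
  obtain ⟨a, rfl⟩ := F.surjective v
  obtain ⟨b, rfl⟩ := F.surjective w
  rw [h2, h2, h1, h1, baseForm_baseJ_comm]

theorem isPositive_twistorJMinus (n : ℕ) : IsPositive (kks n) (twistorJMinus n) := by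
  intro p v hv
  obtain ⟨F, h1, h2⟩ := kks_frame p
  obtain ⟨a, rfl⟩ := F.surjective v
  rw [twistorJMinus, h2, h1, baseForm_baseJ_self]
  have ha : a ≠ 0 := by rintro rfl; simp at hv
  have h3 : 0 ≤ a.1 ⬝ᵥ a.1 := Finset.sum_nonneg fun i _ => mul_self_nonneg _
  have h4 : 0 ≤ ∑ i, ∑ k, (a.2 : SMat n) i k ^ 2 :=
    Finset.sum_nonneg fun i _ => Finset.sum_nonneg fun k _ => sq_nonneg _
  by_contra hneg
  have h5 : a.1 ⬝ᵥ a.1 = 0 := by linarith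
  have h6 : ∑ i, ∑ k, (a.2 : SMat n) i k ^ 2 = 0 := by linarith
  refine ha (Prod.ext (dotProduct_self_eq_zero.1 h5) (Subtype.ext ?_))
  ext i k
  have h7 := (Finset.sum_eq_zero_iff_of_nonneg fun i _ =>
    Finset.sum_nonneg fun k _ => sq_nonneg _).1 h6 i (Finset.mem_univ _)
  have h8 := (Finset.sum_eq_zero_iff_of_nonneg fun k _ => sq_nonneg _).1 h7 k (Finset.mem_univ _)
  exact pow_eq_zero_iff two_ne_zero |>.1 h8

theorem not_isPositive_twistorJPlus {n : ℕ} (hn : 1 ≤ n) :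
    ¬ IsPositive (kks n) (twistorJPlus n) := by
  intro h
  have hmem : (1 : LMat n) ∈ SO0 n := by simp [SO0]
  let p : Twistor n := ⟨t0 n, 1, hmem, by simp⟩
  obtain ⟨F, h1, h2⟩ := kks_frame p
  -- A vector of `𝔭`, on which the metric of `J⁺` is negative; it is nonzero because `n ≥ 1`.
  let a : Model n := (fun _ => 1, 0)
  have ha : a ≠ 0 := fun h => by
    have h3 : (1 : ℝ) = 0 := congrFun (congrArg Prod.fst h) (Sum.inl ⟨0, hn⟩)
    exact one_ne_zero h3
  have h3 := h p (F a) ((LinearEquiv.map_ne_zero_iff F).2 ha)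
  rw [twistorJPlus, h2, h1, baseForm_baseJ_self] at h3
  have h4 : 0 ≤ a.1 ⬝ᵥ a.1 := Finset.sum_nonneg fun i _ => mul_self_nonneg _
  have h5 : ∑ i, ∑ k, (a.2 : SMat n) i k ^ 2 = 0 := by simp [a]
  rw [h5] at h3
  linarith

theorem isSymplectic_kks (n : ℕ) : IsSymplectic (kks n) where
  alt p v := by
    obtain ⟨F, h1, -⟩ := kks_frame p
    obtain ⟨a, rfl⟩ := F.surjective v
    rw [h1]
    simp [baseForm]
  -- A vector `v ≠ 0` pairs strictly positively with `J⁻v`.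
  nondegenerate p v h := by
    by_contra hv
    exact (isPositive_twistorJMinus n p v hv).ne' (h _)
  smooth _ _ hX hY := kks_smooth hX hY
  closed _ _ _ hX hY hZ p := kks_closed hX hY hZ p

theorem isAlmostComplex_twistorJ (n : ℕ) {ε : ℝ} (hε : ε * ε = 1) :
    IsAlmostComplex (twistorJ n ε) where
  sq p v := by
    obtain ⟨F, -, h2⟩ := kks_frame p
    obtain ⟨a, rfl⟩ := F.surjective v
    rw [h2, h2, baseJ_baseJ hε, map_neg]
  smooth X hX := by
    rw [isSmoothField_iff] at hX ⊢
    have hv := contMDiff_val n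
    have e : fieldMat (fun p => twistorJ n ε p (X p)) = fun p =>
        -(matOf p * fieldMat X p * (matOf p * matOf p)) + ε • (matOf p * fieldMat X p *
        (1 + matOf p * matOf p) - (1 + matOf p * matOf p) * fieldMat X p * matOf p) :=
      funext fun p => tangentMat_twistorJ ε p (X p)
    rw [e]
    have h1 := contMDiff_mul_mat hv hX
    have h2 := contMDiff_mul_mat hv hv
    have h3 := (contMDiff_const (c := (1 : AMat n))).add h2
    exact (contMDiff_mul_mat h1 h2).neg.add ((ε • ContinuousLinearMap.id ℝ (AMat n)).contMDiff.comp
      ((contMDiff_mul_mat h1 h3).sub (contMDiff_mul_mat (contMDiff_mul_mat h3 hX) hv)))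

end HypTwistor

namespace HypTwistor

open AlmostComplexGeometry

/-! The Nijenhuis tensor. -/

/-- The derivative of `X ↦ matJ ε X V` in the direction `U`. -/
def matJDeriv {n : ℕ} (ε : ℝ) (x U V : LMat n) : LMat n :=
  -(U * V * (x * x) + x * V * (U * x + x * U)) + ε • (U * V * (1 + x * x) +
    x * V * (U * x + x * U) - ((U * x + x * U) * V * x + (1 + x * x) * V * U))

/-- The Nijenhuis tensor of `J^ε`, on matrices. -/
def matNij {n : ℕ} (ε : ℝ) (x V W : LMat n) : LMat n :=
  matJDeriv ε x (matJ ε x V) W - matJDeriv ε x (matJ ε x W) V + matJ ε x (matJDeriv ε x W V) -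
    matJ ε x (matJDeriv ε x V W)

theorem matJ_add {n : ℕ} (ε : ℝ) (x V W : LMat n) :
    matJ ε x (V + W) = matJ ε x V + matJ ε x W := by
  simp only [matJ, mul_add, add_mul, smul_add, smul_sub, mul_one, one_mul]
  abel

theorem matJ_sub {n : ℕ} (ε : ℝ) (x V W : LMat n) :
    matJ ε x (V - W) = matJ ε x V - matJ ε x W := by
  rw [eq_sub_iff_add_eq, ← matJ_add, sub_add_cancel]

theorem hasDerivAt_matJ {n : ℕ} (ε : ℝ) {γ A : ℝ → AMat n} {U A' : AMat n}
    (hγ : HasDerivAt γ U 0) (hA : HasDerivAt A A' 0) :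
    HasDerivAt (fun t => (matJ ε (γ t) (A t) : AMat n))
      (matJDeriv ε (γ 0) U (A 0) + matJ ε (γ 0) A' : AMat n) 0 := by
  have h1 := hγ.mul hγ
  have h2 := h1.const_add 1
  have h3 := ((hγ.mul hA).mul h1).neg.add
    ((((hγ.mul hA).mul h2).sub ((h2.mul hA).mul hγ)).const_smul ε)
  refine h3.congr_deriv ?_
  have e1 : ∀ x U V : AMat n, @Eq (AMat n) (matJDeriv ε x U V)
    (-(U * V * (x * x) + x * V * (U * x + x * U)) + ε • (U * V * (1 + x * x) +
    x * V * (U * x + x * U) - ((U * x + x * U) * V * x + (1 + x * x) * V * U))) := fun _ _ _ => rfl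
  have e2 : ∀ x V : AMat n, @Eq (AMat n) (matJ ε x V)
    (-(x * V * (x * x)) + ε • (x * V * (1 + x * x) - (1 + x * x) * V * x)) := fun _ _ => rfl
  rw [e1, e2]
  simp only [Pi.mul_apply, add_mul, mul_add, smul_add, smul_sub, mul_one, one_mul, mul_assoc]
  abel

theorem mdir_twistorJ {n : ℕ} {ε : ℝ} (hε : ε * ε = 1)
    {X : ∀ p : Twistor n, TangentSpace 𝓘(ℝ, Model n) p} (hX : IsSmoothField X)
    (Y : ∀ p : Twistor n, TangentSpace 𝓘(ℝ, Model n) p) (p : Twistor n) {A : LMat n}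
    (hA : mdir (F := AMat n) (fieldMat X) Y p = A) :
    mdir (F := AMat n) (fieldMat fun q => twistorJ n ε q (X q)) Y p =
      (matJDeriv ε p.1 (tangentMat p (Y p)) (tangentMat p (X p)) + matJ ε p.1 A : LMat n) := by
  subst hA
  obtain ⟨γ, h0, h1, h2⟩ := exists_curve_val p (Y p)
  have hX' := h2 (AMat n) _ ((isSmoothField_iff X).1 hX)
  have h3 := h2 (AMat n) _ ((isSmoothField_iff _).1 ((isAlmostComplex_twistorJ n hε).smooth X hX))
  have h4 := hasDerivAt_matJ ε h1 hX'
  rw [h0] at h4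
  have e : (fun t => fieldMat (fun q => twistorJ n ε q (X q)) (γ t)) =
    fun t => (matJ ε (matOf (γ t)) (fieldMat X (γ t)) : AMat n) :=
    funext fun t => tangentMat_twistorJ _ _ _
  rw [e] at h3
  exact h3.unique h4

/-- `A`, `B`, `A'`, `B'` stand for the derivatives of `Y` along `X`, of `X` along `Y`, of `Y` along
`JX` and of `X` along `JY`. The primed terms cancel, and the others combine into `-J²(A - B) - (A -
B)`. Hence only the derivatives of `J` remain. -/
theorem matNij_eq {n : ℕ} {ε : ℝ} {x V W A B : LMat n} (A' B' : LMat n)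
    (h : matJ ε x (matJ ε x (A - B)) = -(A - B)) :
    matJDeriv ε x (matJ ε x V) W + matJ ε x A' - (matJDeriv ε x (matJ ε x W) V + matJ ε x B') -
      matJ ε x (A' - (matJDeriv ε x W V + matJ ε x B)) -
      matJ ε x (matJDeriv ε x V W + matJ ε x A - B') - (A - B) = matNij ε x V W := by
  rw [neg_sub] at h
  simp only [matNij, matJ_sub, matJ_add] at *
  rw [← sub_eq_zero] at h ⊢
  rw [← neg_eq_zero, ← h]
  abel

/-- Makes the tensoriality explicit: the right side involves only the values of the fields at `p`.
-/
theorem tangentMat_nijenhuis {n : ℕ} {ε : ℝ} (hε : ε * ε = 1)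
    {X Y : ∀ p : Twistor n, TangentSpace 𝓘(ℝ, Model n) p} (hX : IsSmoothField X)
    (hY : IsSmoothField Y) (p : Twistor n) :
    tangentMat p (nijenhuis (twistorJ n ε) X Y p) =
      matNij ε p.1 (tangentMat p (X p)) (tangentMat p (Y p)) := by
  have hJ := isAlmostComplex_twistorJ n hε
  have hb : ∀ {X Y : ∀ p : Twistor n, TangentSpace 𝓘(ℝ, Model n) p}, IsSmoothField X →
      IsSmoothField Y → ∀ {A B : LMat n}, mdir (F := AMat n) (fieldMat Y) X p = A →
      mdir (F := AMat n) (fieldMat X) Y p = B →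
      tangentMat p (VectorField.mlieBracket 𝓘(ℝ, Model n) X Y p) = A - B := by
    rintro X Y hX hY _ _ rfl rfl
    exact congrFun (fieldMat_mlieBracket hX hY) p
  have hJX := hJ.smooth X hX
  have hJY := hJ.smooth Y hY
  obtain ⟨A, hA⟩ : ∃ A : LMat n, mdir (F := AMat n) (fieldMat Y) X p = A := ⟨_, rfl⟩
  obtain ⟨B, hB⟩ : ∃ B : LMat n, mdir (F := AMat n) (fieldMat X) Y p = B := ⟨_, rfl⟩
  obtain ⟨A', hA'⟩ : ∃ A : LMat n,
    mdir (F := AMat n) (fieldMat Y) (fun q => twistorJ n ε q (X q)) p = A := ⟨_, rfl⟩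
  obtain ⟨B', hB'⟩ : ∃ A : LMat n,
    mdir (F := AMat n) (fieldMat X) (fun q => twistorJ n ε q (Y q)) p = A := ⟨_, rfl⟩
  have b0 := hb hX hY hA hB
  have b1 := hb hJX hY hA' (mdir_twistorJ hε hX Y p hB)
  have b2 := hb hX hJY (mdir_twistorJ hε hY X p hA) hB'
  have b3 := hb hJX hJY (mdir_twistorJ hε hY _ p hA') (mdir_twistorJ hε hX _ p hB')
  -- `matJ` squares to `-1` on tangent matrices only, so this is applied to the bracket and not to
  -- `A` and `B` separately.
  have hsq : matJ ε p.1 (matJ ε p.1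
      (tangentMat p (VectorField.mlieBracket 𝓘(ℝ, Model n) X Y p))) =
      -tangentMat p (VectorField.mlieBracket 𝓘(ℝ, Model n) X Y p) := by
    rw [← tangentMat_twistorJ, ← tangentMat_twistorJ, hJ.sq, map_neg]
  rw [b0] at hsq
  rw [nijenhuis, map_sub, map_sub, map_sub, tangentMat_twistorJ, tangentMat_twistorJ, b0, b1, b2, b3,
    tangentMat_twistorJ, tangentMat_twistorJ]
  exact matNij_eq A' B' hsq

/-- The infinitesimal action `q ↦ [ξ, q]` of an element of `so(1,2n)` is a globally defined smooth
field, so no cut-off function is needed. -/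
theorem exists_field {n : ℕ} (p : Twistor n) (v : TangentSpace 𝓘(ℝ, Model n) p) :
    ∃ X : ∀ q : Twistor n, TangentSpace 𝓘(ℝ, Model n) q, IsSmoothField X ∧ X p = v := by
  obtain ⟨ξ, hξ, hv⟩ := tangentMat_mem p v
  have h : ∀ q : Twistor n, ∃ w, tangentMat q w = ξ * q.1 - q.1 * ξ := by
    intro q
    have h3 := orbit_cube q.2
    have h4 := orbit_eta q.2
    apply mem_range_tangentMat
    · generalize q.1 = x at *
      calc _ = ξ * (x * x * x) - (x * x * x) * ξ := by noncomm_ring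
        _ = _ := by rw [h3]; noncomm_ring
    · generalize q.1 = x at *
      rw [Matrix.transpose_sub, Matrix.transpose_mul, Matrix.transpose_mul]
      calc _ = xᵀ * (ξᵀ * eta n) - ξᵀ * (xᵀ * eta n) := by noncomm_ring
        _ = xᵀ * -(eta n * ξ) - ξᵀ * -(eta n * x) := by rw [hξ, h4]
        _ = -(xᵀ * eta n) * ξ + (ξᵀ * eta n) * x := by noncomm_ring
        _ = _ := by rw [hξ, h4]; noncomm_ring
  choose X hX using h
  refine ⟨X, (isSmoothField_iff X).2 ?_, tangentMat_injective p (by rw [hX, hv])⟩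
  let ξ' : AMat n := ξ
  have e : fieldMat X = fun q => ξ' * matOf q - matOf q * ξ' := funext hX
  rw [e]
  exact (contMDiff_mul_mat contMDiff_const (contMDiff_val n)).sub
    (contMDiff_mul_mat (contMDiff_val n) contMDiff_const)

theorem matNij_mem {n : ℕ} {ε : ℝ} (hε : ε * ε = 1) (p : Twistor n)
    (v w : TangentSpace 𝓘(ℝ, Model n) p) :
    matNij ε p.1 (tangentMat p v) (tangentMat p w) ∈
      (nijenhuisImage (twistorJ n ε) p).map (tangentMat p) := by
  obtain ⟨X, hX, rfl⟩ := exists_field p v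
  obtain ⟨Y, hY, rfl⟩ := exists_field p w
  exact ⟨_, Submodule.subset_span ⟨X, Y, hX, hY, rfl⟩, tangentMat_nijenhuis hε hX hY p⟩

/-! ### The Nijenhuis tensor of `J⁻` at the base point. -/

/-- Conjugation by `g`. -/
noncomputable def conjHom {n : ℕ} {g : LMat n} (hg : g ∈ SO0 n) : LMat n →ₐ[ℝ] LMat n where
  toFun A := g * A * g⁻¹
  map_one' := by rw [mul_one, Matrix.mul_nonsing_inv _ (SO0_unit hg)]
  map_mul' A B := (conj_mul hg A B).symm
  map_zero' := by simp
  map_add' A B := by noncomm_ring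
  commutes' r := by
    rw [Algebra.algebraMap_eq_smul_one, mul_smul_comm, smul_mul_assoc, mul_one,
      Matrix.mul_nonsing_inv _ (SO0_unit hg)]

/-- `matNij` is built from products and real linear combinations, hence commutes with algebra
homomorphisms; this reduces all points to `j₀'`. -/
theorem matNij_conj {n : ℕ} (φ : LMat n →ₐ[ℝ] LMat n) (ε : ℝ) (x V W : LMat n) :
    matNij ε (φ x) (φ V) (φ W) = φ (matNij ε x V W) := by
  simp only [matNij, matJ, matJDeriv, map_add, map_sub, map_neg, map_mul, map_smul, map_one]

/-- The symmetric matrix with column `a`. -/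
def pMat {n : ℕ} (a : Matrix (SIdx n) Unit ℝ) : LMat n := Matrix.fromBlocks 0 aᵀ a 0

theorem t0_sq (n : ℕ) : t0 n * t0 n = Matrix.fromBlocks 0 0 0 (-1) := by
  simp [t0, Matrix.fromBlocks_multiply, j0_sq]

theorem one_add_t0_sq (n : ℕ) : 1 + t0 n * t0 n = Matrix.fromBlocks 1 0 0 0 := by
  rw [t0_sq, ← Matrix.fromBlocks_one, Matrix.fromBlocks_add]; simp

theorem matJ_pMat {n : ℕ} (a : Matrix (SIdx n) Unit ℝ) :
    matJ (-1) (t0 n) (pMat a) = pMat (-(j0 n * a)) := by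
  rw [matJ, one_add_t0_sq, t0_sq, pMat, t0, pMat]
  simp [Matrix.fromBlocks_multiply, j0_t, sub_eq_add_neg, Matrix.fromBlocks_add,
    Matrix.fromBlocks_neg]

theorem matJ_ext0 {n : ℕ} (B : SMat n) : matJ (-1) (t0 n) (ext0 B) = ext0 (j0 n * B) := by
  rw [matJ, one_add_t0_sq, t0_sq, ext0, t0, ext0]
  simp [Matrix.fromBlocks_multiply, Matrix.fromBlocks_neg]

theorem matJDeriv_pMat_pMat {n : ℕ} (a b : Matrix (SIdx n) Unit ℝ) :
    matJDeriv (-1) (t0 n) (pMat a) (pMat b) = ext0 (a * bᵀ - (2 : ℝ) • (j0 n * b * aᵀ * j0 n)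
      + j0 n * a * bᵀ * j0 n) := by
  have h : bᵀ * a = aᵀ * b := by
    rw [← Matrix.transpose_transpose b, ← Matrix.transpose_mul, Matrix.transpose_transpose]
    rfl
  rw [matJDeriv, one_add_t0_sq, t0_sq, t0, pMat, pMat, ext0]
  simp [Matrix.fromBlocks_multiply, Matrix.fromBlocks_add, Matrix.fromBlocks_neg,
    sub_eq_add_neg]
  refine ⟨by rw [h, add_neg_cancel], ?_⟩
  simp only [Matrix.mul_assoc]
  module

theorem matJDeriv_ext0_pMat {n : ℕ} {B : SMat n} (hB : B * j0 n = -(j0 n * B)) (hBt : Bᵀ = -B)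
    (a : Matrix (SIdx n) Unit ℝ) :
    matJDeriv (-1) (t0 n) (ext0 B) (pMat a) = pMat (-(B * a)) := by
  rw [matJDeriv, one_add_t0_sq, t0_sq, t0, pMat, pMat, ext0]
  simp [Matrix.fromBlocks_multiply, Matrix.fromBlocks_add, Matrix.fromBlocks_neg,
    sub_eq_add_neg, hB, hBt]

theorem matJDeriv_pMat_ext0 {n : ℕ} {B : SMat n} (hB : B * j0 n = -(j0 n * B)) (hBt : Bᵀ = -B)
    (a : Matrix (SIdx n) Unit ℝ) :
    matJDeriv (-1) (t0 n) (pMat a) (ext0 B) = pMat (-((2 : ℝ) • (B * a))) := by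
  rw [matJDeriv, one_add_t0_sq, t0_sq, t0, pMat, pMat, ext0]
  simp [Matrix.fromBlocks_multiply, Matrix.fromBlocks_add, Matrix.fromBlocks_neg,
    sub_eq_add_neg, hBt]
  have h1 : ∀ {K : Type} [Fintype K] (Z : Matrix K (SIdx n) ℝ), Z * j0 n * B * j0 n = Z * B := by
    intro K _ Z
    have h0 : j0 n * -(j0 n * B) = B := by rw [mul_neg, ← mul_assoc, j0_sq]; simp
    rw [Matrix.mul_assoc, Matrix.mul_assoc, hB, h0]
  have h2 : j0 n * B * (j0 n * a) = B * a := by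
    rw [Matrix.mul_assoc, ← Matrix.mul_assoc B, hB, Matrix.neg_mul, Matrix.mul_neg,
      Matrix.mul_assoc, ← Matrix.mul_assoc, j0_sq]
    simp
  rw [h1, h2]
  exact ⟨by module, by module⟩

theorem ext0_add {n : ℕ} (A B : SMat n) : ext0 A + ext0 B = ext0 (A + B) := ((ext0L n).map_add A B).symm
theorem ext0_sub {n : ℕ} (A B : SMat n) : ext0 A - ext0 B = ext0 (A - B) := ((ext0L n).map_sub A B).symm

theorem pMat_add {n : ℕ} (a b : Matrix (SIdx n) Unit ℝ) : pMat a + pMat b = pMat (a + b) := by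
  simp [pMat, Matrix.fromBlocks_add]
theorem pMat_sub {n : ℕ} (a b : Matrix (SIdx n) Unit ℝ) : pMat a - pMat b = pMat (a - b) := by
  simp [pMat, sub_eq_add_neg, Matrix.fromBlocks_neg, Matrix.fromBlocks_add]

/-- Two vectors of `𝔭` produce an element of `𝔮`: up to the factor `-4`, the commutator of `j₀` with
the skew matrix `abᵀ - baᵀ`. -/
theorem matNij_pMat_pMat {n : ℕ} (a b : Matrix (SIdx n) Unit ℝ) :
    matNij (-1) (t0 n) (pMat a) (pMat b) = ext0 (-((4 : ℝ) • (j0 n * (a * bᵀ - (a * bᵀ)ᵀ) -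
      (a * bᵀ - (a * bᵀ)ᵀ) * j0 n))) := by
  have hj : ∀ Z : SMat n, j0 n * (j0 n * Z) = -Z := fun Z => by rw [← mul_assoc, j0_sq]; simp
  have hj' : ∀ Z : Matrix (SIdx n) Unit ℝ, j0 n * (j0 n * Z) = -Z := fun Z => by rw [← Matrix.mul_assoc, j0_sq]; simp
  rw [matNij, matJ_pMat, matJ_pMat]
  simp only [matJDeriv_pMat_pMat, matJ_ext0, ext0_add, ext0_sub]
  congr 1
  simp [mul_sub, mul_add, sub_mul, Matrix.mul_assoc, hj, hj', j0_t, j0_sq]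
  module

/-- A vector of `𝔭` and an element of `𝔮` produce a vector of `𝔭`, so all of `𝔭` is reached once the
vectors `Ba` span. -/
theorem matNij_pMat_ext0 {n : ℕ} {B : SMat n} (hB : B * j0 n = -(j0 n * B)) (hBt : Bᵀ = -B)
    (a : Matrix (SIdx n) Unit ℝ) :
    matNij (-1) (t0 n) (pMat a) (ext0 B) = pMat (-((2 : ℝ) • (j0 n * (B * a)))) := by
  have h1 : (j0 n * B) * j0 n = -(j0 n * (j0 n * B)) := by rw [mul_assoc, hB, mul_neg]
  have h2 : (j0 n * B)ᵀ = -(j0 n * B) := by rw [Matrix.transpose_mul, hBt, j0_t, neg_mul_neg, hB]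
  have h3 : B * (j0 n * a) = -(j0 n * (B * a)) := by
    rw [← Matrix.mul_assoc, hB, Matrix.neg_mul, Matrix.mul_assoc]
  rw [matNij, matJ_pMat, matJ_ext0, matJDeriv_pMat_ext0 hB hBt, matJDeriv_ext0_pMat h1 h2,
    matJDeriv_ext0_pMat hB hBt, matJDeriv_pMat_ext0 hB hBt, matJ_pMat, matJ_pMat]
  simp only [pMat_add, pMat_sub, Matrix.mul_neg, h3, Matrix.mul_assoc, Matrix.mul_smul]
  congr 1
  module

/-- A basic element of `𝔮`. -/
def qMat {n : ℕ} (r k : Fin n) : SMat n :=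
  Matrix.fromBlocks (Matrix.single r k (1 : ℝ) - Matrix.single k r 1) 0 0
    (-(Matrix.single r k (1 : ℝ) - Matrix.single k r 1))

theorem qMat_mem {n : ℕ} (r k : Fin n) : qMat r k ∈ qSpace n := by
  constructor
  · simp [qMat, Matrix.fromBlocks_transpose, Matrix.fromBlocks_neg, Matrix.transpose_single]
  · simp [qMat, j0, Matrix.J, Matrix.fromBlocks_multiply, Matrix.fromBlocks_neg]

/-- `qMat r k` moves the `k`-th basis vector to the `r`-th, which requires two distinct indices. -/
theorem qMat_mul_inl {n : ℕ} {r k : Fin n} (h : k ≠ r) (c : ℝ) :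
    qMat r k * (Matrix.single (Sum.inl k) () c : Matrix (SIdx n) Unit ℝ) =
      Matrix.single (Sum.inl r) () c := by
  ext (i | i) j <;>
    simp [qMat, Matrix.mul_apply, Matrix.single_apply, h.symm]

theorem qMat_mul_inr {n : ℕ} {r k : Fin n} (h : k ≠ r) (c : ℝ) :
    qMat r k * (Matrix.single (Sum.inr k) () (-c) : Matrix (SIdx n) Unit ℝ) =
      Matrix.single (Sum.inr r) () c := by
  ext (i | i) j <;>
    simp [qMat, Matrix.mul_apply, Matrix.single_apply, h.symm]

/-- The Nijenhuis tensor of `J⁻` spans the tangent space. -/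
theorem isMaximallyNonIntegrable_twistorJMinus {n : ℕ} (hn : 2 ≤ n) :
    IsMaximallyNonIntegrable (twistorJMinus n) := by
  intro p
  obtain ⟨g, hg, hp⟩ := p.2
  set S := (nijenhuisImage (twistorJMinus n) p).map (tangentMat p) with hS
  set φ := conjHom hg with hφ
  have hpφ : p.1 = φ (t0 n) := hp
  have hbase : ∀ N : LMat n, Nᵀ * eta n = -(eta n * N) →
      N * t0 n * t0 n + t0 n * N * t0 n + t0 n * t0 n * N = -N → ∃ v, tangentMat p v = φ N := by
    intro N h1 h2
    obtain ⟨c, hc⟩ := mem_frameMat_base h1 h2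
    exact ⟨frame p hg hp c, by rw [tangentMat_frame, hc]; rfl⟩
  have hP : ∀ a : Matrix (SIdx n) Unit ℝ, ∃ v, tangentMat p v = φ (pMat a) := by
    intro a
    apply hbase
    · simp [pMat, eta_eq, Matrix.fromBlocks_transpose, Matrix.fromBlocks_multiply,
        Matrix.fromBlocks_neg]
    · simp [pMat, t0, Matrix.fromBlocks_multiply, Matrix.fromBlocks_add, Matrix.fromBlocks_neg,
        Matrix.mul_assoc, j0_sq]
  have hQ : ∀ B ∈ qSpace n, ∃ v, tangentMat p v = φ (ext0 B) := by
    rintro B ⟨h1, h2⟩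
    apply hbase
    · simp [ext0, eta_eq, Matrix.fromBlocks_transpose, Matrix.fromBlocks_multiply,
        Matrix.fromBlocks_neg, h1]
    · have h3 : j0 n * (j0 n * B) = -B := by rw [← mul_assoc, j0_sq]; simp
      simp [ext0, t0, Matrix.fromBlocks_multiply, Matrix.fromBlocks_add, Matrix.fromBlocks_neg,
        mul_assoc, j0_sq, h2, h3]
  have hpp : ∀ a b : Matrix (SIdx n) Unit ℝ, φ (ext0 (-((4 : ℝ) • (j0 n * (a * bᵀ - (a * bᵀ)ᵀ) -
      (a * bᵀ - (a * bᵀ)ᵀ) * j0 n)))) ∈ S := by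
    intro a b
    obtain ⟨v, hv⟩ := hP a
    obtain ⟨w, hw⟩ := hP b
    have h := matNij_mem (ε := -1) (by norm_num) p v w
    rwa [hv, hw, hpφ, matNij_conj, matNij_pMat_pMat] at h
  have hpq : ∀ (a : Matrix (SIdx n) Unit ℝ) (B : SMat n), B ∈ qSpace n →
      φ (pMat (-((2 : ℝ) • (j0 n * (B * a))))) ∈ S := by
    intro a B hB
    obtain ⟨v, hv⟩ := hP a
    obtain ⟨w, hw⟩ := hQ B hB
    have h := matNij_mem (ε := -1) (by norm_num) p v w
    rwa [hv, hw, hpφ, matNij_conj, matNij_pMat_ext0 hB.2 hB.1] at h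
  -- The linear extension of the values on `𝔭 × 𝔭` from the matrices `abᵀ` to all matrices; its
  -- values lie in `S` because every matrix is a sum of matrices of rank at most one.
  let LQ : SMat n →ₗ[ℝ] LMat n :=
    { toFun := fun Z => φ (ext0 (-((4 : ℝ) • (j0 n * (Z - Zᵀ) - (Z - Zᵀ) * j0 n))))
      map_add' := fun A B => by
        rw [← map_add, ext0_add, Matrix.transpose_add]
        congr 2
        simp only [mul_sub, mul_add, sub_mul, add_mul]
        module
      map_smul' := fun c A => by
        rw [RingHom.id_apply, ← map_smul, Matrix.transpose_smul, ← smul_sub, mul_smul_comm,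
          smul_mul_assoc, ← smul_sub, smul_comm, ← smul_neg]
        exact congrArg φ ((ext0L n).map_smul c _) }
  have hLQ : ∀ Z, LQ Z ∈ S := by
    intro Z
    rw [Matrix.matrix_eq_sum_single Z, map_sum]
    refine Submodule.sum_mem _ fun i _ => ?_
    rw [map_sum]
    refine Submodule.sum_mem _ fun k _ => ?_
    have e : Matrix.single i k (Z i k) =
        Matrix.single i () (Z i k) * (Matrix.single k () (1 : ℝ))ᵀ := by
      simp [Matrix.transpose_single]
    rw [e]
    exact hpp _ _
  have hQS : ∀ B ∈ qSpace n, φ (ext0 B) ∈ S := by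
    intro B hB
    have hj := j0_sq n
    have h1 : (j0 n * B)ᵀ = -(j0 n * B) := by
      rw [Matrix.transpose_mul, hB.1, j0_t, neg_mul_neg, hB.2]
    have h2 : j0 n * (j0 n * B) = -B := by rw [← mul_assoc, hj]; simp
    have h3 : (j0 n * B) * j0 n = B := by rw [mul_assoc, hB.2, mul_neg, h2, neg_neg]
    -- With `Z = j₀B/16`, which is skew, `Z - Zᵀ = j₀B/8`; its commutator with `j₀` is `-B/4`, and
    -- the factor `-4` restores `B`.
    have h4 : LQ ((1 / 16 : ℝ) • (j0 n * B)) = φ (ext0 B) := by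
      show φ (ext0 (-((4 : ℝ) • (j0 n * ((1 / 16 : ℝ) • (j0 n * B) - ((1 / 16 : ℝ) • (j0 n * B))ᵀ) -
        ((1 / 16 : ℝ) • (j0 n * B) - ((1 / 16 : ℝ) • (j0 n * B))ᵀ) * j0 n)))) = _
      congr 2
      rw [Matrix.transpose_smul, h1]
      simp only [mul_sub, sub_mul, mul_smul_comm, smul_mul_assoc, mul_neg, neg_mul, h2, h3]
      module
    rw [← h4]
    exact hLQ _
  let LP : Matrix (SIdx n) Unit ℝ →ₗ[ℝ] LMat n :=
    { toFun := fun a => φ (pMat (-((2 : ℝ) • (j0 n * a))))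
      map_add' := fun a b => by
        rw [← map_add, pMat_add, Matrix.mul_add]
        congr 2
        module
      map_smul' := fun c a => by
        rw [RingHom.id_apply, ← map_smul, Matrix.mul_smul, smul_comm, ← smul_neg]
        congr 1
        simp [pMat, Matrix.fromBlocks_smul] }
  have hLP : ∀ a, LP a ∈ S := by
    intro a
    -- The only use of `n ≥ 2`: each index `r` needs some `k ≠ r`.
    have : Nontrivial (Fin n) := Fin.nontrivial_iff_two_le.2 hn
    rw [Matrix.matrix_eq_sum_single a, map_sum]
    refine Submodule.sum_mem _ fun i _ => ?_
    rw [map_sum]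
    refine Submodule.sum_mem _ fun _ _ => ?_
    rcases i with r | r
    · obtain ⟨k, hk⟩ := exists_ne r
      have h := hpq (Matrix.single (Sum.inl k) () (a (Sum.inl r) ())) _ (qMat_mem r k)
      rwa [qMat_mul_inl hk] at h
    · obtain ⟨k, hk⟩ := exists_ne r
      have h := hpq (Matrix.single (Sum.inr k) () (-a (Sum.inr r) ())) _ (qMat_mem r k)
      rwa [qMat_mul_inr hk] at h
  have hPS : ∀ a, φ (pMat a) ∈ S := by
    intro a
    have h := hLP ((1 / 2 : ℝ) • (j0 n * a))
    have e : LP ((1 / 2 : ℝ) • (j0 n * a)) = φ (pMat a) := by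
      show φ (pMat (-((2 : ℝ) • (j0 n * ((1 / 2 : ℝ) • (j0 n * a)))))) = _
      rw [Matrix.mul_smul, ← Matrix.mul_assoc, j0_sq]
      congr 2
      simp
    rwa [e] at h
  rw [eq_top_iff]
  intro v _
  have hv : tangentMat p v ∈ S := by
    obtain ⟨c, rfl⟩ := (frame p hg hp).surjective v
    rw [tangentMat_frame, mMat_comm]
    have hq : -((2 : ℝ) • (j0 n * (c.2 : SMat n))) ∈ qSpace n :=
      (qSpace n).neg_mem ((qSpace n).smul_mem _ (baseJ n 1 c).2.2)
    have h := S.add_mem (hPS (Matrix.replicateCol Unit (-(j0 n *ᵥ c.1)))) (hQS _ hq)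
    rw [← map_add, pMat, ext0, Matrix.fromBlocks_add] at h
    simp only [add_zero, zero_add] at h
    exact h
  obtain ⟨w, hw, hwv⟩ := hv
  rwa [← tangentMat_injective p hwv]

end HypTwistor

/-! ### From immersions in a complex vector space to a holomorphic atlas. -/

namespace AlmostComplexGeometry

/-- An injective real-linear map to a complex space that turns `J` into `i` becomes an isomorphism
after a complex-linear projection. -/
theorem exists_complex_projection {V W : Type*} [AddCommGroup V] [Module ℝ V]
    [FiniteDimensional ℝ V] [AddCommGroup W] [Module ℂ W] [FiniteDimensional ℂ W]
    (D : V →ₗ[ℝ] W) (J : V →ₗ[ℝ] V) (hJ : ∀ v, D (J v) = Complex.I • D v)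
    (hD : Function.Injective D) :
    ∃ L : W →ₗ[ℂ] (Fin (Module.finrank ℝ V / 2) → ℂ), Function.Bijective fun v => L (D v) := by
  have hc : ∀ (c : ℂ) (w : W), c • w = c.re • w + c.im • Complex.I • w := by
    intro c w
    conv_lhs => rw [← Complex.re_add_im c, add_smul, mul_smul]
    rfl
  -- The range of `D` is stable under `i` because `iD = DJ`; a complex-linear retraction on it,
  -- followed by a basis, gives `L`.
  let R : Submodule ℂ W :=
    { carrier := Set.range D
      add_mem' := by rintro _ _ ⟨v, rfl⟩ ⟨w, rfl⟩; exact ⟨v + w, map_add _ _ _⟩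
      zero_mem' := ⟨0, map_zero _⟩
      smul_mem' := by
        rintro c _ ⟨v, rfl⟩
        exact ⟨c.re • v + c.im • J v, by rw [hc, map_add, map_smul, map_smul, hJ]⟩ }
  let D' : V ≃ₗ[ℝ] R := LinearEquiv.ofBijective
    { toFun := fun v => ⟨D v, v, rfl⟩
      map_add' := fun v w => Subtype.ext (map_add D v w)
      map_smul' := fun c v => Subtype.ext (map_smul D c v) }
    ⟨fun v w h => hD (congrArg Subtype.val h), by rintro ⟨_, v, rfl⟩; exact ⟨v, rfl⟩⟩
  -- The real dimension of `V` is twice the complex dimension of the range, so the division by `2`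
  -- is exact.
  have hfr : Module.finrank ℂ R = Module.finrank ℝ V / 2 := by
    rw [D'.finrank_eq, finrank_real_of_complex]; omega
  obtain ⟨π, hπ⟩ := LinearMap.exists_leftInverse_of_injective R.subtype R.ker_subtype
  let e : R ≃ₗ[ℂ] (Fin (Module.finrank ℝ V / 2) → ℂ) := LinearEquiv.ofFinrankEq _ _ (by simpa using hfr)
  refine ⟨e.toLinearMap ∘ₗ π, ?_⟩
  have h : (fun v => (e.toLinearMap ∘ₗ π) (D v)) = e ∘ D' := by
    funext v
    exact congrArg e (LinearMap.congr_fun hπ (D' v))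
  rw [h]
  exact e.bijective.comp D'.bijective

section
variable {E : Type*} [NormedAddCommGroup E] [NormedSpace ℝ E] [FiniteDimensional ℝ E] {M : Type*}
  [TopologicalSpace M] [ChartedSpace E M] [IsManifold 𝓘(ℝ, E) ∞ M]

/-- The inverse function theorem on a manifold. -/
theorem exists_coordinates {F : Type*} [NormedAddCommGroup F] [NormedSpace ℝ F]
    {f : M → F} {p : M} {U : Set M} (hU : IsOpen U) (hp : p ∈ U)
    (hf : ContMDiffOn 𝓘(ℝ, E) 𝓘(ℝ, F) ∞ f U)
    (hb : Function.Bijective (mfderiv 𝓘(ℝ, E) 𝓘(ℝ, F) f p)) :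
    ∃ e : OpenPartialHomeomorph M F, p ∈ e.source ∧ e.source ⊆ U ∧ Set.EqOn e f e.source ∧
      ContMDiffOn 𝓘(ℝ, E) 𝓘(ℝ, F) ∞ e e.source ∧
      ContMDiffOn 𝓘(ℝ, F) 𝓘(ℝ, E) ∞ e.symm e.target := by
  have : CompleteSpace E := FiniteDimensional.complete ℝ E
  set φ := chartAt E p with hφ
  set a := φ p with ha
  have hpφ : p ∈ φ.source := mem_chart_source E p
  set O := φ.target ∩ φ.symm ⁻¹' U with hO
  have hOo : IsOpen O := φ.isOpen_inter_preimage_symm hU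
  have haO : a ∈ O := ⟨φ.map_source hpφ, by simpa [ha, φ.left_inv hpφ] using hp⟩
  set g := f ∘ φ.symm with hg
  have hgO : ContDiffOn ℝ ∞ g O := by
    rw [← contMDiffOn_iff_contDiffOn]
    exact hf.comp ((contMDiffOn_chart_symm (x := p)).mono fun _ h => h.1) fun _ h => h.2
  have hgA : ∀ b ∈ O, ContDiffAt ℝ ∞ g b := fun b hb => hgO.contDiffAt (hOo.mem_nhds hb)
  have hbij : Function.Bijective (fderiv ℝ g a) := by
    have h := fun v => mfderiv_eq_fderiv_chart
      ((hf.contMDiffAt (hU.mem_nhds hp)).mdifferentiableAt (by simp)) v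
    exact (funext h : (mfderiv 𝓘(ℝ, E) 𝓘(ℝ, F) f p : E → F) = fderiv ℝ g a) ▸ hb
  have : FiniteDimensional ℝ F :=
    (LinearEquiv.ofBijective (fderiv ℝ g a).toLinearMap hbij).finiteDimensional
  let A : E ≃L[ℝ] F := (LinearEquiv.ofBijective (fderiv ℝ g a).toLinearMap hbij).toContinuousLinearEquiv
  have hA : HasFDerivAt g (A : E →L[ℝ] F) a := by
    convert ((hgA a haO).differentiableAt (by simp)).hasFDerivAt using 1
    ext v; rfl
  let h0 := (hgA a haO).toOpenPartialHomeomorph g hA (by simp)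
  -- The open set where the derivative stays invertible: restricting to it makes the inverse smooth
  -- at every point of the target, not only at the image of `p`.
  set s := O ∩ fderiv ℝ g ⁻¹' Set.range ((↑) : (E ≃L[ℝ] F) → E →L[ℝ] F) with hs
  have hso : IsOpen s := (hgO.continuousOn_fderiv_of_isOpen hOo (by simp)).isOpen_inter_preimage
    hOo ContinuousLinearEquiv.isOpen
  have has : a ∈ s := ⟨haO, A, hA.fderiv.symm⟩
  have h0g : ∀ b, h0 b = g b := fun b => rfl
  let h1 := h0.restrOpen s hso
  have hsub : ∀ q ∈ (φ.trans h1).source, q ∈ φ.source ∧ φ q ∈ s := by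
    intro q hq
    rw [OpenPartialHomeomorph.trans_source] at hq
    exact ⟨hq.1, hq.2.2⟩
  have hEq : Set.EqOn (φ.trans h1) f (φ.trans h1).source := fun q hq => by
    show f (φ.symm (φ q)) = f q
    rw [φ.left_inv (hsub q hq).1]
  have hU' : (φ.trans h1).source ⊆ U := fun q hq => by
    have := (hsub q hq).2.1.2
    rwa [Set.mem_preimage, φ.left_inv (hsub q hq).1] at this
  refine ⟨φ.trans h1, ?_, hU', hEq, (hf.mono hU').congr hEq, ?_⟩
  · rw [OpenPartialHomeomorph.trans_source]
    exact ⟨hpφ, (hgA a haO).mem_toOpenPartialHomeomorph_source hA (by simp), has⟩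
  · intro c hc
    have hc1 : c ∈ h1.target := by
      rw [OpenPartialHomeomorph.trans_target] at hc; exact hc.1
    have hc2 := h1.map_target hc1
    obtain ⟨hcO, B, hB⟩ : h1.symm c ∈ s := hc2.2
    have hd : HasFDerivAt h1 (B : E →L[ℝ] F) (h1.symm c) := by
      rw [hB]
      exact ((hgA _ hcO).differentiableAt (by simp)).hasFDerivAt
    have h2 : ContDiffAt ℝ ∞ h1.symm c := h1.contDiffAt_symm hc1 hd (hgA _ hcO)
    have h3 := (contMDiffOn_chart_symm (I := 𝓘(ℝ, E)) (n := ∞) (x := p)).contMDiffAt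
      (φ.open_target.mem_nhds hcO.1)
    exact (h3.comp c h2.contMDiffAt).contMDiffWithinAt

-- The real derivative of the transition map is `de' ∘ (de)⁻¹`. Both factors intertwine `J` with
-- `i`, so it commutes with `i` and the map is complex differentiable.
omit [FiniteDimensional ℝ E] [IsManifold 𝓘(ℝ, E) ∞ M] in
theorem differentiableOn_transition {m : ℕ} {e e' : OpenPartialHomeomorph M (Fin m → ℂ)}
    {J : ∀ p : M, TangentSpace 𝓘(ℝ, E) p →ₗ[ℝ] TangentSpace 𝓘(ℝ, E) p}
    (h1 : ContMDiffOn 𝓘(ℝ, E) 𝓘(ℝ, Fin m → ℂ) ∞ e e.source)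
    (h2 : ContMDiffOn 𝓘(ℝ, Fin m → ℂ) 𝓘(ℝ, E) ∞ e.symm e.target)
    (h3 : ∀ p ∈ e.source, ∀ v : TangentSpace 𝓘(ℝ, E) p,
      complexDiff e p (J p v) = Complex.I • complexDiff e p v)
    (h1' : ContMDiffOn 𝓘(ℝ, E) 𝓘(ℝ, Fin m → ℂ) ∞ e' e'.source)
    (h3' : ∀ p ∈ e'.source, ∀ v : TangentSpace 𝓘(ℝ, E) p,
      complexDiff e' p (J p v) = Complex.I • complexDiff e' p v) :
    DifferentiableOn ℂ (e.symm.trans e') (e.symm.trans e').source := by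
  intro b hb
  rw [OpenPartialHomeomorph.trans_source] at hb
  obtain ⟨hb1, hb2⟩ : b ∈ e.target ∧ e.symm b ∈ e'.source := hb
  set q := e.symm b with hq
  have hqe : q ∈ e.source := e.map_target hb1
  have d1 : MDifferentiableAt 𝓘(ℝ, E) 𝓘(ℝ, Fin m → ℂ) e q :=
    (h1.contMDiffAt (e.open_source.mem_nhds hqe)).mdifferentiableAt (by simp)
  have d2 : MDifferentiableAt 𝓘(ℝ, Fin m → ℂ) 𝓘(ℝ, E) e.symm b :=
    (h2.contMDiffAt (e.open_target.mem_nhds hb1)).mdifferentiableAt (by simp)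
  have d1' : MDifferentiableAt 𝓘(ℝ, E) 𝓘(ℝ, Fin m → ℂ) e' q :=
    (h1'.contMDiffAt (e'.open_source.mem_nhds hb2)).mdifferentiableAt (by simp)
  have hmd : e.MDifferentiable 𝓘(ℝ, E) 𝓘(ℝ, Fin m → ℂ) :=
    ⟨h1.mdifferentiableOn (by simp), h2.mdifferentiableOn (by simp)⟩
  let S : (Fin m → ℂ) →L[ℝ] TangentSpace 𝓘(ℝ, E) q := mfderiv 𝓘(ℝ, Fin m → ℂ) 𝓘(ℝ, E) e.symm b
  have hS1 : ∀ z, complexDiff e q (S z) = z := fun z =>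
    congrArg (fun A : (Fin m → ℂ) →L[ℝ] (Fin m → ℂ) => A z) (hmd.comp_symm_deriv hb1)
  have hS2 : ∀ v, S (complexDiff e q v) = v := fun v => by
    have h4 := hmd.symm_comp_deriv hqe
    rw [e.right_inv hb1] at h4
    exact congrArg (fun A : E →L[ℝ] E => A v) h4
  have hcomp : DifferentiableAt ℝ (e.symm.trans e') b :=
    (d1'.comp b d2).differentiableAt
  have hT : ∀ z, fderiv ℝ (e.symm.trans e') b z = complexDiff e' q (S z) := fun z => by
    have := mfderiv_comp_apply b d1' d2 z
    rw [mfderiv_eq_fderiv] at this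
    exact this
  have hTI : ∀ z, fderiv ℝ (e.symm.trans e') b (Complex.I • z) =
      Complex.I • fderiv ℝ (e.symm.trans e') b z := by
    intro z
    have h4 : S (Complex.I • z) = J q (S z) := by
      rw [← hS2 (J q (S z)), h3 q hqe, hS1]
    rw [hT, hT, h4, h3' q hb2]
  refine ((differentiableAt_iff_restrictScalars (𝕜' := ℂ) ℝ hcomp).2 ⟨⟨⟨⟨fderiv ℝ (e.symm.trans e') b,
    map_add _⟩, fun c z => ?_⟩, ContinuousLinearMap.continuous _⟩, rfl⟩).differentiableWithinAt
  have hc : ∀ w : Fin m → ℂ, c • w = c.re • w + c.im • Complex.I • w := by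
    intro w
    conv_lhs => rw [← Complex.re_add_im c, add_smul, mul_smul]
    rfl
  show fderiv ℝ (e.symm.trans e') b (c • z) = c • fderiv ℝ (e.symm.trans e') b z
  rw [hc, hc, map_add, map_smul, map_smul, hTI]

/-- The differential of a map with values in a vector space. -/
noncomputable def vdiff {F : Type*} [NormedAddCommGroup F] [NormedSpace ℝ F] (f : M → F) (p : M) :
    TangentSpace 𝓘(ℝ, E) p →L[ℝ] F :=
  mfderiv 𝓘(ℝ, E) 𝓘(ℝ, F) f p

/-- `J` is integrable if locally there are immersions in a complex vector space whose differentials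
turn `J` into `i`. -/
theorem isIntegrable_of_immersions {W : Type*} [NormedAddCommGroup W] [NormedSpace ℂ W]
    [FiniteDimensional ℂ W]
    (J : ∀ p : M, TangentSpace 𝓘(ℝ, E) p →ₗ[ℝ] TangentSpace 𝓘(ℝ, E) p)
    (h : ∀ p : M, ∃ (f : M → W) (U : Set M), IsOpen U ∧ p ∈ U ∧
      ContMDiffOn 𝓘(ℝ, E) 𝓘(ℝ, W) ∞ f U ∧
      (∀ q ∈ U, ∀ v : TangentSpace 𝓘(ℝ, E) q,
        vdiff f q (J q v) = Complex.I • vdiff f q v) ∧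
      Function.Injective (vdiff (E := E) f p)) :
    IsIntegrable J := by
  refine ⟨Module.finrank ℝ E / 2, {e | (ContMDiffOn 𝓘(ℝ, E) 𝓘(ℝ, Fin _ → ℂ) ∞ e e.source ∧
      ContMDiffOn 𝓘(ℝ, Fin _ → ℂ) 𝓘(ℝ, E) ∞ e.symm e.target) ∧
      ∀ p ∈ e.source, ∀ v : TangentSpace 𝓘(ℝ, E) p,
        complexDiff e p (J p v) = Complex.I • complexDiff e p v}, ?_, fun e he => he.1, ?_,
      fun e he => he.2⟩
  · intro p
    obtain ⟨f, U, hU, hp, hf, hfJ, hinj⟩ := h p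
    let D : E →L[ℝ] W := vdiff (E := E) f p
    let J' : E →ₗ[ℝ] E := J p
    -- `L` is chosen at `p` only, but being complex linear it preserves the relation between `J` and
    -- `i` at all points of `U`.
    obtain ⟨L, hL⟩ := exists_complex_projection (D : E →ₗ[ℝ] W) J' (hfJ p hp) hinj
    let L' : W →L[ℝ] (Fin (Module.finrank ℝ E / 2) → ℂ) :=
      (LinearMap.toContinuousLinearMap L).restrictScalars ℝ
    have hL' : ∀ q ∈ U, ∀ v : TangentSpace 𝓘(ℝ, E) q,
        complexDiff (L' ∘ f) q v = L (vdiff f q v) := by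
      intro q hq v
      have h1 := mfderiv_comp_apply (I := 𝓘(ℝ, E)) (I' := 𝓘(ℝ, W))
        (I'' := 𝓘(ℝ, Fin (Module.finrank ℝ E / 2) → ℂ)) q (g := L') (f := f)
        (L'.contMDiff.mdifferentiableAt one_ne_zero)
        ((hf.contMDiffAt (hU.mem_nhds hq)).mdifferentiableAt (by simp)) v
      rw [mfderiv_eq_fderiv, L'.fderiv] at h1
      exact h1
    obtain ⟨e, h1, h2, h3, h4, h5⟩ := exists_coordinates hU hp (L'.contMDiff.comp_contMDiffOn hf)
      (by
        show Function.Bijective (complexDiff (L' ∘ f) p)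
        rw [funext (hL' p hp)]
        exact hL)
    refine ⟨e, ⟨⟨h4, h5⟩, fun q hq v => ?_⟩, h1⟩
    have e2 : ∀ v : TangentSpace 𝓘(ℝ, E) q, complexDiff e q v = complexDiff (L' ∘ f) q v := by
      intro v
      have := (h3.eventuallyEq_of_mem (e.open_source.mem_nhds hq)).mfderiv_eq (I := 𝓘(ℝ, E))
        (I' := 𝓘(ℝ, Fin (Module.finrank ℝ E / 2) → ℂ))
      unfold complexDiff
      exact congrArg (fun A : E →L[ℝ] (Fin (Module.finrank ℝ E / 2) → ℂ) => A v) this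
    rw [e2, e2, hL' q (h2 hq), hL' q (h2 hq), hfJ q (h2 hq), map_smul]
  · rintro e ⟨⟨h1, h2⟩, h3⟩ e' ⟨⟨h1', -⟩, h3'⟩
    exact differentiableOn_transition h1 h2 h3 h1' h3'

end

end AlmostComplexGeometry

/-! ### Spectral projectors and the map to a complex Grassmannian. -/

namespace AlmostComplexGeometry

section
variable {𝔸 : Type} [Ring 𝔸] [Algebra ℂ 𝔸]

/-- The projector on the `-i` eigenspace of an element with `x ^ 3 = -x`. -/
noncomputable def eigenProj (x : 𝔸) : 𝔸 := (-(1 / 2) : ℂ) • (x * x) + (Complex.I / 2) • x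

/-- The derivative of `eigenProj` at `x` in the direction `V`. -/
noncomputable def eigenProjDeriv (x V : 𝔸) : 𝔸 :=
  (-(1 / 2) : ℂ) • (x * V + V * x) + (Complex.I / 2) • V

theorem mul_eigenProj {x : 𝔸} (hx : x * (x * x) = -x) :
    x * eigenProj x = (-Complex.I) • eigenProj x := by
  simp only [eigenProj, mul_add, mul_smul_comm, hx]
  match_scalars
  · linear_combination (1 / 2 : ℂ) * Complex.I_mul_I
  · ring

theorem eigenProj_mul {x : 𝔸} (hx : x * (x * x) = -x) :
    eigenProj x * x = (-Complex.I) • eigenProj x := by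
  rw [← mul_eigenProj hx]
  simp only [eigenProj, mul_add, add_mul, mul_smul_comm, smul_mul_assoc, mul_assoc]

theorem eigenProj_mul_self {x : 𝔸} (hx : x * (x * x) = -x) :
    eigenProj x * eigenProj x = eigenProj x := by
  have h : eigenProj x * eigenProj x =
      (-(1 / 2) : ℂ) • (x * (x * eigenProj x)) + (Complex.I / 2) • (x * eigenProj x) := by
    conv_lhs => enter [1]; rw [eigenProj]
    rw [add_mul, smul_mul_assoc, smul_mul_assoc, mul_assoc]
  rw [h, mul_eigenProj hx, mul_smul_comm, mul_eigenProj hx]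
  match_scalars
  linear_combination (-1 : ℂ) * Complex.I_mul_I

theorem eigenProjDeriv_mul {x : 𝔸} (hx : x * (x * x) = -x) (V : 𝔸) :
    eigenProjDeriv x V * eigenProj x =
      Complex.I • (V * eigenProj x) - (1 / 2 : ℂ) • (x * (V * eigenProj x)) := by
  rw [eigenProjDeriv]
  simp only [add_mul, smul_mul_assoc, mul_assoc, mul_eigenProj hx, mul_smul_comm]
  module

/-- The derivative of `R² = R` for `R = eigenProj x`, along directions that preserve `x³ = -x` to
first order. -/
theorem eigenProjDeriv_eq {x V : 𝔸} (hx : x * (x * x) = -x)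
    (hV : V * x * x + x * V * x + x * x * V = -V) :
    eigenProjDeriv x V = eigenProjDeriv x V * eigenProj x + eigenProj x * eigenProjDeriv x V := by
  simp only [mul_assoc] at hV
  have h1 : x * (V * (x * x)) + x * (x * (V * x)) = 0 := by
    have h := congrArg (fun z => x * z) hV
    have h2 : x * (x * (x * V)) = -(x * V) := by
      rw [← neg_mul, ← hx]; simp only [mul_assoc]
    simpa [mul_add, h2] using h
  have h3 : eigenProj x * eigenProjDeriv x V =
      Complex.I • (eigenProj x * V) - (1 / 2 : ℂ) • (eigenProj x * V * x) := by
    rw [eigenProjDeriv]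
    simp only [mul_add, mul_smul_comm, ← mul_assoc, eigenProj_mul hx, smul_mul_assoc]
    module
  have h4 : V = -(V * (x * x) + x * (V * x) + x * (x * V)) := by
    simp only [add_assoc] at hV ⊢
    rw [hV, neg_neg]
  have h5 : x * (V * (x * x)) = -(x * (x * (V * x))) := eq_neg_of_add_eq_zero_left h1
  rw [eigenProjDeriv_mul hx, h3, eigenProjDeriv, eigenProj]
  simp only [mul_add, add_mul, mul_smul_comm, smul_mul_assoc, mul_assoc, h5]
  have h6 : (Complex.I / 2) • V =
      (Complex.I / 2) • -(V * (x * x) + x * (V * x) + x * (x * V)) := congrArg _ h4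
  rw [h6]
  match_scalars <;> ring_nf <;> simp <;> ring

/-- In the chart of a Grassmannian given by a projector `P`, the matrix of a projector `R`. -/
noncomputable def grassMap (P R : 𝔸) : 𝔸 := R * P * Ring.inverse (P * R * P + (1 - P))

omit [Algebra ℂ 𝔸] in
theorem commute_inverse {P R : 𝔸} (hP : P * P = P) (h : IsUnit (P * R * P + (1 - P))) :
    Commute P (Ring.inverse (P * R * P + (1 - P))) := by
  have hc : Commute P (P * R * P + (1 - P)) := by
    show P * (P * R * P + (1 - P)) = (P * R * P + (1 - P)) * P
    simp only [mul_add, add_mul, mul_sub, sub_mul, mul_one, one_mul, ← mul_assoc, hP]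
    simp only [mul_assoc, hP]
  obtain ⟨u, hu⟩ := h
  rw [← hu] at hc ⊢
  rw [Ring.inverse_unit]
  exact hc.units_inv_right

-- `grassMap P R` inverts, from the image of `P` to that of `R`, the restriction of `P`. Thus
-- `grassMap P R * P` is the projector on the image of `R` along the kernel of `P`, and it fixes
-- `R`.
omit [Algebra ℂ 𝔸] in
theorem grassMap_mul {P R : 𝔸} (hP : P * P = P) (hR : R * R = R)
    (h1 : IsUnit (P * R * P + (1 - P))) (h2 : IsUnit (R * P * R + (1 - R))) :
    (1 - grassMap P R * P) * R = 0 := by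
  have hc := commute_inverse hP h1
  have h3 := Ring.inverse_mul_cancel _ h1
  rw [grassMap]
  set A := P * R * P + (1 - P) with hA
  set B := Ring.inverse A
  have hPA : P * R * P = A * P := by
    simp only [hA, add_mul, sub_mul, one_mul, mul_assoc, hP]; simp
  have h4 : (1 - R * P * B * P) * R * (P * R) = 0 := by
    have e : R * P * B * P * R * (P * R) = R * P * R := by
      calc _ = R * P * B * (P * R * P) * R := by simp only [mul_assoc]
        _ = R * P * (B * A) * P * R := by rw [hPA]; simp only [mul_assoc]
        _ = R * (P * P) * R := by rw [h3]; simp only [mul_assoc, one_mul]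
        _ = _ := by rw [hP]
    simp only [sub_mul, one_mul, e]
    simp only [mul_assoc, sub_self]
  -- `h4` gives the vanishing on `RPR` only; the invertibility of `RPR + (1 - R)` then allows
  -- cancellation.
  have h5 : (1 - R * P * B * P) * R * (R * P * R + (1 - R)) = 0 := by
    generalize (1 - R * P * B * P) = K at *
    calc K * R * (R * P * R + (1 - R)) = K * (R * R) * (P * R) + K * (R - R * R) := by noncomm_ring
      _ = 0 := by rw [hR, h4]; simp
  exact h2.mul_left_eq_zero.1 h5

/-- The tangent space of the Grassmannian at the image of `R = eigenProj x` consists of maps from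
this image to the quotient by it, and `K` factors through that quotient. There `x` has only the
eigenvalues `0` and `i`. Since `(JV)R = xVR + i(1 + x²)VR`, both eigenspaces see multiplication by
`i`. -/
theorem eigenProj_relation {x V : 𝔸} (hx : x * (x * x) = -x) {K : 𝔸}
    (hK : K * eigenProj x = 0) :
    K * (eigenProjDeriv x (-(x * V * (x * x)) + (x * V * (1 + x * x) - (1 + x * x) * V * x)) *
      eigenProj x) = Complex.I • (K * (eigenProjDeriv x V * eigenProj x)) := by
  have h0 := mul_eigenProj hx
  have h1 : (-(x * V * (x * x)) + (x * V * (1 + x * x) - (1 + x * x) * V * x)) * eigenProj x =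
      x * (V * eigenProj x) + Complex.I • ((1 + x * x) * (V * eigenProj x)) := by
    simp only [add_mul, sub_mul, neg_mul, mul_assoc, mul_add, h0, mul_smul_comm, smul_smul, one_mul]
    match_scalars <;> ring_nf
  rw [eigenProjDeriv_mul hx, eigenProjDeriv_mul hx, h1]
  generalize V * eigenProj x = S at *
  -- `K * eigenProj x = 0` reads `Kx² = iKx`.
  have h2 : K * (x * (x * S)) = Complex.I • (K * (x * S)) := by
    have h := congrArg (fun z => z * S) hK
    simp only [eigenProj, mul_add, add_mul, mul_smul_comm, smul_mul_assoc, mul_assoc, zero_mul] at h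
    have h' : (2 : ℂ) • ((-(1 / 2) : ℂ) • (K * (x * (x * S))) + (Complex.I / 2) • (K * (x * S))) = 0 := by
      rw [h, smul_zero]
    rw [← sub_eq_zero, ← neg_eq_zero, ← h']
    module
  have h3 : x * (x * (x * S)) = -(x * S) := by rw [← neg_mul, ← hx]; simp only [mul_assoc]
  simp only [mul_add, mul_sub, add_mul, mul_smul_comm, mul_assoc, one_mul, h3, h2, mul_neg]
  match_scalars <;> ring_nf
  simp
  ring

/-- Put `S = VR` with `R = eigenProj x`. The tangency relation gives `x²S = ixS`, so `S` has no `-i`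
component and `1 - R` loses nothing. The hypothesis becomes `iS = ½xS`, and `2i` is incompatible
with `x²S = ixS` unless `S = 0`. -/
theorem mul_eigenProj_eq_zero {x V : 𝔸} (hx : x * (x * x) = -x)
    (hV : V * x * x + x * V * x + x * x * V = -V)
    (h : (1 - eigenProj x) * (eigenProjDeriv x V * eigenProj x) = 0) : V * eigenProj x = 0 := by
  have h0 := mul_eigenProj hx
  have h1 : x * (x * (V * eigenProj x)) = Complex.I • (x * (V * eigenProj x)) := by
    have e := congrArg (fun z => z * eigenProj x) hV
    simp only [add_mul, mul_assoc, h0, mul_smul_comm, neg_mul, smul_smul] at e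
    rw [← sub_eq_zero] at e ⊢
    rw [← e]
    match_scalars <;> ring_nf
    simp
  rw [eigenProjDeriv_mul hx] at h
  generalize V * eigenProj x = S at *
  have h4 : x * S = (2 * Complex.I) • S := by
    simp only [eigenProj, sub_mul, add_mul, mul_sub, one_mul, mul_smul_comm, smul_mul_assoc,
      mul_assoc, h1] at h
    rw [← sub_eq_zero]
    have h' := congrArg (fun z => (-2 : ℂ) • z) h
    simp only [smul_zero] at h'
    rw [← h']
    match_scalars <;> ring_nf
  rw [h4, mul_smul_comm, h4, smul_smul, smul_smul, ← sub_eq_zero, ← sub_smul] at h1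
  refine (smul_eq_zero.1 h1).resolve_left ?_
  ring_nf
  simp
end

section
variable {E : Type*} [NormedAddCommGroup E] [NormedSpace ℝ E] [FiniteDimensional ℝ E] {M : Type*}
  [TopologicalSpace M] [ChartedSpace E M] [IsManifold 𝓘(ℝ, E) ∞ M]
  {𝔸 : Type} [NormedRing 𝔸] [NormedAlgebra ℂ 𝔸] [FiniteDimensional ℂ 𝔸]

omit [FiniteDimensional ℂ 𝔸] in
theorem contDiff_eigenProj : ContDiff ℝ ∞ (eigenProj : 𝔸 → 𝔸) :=
  ((contDiff_id.mul contDiff_id).const_smul _).add (contDiff_id.const_smul _)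

theorem contDiffAt_grassMap {P R : 𝔸} (h : IsUnit (P * R * P + (1 - P))) :
    ContDiffAt ℝ ∞ (grassMap P) R := by
  have : CompleteSpace 𝔸 := FiniteDimensional.complete ℂ 𝔸
  obtain ⟨u, hu⟩ := h
  have h1 := contDiffAt_ringInverse ℝ (n := ∞) u
  rw [hu] at h1
  have h2 : ContDiffAt ℝ ∞ (fun R : 𝔸 => P * R * P + (1 - P)) R :=
    ((contDiffAt_const.mul contDiffAt_id).mul contDiffAt_const).add contDiffAt_const
  exact (contDiffAt_id.mul contDiffAt_const).mul (ContDiffAt.comp (g := Ring.inverse) R h1 h2)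

/-- The derivative of the inverse contributes `-grassMap P R * P`, giving the left factor `1 -
grassMap P R * P`, which kills the image of `R` when `grassMap_mul` applies. -/
theorem hasDerivAt_grassMap {P : 𝔸} {R : ℝ → 𝔸} {R' : 𝔸} {t : ℝ}
    (hR : HasDerivAt R R' t) (h : IsUnit (P * R t * P + (1 - P))) :
    HasDerivAt (fun s => grassMap P (R s)) ((1 - grassMap P (R t) * P) * R' * P *
      Ring.inverse (P * R t * P + (1 - P))) t := by
  have : CompleteSpace 𝔸 := FiniteDimensional.complete ℂ 𝔸
  have h2 : HasDerivAt (fun s => P * R s * P + (1 - P)) (P * R' * P) t :=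
    ((hR.const_mul P).mul_const P).add_const _
  obtain ⟨u, hu⟩ := h
  have h1 := hasFDerivAt_ringInverse (𝕜 := ℝ) u
  have h3 := HasFDerivAt.comp_hasDerivAt_of_eq t h1 h2 hu
  refine ((hR.mul_const P).mul h3).congr_deriv ?_
  simp only [Function.comp_apply, grassMap]
  rw [← hu, Ring.inverse_unit]
  simp only [mul_neg, add_mul, neg_mul, one_mul, neg_apply,
    ContinuousLinearMap.mulLeftRight_apply, mul_assoc, sub_eq_add_neg]

/-- `J` is integrable if it corresponds to `J⁺` under an immersion by matrices with `x ^ 3 = -x`. -/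
theorem isIntegrable_of_cube {x : M → 𝔸} (hx : ContMDiff 𝓘(ℝ, E) 𝓘(ℝ, 𝔸) ∞ x)
    (hc : ∀ p, x p * (x p * x p) = -x p)
    (hV : ∀ p (v : TangentSpace 𝓘(ℝ, E) p), vdiff x p v * x p * x p + x p * vdiff x p v * x p +
      x p * x p * vdiff x p v = -vdiff x p v)
    (J : ∀ p : M, TangentSpace 𝓘(ℝ, E) p →ₗ[ℝ] TangentSpace 𝓘(ℝ, E) p)
    (hJ : ∀ p (v : TangentSpace 𝓘(ℝ, E) p), vdiff x p (J p v) =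
      -(x p * vdiff x p v * (x p * x p)) + (x p * vdiff x p v * (1 + x p * x p) -
        (1 + x p * x p) * vdiff x p v * x p))
    (hinj : ∀ p (v : TangentSpace 𝓘(ℝ, E) p), vdiff x p v * eigenProj (x p) = 0 → v = 0) :
    IsIntegrable J := by
  have : CompleteSpace 𝔸 := FiniteDimensional.complete ℂ 𝔸
  have hRR := fun q => eigenProj_mul_self (hc q)
  have hRc : Continuous fun q => eigenProj (x q) := contDiff_eigenProj.continuous.comp hx.continuous
  apply isIntegrable_of_immersions (W := 𝔸)
  intro p
  set P := eigenProj (x p) with hP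
  have hPP : P * P = P := hRR p
  -- The first condition defines the graph chart; the second is the one needed by `grassMap_mul`.
  set U := {q | IsUnit (P * eigenProj (x q) * P + (1 - P))} ∩
    {q | IsUnit (eigenProj (x q) * P * eigenProj (x q) + (1 - eigenProj (x q)))} with hU
  have hUo : IsOpen U := by
    refine IsOpen.inter (Units.isOpen.preimage ?_) (Units.isOpen.preimage ?_)
    · exact ((continuous_const.mul hRc).mul continuous_const).add continuous_const
    · exact ((hRc.mul continuous_const).mul hRc).add (continuous_const.sub hRc)
  have hpU : p ∈ U := by
    have h : P * P * P + (1 - P) = 1 := by rw [hPP, hPP, add_sub_cancel]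
    constructor <;> simp only [Set.mem_ofPred_eq, ← hP, h, isUnit_one]
  have hsm : ContMDiffOn 𝓘(ℝ, E) 𝓘(ℝ, 𝔸) ∞ (fun q => grassMap P (eigenProj (x q))) U := by
    intro q hq
    have h := (contDiffAt_grassMap hq.1).comp (x q) contDiff_eigenProj.contDiffAt
    exact (h.contMDiffAt.comp q (hx q)).contMDiffWithinAt
  -- The vector `v` enters only through `K R' R`, with `K = 1 - grassMap P R * P`; the right-hand
  -- factor does not depend on `v`. `J`-linearity thus reduces to `eigenProj_relation`.
  have hd : ∀ q ∈ U, ∀ v : TangentSpace 𝓘(ℝ, E) q,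
      vdiff (fun q => grassMap P (eigenProj (x q))) q v =
      ((1 - grassMap P (eigenProj (x q)) * P) * (eigenProjDeriv (x q) (vdiff x q v) *
        eigenProj (x q))) * (P * Ring.inverse (P * eigenProj (x q) * P + (1 - P))) := by
    intro q hq v
    obtain ⟨γ, h0, hγ⟩ := exists_curve q v
    have h1 := hγ 𝔸 x (hx.mdifferentiable (by simp) q)
    have h2 := hγ 𝔸 _ ((hsm.contMDiffAt (hUo.mem_nhds hq)).mdifferentiableAt (by simp))
    have h3 : HasDerivAt (fun t => eigenProj (x (γ t))) (eigenProjDeriv (x q) (vdiff x q v)) 0 := by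
      have h := ((h1.mul h1).const_smul (-(1 / 2) : ℂ)).add (h1.const_smul (Complex.I / 2))
      rw [h0] at h
      refine h.congr_deriv ?_
      rw [eigenProjDeriv, add_comm (x q * _)]
      rfl
    have h4 := hasDerivAt_grassMap h3 (by rw [h0]; exact hq.1)
    rw [h0] at h4
    have hK := grassMap_mul hPP (hRR q) hq.1 hq.2
    refine (h2.unique h4).trans ?_
    -- Writing `R' = R'R + RR'`, the second summand is killed because `KR = 0`.
    conv_lhs => rw [eigenProjDeriv_eq (hc q) (hV q v)]
    rw [mul_add, ← mul_assoc _ (eigenProj (x q)) (eigenProjDeriv _ _), hK, zero_mul, add_zero]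
    simp only [mul_assoc]
  refine ⟨_, U, hUo, hpU, hsm, fun q hq v => ?_, ?_⟩
  · rw [hd q hq, hd q hq, hJ, eigenProj_relation (hc q) (grassMap_mul hPP (hRR q) hq.1 hq.2),
      smul_mul_assoc]
  · refine (injective_iff_map_eq_zero _).2 fun v hv => hinj p v ?_
    refine mul_eigenProj_eq_zero (hc p) (hV p v) ?_
    rw [hd p hpU, ← hP] at hv
    have h : P * P * P + (1 - P) = 1 := by rw [hPP, hPP, add_sub_cancel]
    rw [grassMap, h, Ring.inverse_one, mul_one, mul_one, hPP, hPP] at hv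
    simpa only [mul_assoc, hPP] using hv

end

end AlmostComplexGeometry

/-! ### Complexification of the matrices and integrability of `J⁺`. -/

namespace HypTwistor

open AlmostComplexGeometry

/-- The algebra of complex matrices with a normed structure. -/
def CMat (n : ℕ) : Type := Matrix (LIdx n) (LIdx n) ℂ

section
attribute [local instance] Matrix.linftyOpNormedRing Matrix.linftyOpNormedAlgebra

noncomputable instance (n : ℕ) : NormedRing (CMat n) :=
  inferInstanceAs (NormedRing (Matrix (LIdx n) (LIdx n) ℂ))
noncomputable instance (n : ℕ) : NormedAlgebra ℂ (CMat n) :=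
  inferInstanceAs (NormedAlgebra ℂ (Matrix (LIdx n) (LIdx n) ℂ))
instance (n : ℕ) : FiniteDimensional ℂ (CMat n) :=
  inferInstanceAs (FiniteDimensional ℂ (Matrix (LIdx n) (LIdx n) ℂ))
end

/-- The complexification of real matrices. -/
noncomputable def cMap (n : ℕ) : LMat n →+* CMat n := Complex.ofRealHom.mapMatrix

/-- The complexification of real matrices as a continuous linear map. -/
noncomputable def cMapL (n : ℕ) : AMat n →L[ℝ] CMat n :=
  have : FiniteDimensional ℝ (AMat n) := inferInstanceAs (FiniteDimensional ℝ (LMat n))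
  LinearMap.toContinuousLinearMap
    { toFun := fun A => cMap n A
      map_add' := fun A B => map_add (cMap n) A B
      map_smul' := fun c A => by
        refine Matrix.ext fun i j => ?_
        exact Complex.ofReal_mul c _ }

theorem vdiff_cMap {n : ℕ} (p : Twistor n) (v : TangentSpace 𝓘(ℝ, Model n) p) :
    vdiff (fun q => cMapL n (matOf q)) p v = cMap n (tangentMat p v) := by
  rw [tangentMat_eq_mfderiv]
  have h := mfderiv_comp_apply (I := 𝓘(ℝ, Model n)) (I' := 𝓘(ℝ, AMat n)) (I'' := 𝓘(ℝ, CMat n)) p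
    (g := cMapL n) (f := matOf) ((cMapL n).contMDiff.mdifferentiableAt one_ne_zero)
    ((contMDiff_val n).mdifferentiable (by simp) p) v
  rw [mfderiv_eq_fderiv, (cMapL n).fderiv] at h
  exact h

/-- As `V` and `x` are real, the imaginary part of the product is `½Vx`. -/
theorem cMap_mul_eigenProj {n : ℕ} {x V : LMat n} (h : cMap n V * eigenProj (cMap n x) = 0) :
    V * x = 0 := by
  have h1 : (-(1 / 2) : ℂ) • cMap n (V * (x * x)) + (Complex.I / 2) • cMap n (V * x) = 0 := by
    rw [map_mul, map_mul, map_mul, ← h, eigenProj, mul_add, mul_smul_comm, mul_smul_comm]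
  ext i j
  have h2 : (-(1 / 2) : ℂ) * ((V * (x * x)) i j : ℂ) + (Complex.I / 2) * ((V * x) i j : ℂ) = 0 :=
    congrFun (congrFun h1 i) j
  have h3 := congrArg Complex.im h2
  simpa using h3

/-- The almost complex structure `J⁺` is integrable. -/
theorem isIntegrable_twistorJPlus (n : ℕ) : IsIntegrable (twistorJPlus n) := by
  have hc : ∀ p : Twistor n, p.1 * (p.1 * p.1) = -p.1 := fun p => by
    rw [← mul_assoc]; exact orbit_cube p.2
  have hx : ∀ p : Twistor n, cMapL n (matOf p) = cMap n p.1 := fun _ => rfl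
  apply isIntegrable_of_cube (x := fun p => cMapL n (matOf p))
  · exact (cMapL n).contMDiff.comp (contMDiff_val n)
  · intro p
    rw [hx, ← map_mul, ← map_mul, hc, map_neg]
  · intro p v
    rw [vdiff_cMap, hx]
    have h := congrArg (cMap n) (tangentMat_rel p v)
    simpa only [map_mul, map_add, map_neg] using h
  · intro p v
    have h := tangentMat_twistorJ 1 p v
    rw [matJ, one_smul] at h
    rw [vdiff_cMap, vdiff_cMap, hx, twistorJPlus, h]
    simp only [map_mul, map_add, map_neg, map_sub, map_one]
  · intro p v h
    rw [vdiff_cMap, hx] at h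
    have h1 := cMap_mul_eigenProj h
    have h2 := tangentMat_eta p v
    have h3 := orbit_eta p.2
    have h4 := tangentMat_rel p v
    apply tangentMat_injective p
    rw [map_zero]
    generalize tangentMat p v = V at *
    generalize p.1 = x at *
    -- Transposing `Vx = 0` with respect to `η`, for which both matrices are skew, gives `xV = 0`;
    -- the tangency relation then leaves `V = 0`.
    have h5 : x * V = 0 := by
      have e : eta n * (x * V) = 0 := by
        calc eta n * (x * V) = -(xᵀ * eta n) * V := by rw [h3]; noncomm_ring
          _ = xᵀ * (-(eta n * V)) := by noncomm_ring
          _ = (V * x)ᵀ * eta n := by rw [← h2, Matrix.transpose_mul, mul_assoc]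
          _ = 0 := by rw [h1]; simp
      rw [← one_mul (x * V), ← eta_sq, mul_assoc, e, mul_zero]
    rw [h1, h5, mul_assoc x x V, h5] at h4
    simpa using h4.symm

end HypTwistor

theorem mainTheorem2 (n : ℕ) (hn : 1 ≤ n) :
    AlmostComplexGeometry.IsSymplectic (HypTwistor.kks n) ∧
    (AlmostComplexGeometry.IsAlmostComplex (HypTwistor.twistorJPlus n) ∧
      AlmostComplexGeometry.IsCompatible (HypTwistor.kks n) (HypTwistor.twistorJPlus n) ∧
      AlmostComplexGeometry.IsIntegrable (HypTwistor.twistorJPlus n) ∧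
      ¬ AlmostComplexGeometry.IsPositive (HypTwistor.kks n) (HypTwistor.twistorJPlus n)) ∧
    (AlmostComplexGeometry.IsAlmostComplex (HypTwistor.twistorJMinus n) ∧
      AlmostComplexGeometry.IsPositive (HypTwistor.kks n) (HypTwistor.twistorJMinus n) ∧
      AlmostComplexGeometry.IsCompatible (HypTwistor.kks n) (HypTwistor.twistorJMinus n) ∧
      (2 ≤ n → AlmostComplexGeometry.IsMaximallyNonIntegrable (HypTwistor.twistorJMinus n))) := by
  exact ⟨HypTwistor.isSymplectic_kks n,
    ⟨HypTwistor.isAlmostComplex_twistorJ n (by norm_num), HypTwistor.isCompatible_twistorJ n 1,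
      HypTwistor.isIntegrable_twistorJPlus n, HypTwistor.not_isPositive_twistorJPlus hn⟩,
    ⟨HypTwistor.isAlmostComplex_twistorJ n (by norm_num), HypTwistor.isPositive_twistorJMinus n,
      HypTwistor.isCompatible_twistorJ n (-1),
      fun h => HypTwistor.isMaximallyNonIntegrable_twistorJMinus h⟩⟩
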